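/- **Theorem.** The rooted conjunctive query entailment problem is $\mathrm{coNExpTime}$-hard (in combined complexity) for the description logic $\mathcal{ALC}\mathsf{Self}$, and hence also for the description logic $\mathcal{ZIQ}$. Here the notions are as follows. Fix countably infinite, pairwise disjoint sets of individual names, concept names, role names and variables. An interpretation $\mathcal I$ has a non-empty domain $\Delta^{\mathcal I}$ and maps individual names $a$ to elements $a^{\mathcal I}$, concept names $A$ to subsets $A^{\mathcal I}$ and role names $r$ to binary relations $r^{\mathcal I}$ of $\Delta^{\mathcal I}$ (distinct individual names may denote the same element). *$\mathcal{ALC}\mathsf{Self}$.* Concepts are given by $C ::= \bot \mid A \mid \neg C \mid C\sqcap C \mid \exists r.C \mid \exists r.\mathsf{Self}$ with $A$ a concept name and $r$ a role name; $d\in(\exists r.C)^{\mathcal I}$ iff $(d,e)\in r^{\mathcal I}$ for some $e\in C^{\mathcal I}$, and $d\in(\exists r.\mathsf{Self})^{\mathcal I}$ iff $(d,d)\in r^{\mathcal I}$. A TBox is a finite set of inclusions $C\sqsubseteq D$ of concepts, with the meaning $C^{\mathcal I}\subseteq D^{\mathcal I}$. *$\mathcal{ZIQ}$.* Simple roles are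 given by $s ::= r \mid s^- \mid s\cap s\mid s\cup s\mid s\setminus s$. Concepts are given by $C ::= \bot\mid A\mid\neg C\mid C\sqcap C\mid \exists s.C\mid ({\ge} n\ s).C\mid\exists s.\mathsf{Self}\mid\exists\mathcal A.C$, where $n\in\mathbb N$, $s$ is a simple role and $\mathcal A$ is a nondeterministic finite automaton whose letters are simple roles and tests $D?$ for concepts $D$; $d\in(({\ge}n\ s).C)^{\mathcal I}$ iff at least $n$ elements $e\in C^{\mathcal I}$ satisfy $(d,e)\in s^{\mathcal I}$, and $d\in(\exists\mathcal A.C)^{\mathcal I}$ iff some path from $d$ to some $e\in C^{\mathcal I}$ (possibly of length $0$) realises a word accepted by $\mathcal A$, where a role letter is read along an $s^{\mathcal I}$-edge and a test $D?$ is read at an element of $D^{\mathcal I}$. A TBox is a finite set of inclusions $C\sqsubseteq D$ of concepts and $s\subseteq t$ of simple roles. In both logics a knowledge base $\mathcal K=(\mathcal A,\mathcal T)$ consists of a TBox $\mathcal T$ and a finite ABox $\mathcal A$ of axioms $A(a)$, $r(a,b)$, $a\approx b$ and negations of such axioms. A conjunctive query is a non-empty finite conjunction of atoms $A(x)$ and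 $r(x,y)$ with $A$ a concept name, $r$ a role name, and $x,y$ variables or individual names; it is *rooted* if at least one individual name occurs in it and its query graph (nodes: the terms that occur in the query; edges: the pairs that occur together in a role atom) is connected. $\mathcal K$ *entails* $q$ if in every model of $\mathcal K$ there is an assignment of the variables that makes $q$ true. The rooted conjunctive query entailment problem for a logic is: given a knowledge base $\mathcal K$ of this logic and a rooted conjunctive query $q$, both being part of the input, does $\mathcal K$ entail $q$? It is $\mathrm{coNExpTime}$-hard if every language over a finite alphabet whose complement is decided by a nondeterministic Turing machine in time $2^{p(n)}$, for some polynomial $p$, is reducible to it by a many-one reduction computable in deterministic polynomial time. -/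

import Mathlib

/-! ### Nondeterministic exponential time -/

/-- A nondeterministic Turing machine with one tape, infinite to the right, over the input
alphabet `α`. It halts in the accepting state and whenever no transition applies; a halting
configuration whose state is not accepting is rejecting. -/
structure NTM (α : Type) where
  /-- states -/
  Q : Type
  /-- tape symbols -/
  Γ : Type
  finQ : Finite Q
  finΓ : Finite Γ
  start : Q
  accept : Q
  blank : Γ
  /-- the inclusion of the input alphabet into the tape alphabet -/
  input : α → Γ
  input_injective : Function.Injective input
  input_ne_blank : ∀ a, input a ≠ blank
  δ : Q → Γ → Set (Q × Γ × Turing.Dir)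

namespace NTM

/-- A configuration: current state, head position, tape content. -/
structure Cfg {α : Type} (M : NTM α) where
  state : M.Q
  head : ℕ
  tape : ℕ → M.Γ

/-- Head movement; a move to the left of the leftmost cell leaves the head where it is. -/
def move : Turing.Dir → ℕ → ℕ
  | Turing.Dir.left, i => i - 1
  | Turing.Dir.right, i => i + 1

/-- The initial configuration: the input at the left end of the tape, blanks after it. -/
def init {α : Type} (M : NTM α) (w : List α) : M.Cfg where
  state := M.start
  head := 0
  tape i := (w[i]?.map M.input).getD M.blank

/-- One step of a computation. -/
def Step {α : Type} (M : NTM α) (c c' : M.Cfg) : Prop :=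
  c.state ≠ M.accept ∧
    ∃ q b d, (q, b, d) ∈ M.δ c.state (c.tape c.head) ∧
      c' = ⟨q, move d c.head, Function.update c.tape c.head b⟩

/-- `M.Reaches n c c'`: some computation of exactly `n` steps leads from `c` to `c'`. -/
def Reaches {α : Type} (M : NTM α) : ℕ → M.Cfg → M.Cfg → Prop
  | 0, c, c' => c = c'
  | n + 1, c, c' => ∃ d, M.Step c d ∧ M.Reaches n d c'

/-- `M` decides `L` in time `t`: on every input `w` every computation has at most `t |w|` steps,
and some computation is accepting exactly if `w ∈ L`. -/
def DecidesInTime {α : Type} (M : NTM α) (L : Language α) (t : ℕ → ℕ) : Prop :=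
  (∀ w n c, M.Reaches n (M.init w) c → n ≤ t w.length) ∧
    ∀ w, w ∈ L ↔ ∃ n c, M.Reaches n (M.init w) c ∧ c.state = M.accept

end NTM

/-- The class NExpTime. -/
def InNExpTime {α : Type} (L : Language α) : Prop :=
  ∃ (p : Polynomial ℕ) (M : NTM α), M.DecidesInTime L (fun n => 2 ^ p.eval n)

/-- The class coNExpTime: the complement is in NExpTime. -/
def InCoNExpTime {α : Type} (L : Language α) : Prop :=
  InNExpTime ({w | w ∉ L} : Language α)

/-- Many-one reducibility by a function computable in polynomial time by a deterministic
(multi-stack) Turing machine. -/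
def PolyTimeReducible {α β : Type} (L : Language α) (P : Language β) : Prop :=
  ∃ f : List α → List β,
    Nonempty (Turing.TM2ComputableInPolyTime (id : List α → List α) (id : List β → List β) f) ∧
      ∀ w, w ∈ L ↔ f w ∈ P

/-- Every coNExpTime language, over any finite alphabet, reduces to `P` in polynomial time. -/
def CoNExpTimeHard {β : Type} (P : Language β) : Prop :=
  ∀ (α : Type) [Fintype α] (L : Language α), InCoNExpTime L → PolyTimeReducible L P

/-! ### Description logics: syntax -/

namespace DL

/-- Names are binary words. The sets of individual names, concept names, role names and variables
are disjoint copies of this countably infinite set, told apart by where a name occurs. -/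
abbrev Name := List Bool

/-- Simple roles. -/
inductive SRole where
  | name (r : Name)
  | inv (s : SRole)
  | inter (s t : SRole)
  | union (s t : SRole)
  | diff (s t : SRole)

mutual

/-- Concepts of ZOIQ. -/
inductive Concept where
  | bot
  | name (A : Name)
  | nominal (o : Name)
  | neg (C : Concept)
  | inter (C D : Concept)
  /-- `∃s.C` -/
  | ex (s : SRole) (C : Concept)
  /-- `(≥ n s).C` -/
  | atLeast (n : ℕ) (s : SRole) (C : Concept)
  /-- `∃s.Self` -/
  | self (s : SRole)
  /-- `∃𝒜.C` -/
  | exNFA (𝒜 : NFAutomaton) (C : Concept)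

/-- Nondeterministic finite automata whose letters are simple roles and tests `C?`: the lists of
initial and of final states, extended by one transition at a time. States are named by words. -/
inductive NFAutomaton where
  | states (initial final : List Name)
  | role (q : Name) (s : SRole) (q' : Name) (𝒜 : NFAutomaton)
  | test (q : Name) (C : Concept) (q' : Name) (𝒜 : NFAutomaton)

end

/-- TBox axioms `C ⊑ D` and `s ⊆ t`. -/
inductive TAxiom where
  | gci (C D : Concept)
  | roleIncl (s t : SRole)

/-- ABox axioms `A(a)`, `r(a, b)`, `a ≈ b` and `¬α`. -/
inductive AAxiom where
  | concept (A : Name) (a : Name)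
  | role (r : Name) (a b : Name)
  | eq (a b : Name)
  | neg (α : AAxiom)

/-- Knowledge bases. -/
structure KB where
  abox : List AAxiom
  tbox : List TAxiom

/-! ### The fragments ALCSelf and ZIQ -/

/-- ALCSelf-concepts: built from `⊥`, concept names, `¬`, `⊓`, `∃r.C` and `∃r.Self` with role
names `r`. -/
def Concept.IsALCSelf : Concept → Prop
  | .bot => True
  | .name _ => True
  | .nominal _ => False
  | .neg C => C.IsALCSelf
  | .inter C D => C.IsALCSelf ∧ D.IsALCSelf
  | .ex s C => (∃ r, s = .name r) ∧ C.IsALCSelf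
  | .atLeast _ _ _ => False
  | .self s => ∃ r, s = .name r
  | .exNFA _ _ => False

mutual

/-- ZIQ-concepts: no nominals, also in the tests of automata. -/
def Concept.IsZIQ : Concept → Prop
  | .bot => True
  | .name _ => True
  | .nominal _ => False
  | .neg C => C.IsZIQ
  | .inter C D => C.IsZIQ ∧ D.IsZIQ
  | .ex _ C => C.IsZIQ
  | .atLeast _ _ C => C.IsZIQ
  | .self _ => True
  | .exNFA 𝒜 C => 𝒜.IsZIQ ∧ C.IsZIQ

/-- All tests of the automaton are ZIQ-concepts. -/
def NFAutomaton.IsZIQ : NFAutomaton → Prop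
  | .states _ _ => True
  | .role _ _ _ 𝒜 => 𝒜.IsZIQ
  | .test _ C _ 𝒜 => C.IsZIQ ∧ 𝒜.IsZIQ

end

/-- ALCSelf-KBs: the TBox consists of inclusions between ALCSelf-concepts. -/
def KB.IsALCSelf (K : KB) : Prop :=
  ∀ τ ∈ K.tbox, ∃ C D : Concept, τ = .gci C D ∧ C.IsALCSelf ∧ D.IsALCSelf

/-- ZIQ-KBs: concepts in the TBox are ZIQ-concepts; inclusions of simple roles are allowed. -/
def KB.IsZIQ (K : KB) : Prop :=
  ∀ C D : Concept, TAxiom.gci C D ∈ K.tbox → C.IsZIQ ∧ D.IsZIQ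

/-! ### Semantics -/

/-- Interpretations with domain `Δ`. The domain is non-empty as it interprets individual names;
distinct names may denote the same element. -/
structure Interp (Δ : Type) where
  ind : Name → Δ
  con : Name → Set Δ
  rol : Name → Set (Δ × Δ)

/-- The interpretation of simple roles. -/
def SRole.sem {Δ : Type} (I : Interp Δ) : SRole → Set (Δ × Δ)
  | .name r => I.rol r
  | .inv s => {p | (p.2, p.1) ∈ s.sem I}
  | .inter s t => s.sem I ∩ t.sem I
  | .union s t => s.sem I ∪ t.sem I
  | .diff s t => s.sem I \ t.sem I

def NFAutomaton.initial : NFAutomaton → List Name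
  | .states i _ => i
  | .role _ _ _ 𝒜 => 𝒜.initial
  | .test _ _ _ 𝒜 => 𝒜.initial

def NFAutomaton.final : NFAutomaton → List Name
  | .states _ f => f
  | .role _ _ _ 𝒜 => 𝒜.final
  | .test _ _ _ 𝒜 => 𝒜.final

mutual

/-- The interpretation of concepts. For `∃𝒜.C`, a path from `d` to `e` that realises `𝒜` is an
accepting run of `𝒜` that moves along the letters it reads, from `d` to `e`. -/
def Concept.sem {Δ : Type} (I : Interp Δ) : Concept → Set Δ
  | .bot => ∅
  | .name A => I.con A
  | .nominal o => {I.ind o}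
  | .neg C => (C.sem I)ᶜ
  | .inter C D => C.sem I ∩ D.sem I
  | .ex s C => {d | ∃ e, e ∈ C.sem I ∧ (d, e) ∈ s.sem I}
  | .atLeast n s C => {d | (n : ℕ∞) ≤ {e | e ∈ C.sem I ∧ (d, e) ∈ s.sem I}.encard}
  | .self s => {d | (d, d) ∈ s.sem I}
  | .exNFA 𝒜 C => {d | ∃ q ∈ 𝒜.initial, ∃ q' ∈ 𝒜.final, ∃ e ∈ C.sem I,
      Relation.ReflTransGen (𝒜.step I) (q, d) (q', e)}

/-- One step of a run of an automaton in an interpretation: reading a role leads from an element to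
one related to it by the role; reading a test `C?` stays at an element of `C`. -/
def NFAutomaton.step {Δ : Type} (I : Interp Δ) : NFAutomaton → Name × Δ → Name × Δ → Prop
  | .states _ _ => fun _ _ => False
  | .role q s q' 𝒜 => fun x y =>
      (x.1 = q ∧ y.1 = q' ∧ (x.2, y.2) ∈ s.sem I) ∨ 𝒜.step I x y
  | .test q C q' 𝒜 => fun x y =>
      (x.1 = q ∧ y.1 = q' ∧ x.2 = y.2 ∧ x.2 ∈ C.sem I) ∨ 𝒜.step I x y

end

def TAxiom.Holds {Δ : Type} (I : Interp Δ) : TAxiom → Prop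
  | .gci C D => C.sem I ⊆ D.sem I
  | .roleIncl s t => s.sem I ⊆ t.sem I

def AAxiom.Holds {Δ : Type} (I : Interp Δ) : AAxiom → Prop
  | .concept A a => I.ind a ∈ I.con A
  | .role r a b => (I.ind a, I.ind b) ∈ I.rol r
  | .eq a b => I.ind a = I.ind b
  | .neg α => ¬ α.Holds I

/-- `I` is a model of `K`. -/
def KB.Models {Δ : Type} (I : Interp Δ) (K : KB) : Prop :=
  (∀ α ∈ K.abox, α.Holds I) ∧ ∀ τ ∈ K.tbox, τ.Holds I

/-! ### Conjunctive queries -/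

inductive Term where
  | var (x : Name)
  | ind (a : Name)

/-- Conjunctive queries. -/
inductive CQ where
  | concept (A : Name) (t : Term)
  | role (r : Name) (t u : Term)
  | and (q q' : CQ)

/-- The terms that occur in a query. -/
def CQ.terms : CQ → Set Term
  | .concept _ t => {t}
  | .role _ t u => {t, u}
  | .and q q' => q.terms ∪ q'.terms

/-- The query has an atom `r(t, u)` for some role name `r`. -/
def CQ.HasRoleAtom : CQ → Term → Term → Prop
  | .concept _ _ => fun _ _ => False
  | .role _ t u => fun t' u' => t' = t ∧ u' = u
  | .and q q' => fun t u => q.HasRoleAtom t u ∨ q'.HasRoleAtom t u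

/-- The query graph: its nodes are the terms of the query, two of them being adjacent if they occur
together in a role atom. -/
def CQ.graph (q : CQ) : SimpleGraph q.terms :=
  SimpleGraph.fromRel fun t u => q.HasRoleAtom t u

/-- A query is rooted if it has an individual name and its query graph is connected. -/
def CQ.IsRooted (q : CQ) : Prop :=
  (∃ a, Term.ind a ∈ q.terms) ∧ q.graph.Connected

def Term.sem {Δ : Type} (I : Interp Δ) (η : Name → Δ) : Term → Δ
  | .var x => η x
  | .ind a => I.ind a

/-- The query is true in `I` under the assignment `η` of the variables. -/
def CQ.Holds {Δ : Type} (I : Interp Δ) (η : Name → Δ) : CQ → Prop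
  | .concept A t => t.sem I η ∈ I.con A
  | .role r t u => (t.sem I η, u.sem I η) ∈ I.rol r
  | .and q q' => q.Holds I η ∧ q'.Holds I η

/-- Every model of `K` has a match of `q`. -/
def KB.Entails (K : KB) (q : CQ) : Prop :=
  ∀ (Δ : Type) (I : Interp Δ), K.Models I → ∃ η, q.Holds I η

/-! ### Inputs as words over a finite alphabet -/

/-- The symbols used to write down knowledge bases and queries, in prefix notation. -/
inductive Sym where
  | bit (b : Bool)
  | endName
  | name
  | inv
  | inter
  | union
  | diff
  | bot
  | nominal
  | neg
  | ex
  | atLeast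
  | self
  | nfa
  | role
  | test
  | incl
  | eq
  | var
  | cons
  | nil
  deriving DecidableEq, Fintype

def Name.enc (w : Name) : List Sym := w.map Sym.bit ++ [.endName]

/-- Lists, with an encoding of the entries. -/
def listEnc {α : Type} (enc : α → List Sym) : List α → List Sym
  | [] => [.nil]
  | a :: l => .cons :: (enc a ++ listEnc enc l)

def SRole.enc : SRole → List Sym
  | .name r => .name :: Name.enc r
  | .inv s => .inv :: s.enc
  | .inter s t => .inter :: (s.enc ++ t.enc)
  | .union s t => .union :: (s.enc ++ t.enc)
  | .diff s t => .diff :: (s.enc ++ t.enc)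

mutual

/-- Numbers are written in binary. -/
def Concept.enc : Concept → List Sym
  | .bot => [.bot]
  | .name A => .name :: Name.enc A
  | .nominal o => .nominal :: Name.enc o
  | .neg C => .neg :: C.enc
  | .inter C D => .inter :: (C.enc ++ D.enc)
  | .ex s C => .ex :: (s.enc ++ C.enc)
  | .atLeast n s C => .atLeast :: (Name.enc (Computability.encodeNat n) ++ (s.enc ++ C.enc))
  | .self s => .self :: s.enc
  | .exNFA 𝒜 C => .nfa :: (𝒜.enc ++ C.enc)

def NFAutomaton.enc : NFAutomaton → List Sym
  | .states i f => .nil :: (listEnc Name.enc i ++ listEnc Name.enc f)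
  | .role q s q' 𝒜 => .role :: (Name.enc q ++ (s.enc ++ (Name.enc q' ++ 𝒜.enc)))
  | .test q C q' 𝒜 => .test :: (Name.enc q ++ (C.enc ++ (Name.enc q' ++ 𝒜.enc)))

end

def TAxiom.enc : TAxiom → List Sym
  | .gci C D => .incl :: (C.enc ++ D.enc)
  | .roleIncl s t => .role :: (s.enc ++ t.enc)

def AAxiom.enc : AAxiom → List Sym
  | .concept A a => .name :: (Name.enc A ++ Name.enc a)
  | .role r a b => .role :: (Name.enc r ++ (Name.enc a ++ Name.enc b))
  | .eq a b => .eq :: (Name.enc a ++ Name.enc b)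
  | .neg α => .neg :: α.enc

def Term.enc : Term → List Sym
  | .var x => .var :: Name.enc x
  | .ind a => .name :: Name.enc a

def CQ.enc : CQ → List Sym
  | .concept A t => .name :: (Name.enc A ++ t.enc)
  | .role r t u => .role :: (Name.enc r ++ (t.enc ++ u.enc))
  | .and q q' => .inter :: (q.enc ++ q'.enc)

/-- The word that represents the input `(K, q)`; ABox, TBox and query all count for its length. -/
def encInput (K : KB) (q : CQ) : List Sym :=
  listEnc AAxiom.enc K.abox ++ (listEnc TAxiom.enc K.tbox ++ q.enc)

/-- The rooted conjunctive query entailment problem for the description logic whose knowledge bases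
are those that satisfy `IsKB`: given such a knowledge base and a rooted conjunctive query, is the
query entailed? -/
def RootedCQEntailment (IsKB : KB → Prop) : Language Sym :=
  {w | ∃ (K : KB) (q : CQ), w = encInput K q ∧ IsKB K ∧ q.IsRooted ∧ K.Entails q}

/-! ### Inputs can be read off from the words that represent them -/

theorem Name.enc_inj : ∀ (x y : Name) (u v : List Sym),
    Name.enc x ++ u = Name.enc y ++ v → x = y ∧ u = v
  | [], [], u, v, h => by simpa [Name.enc] using h
  | [], b :: y, u, v, h => by simp [Name.enc] at h
  | a :: x, [], u, v, h => by simp [Name.enc] at h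
  | a :: x, b :: y, u, v, h => by
      have h' : a = b ∧ Name.enc x ++ u = Name.enc y ++ v := by simpa [Name.enc] using h
      obtain ⟨e₁, e₂⟩ := Name.enc_inj x y u v h'.2
      exact ⟨by rw [h'.1, e₁], e₂⟩

theorem listEnc_inj {α : Type} (enc : α → List Sym)
    (henc : ∀ x y u v, enc x ++ u = enc y ++ v → x = y ∧ u = v) :
    ∀ (x y : List α) (u v : List Sym), listEnc enc x ++ u = listEnc enc y ++ v → x = y ∧ u = v
  | [], [], u, v, h => by simpa [listEnc] using h
  | [], b :: y, u, v, h => by simp [listEnc] at h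
  | a :: x, [], u, v, h => by simp [listEnc] at h
  | a :: x, b :: y, u, v, h => by
      simp only [listEnc, List.cons_append, List.append_assoc, List.cons.injEq, true_and] at h
      obtain ⟨e₁, h⟩ := henc _ _ _ _ h
      obtain ⟨e₂, h⟩ := listEnc_inj enc henc _ _ _ _ h
      exact ⟨by rw [e₁, e₂], h⟩

theorem SRole.enc_inj (x : SRole) : ∀ (y : SRole) (u v : List Sym),
    x.enc ++ u = y.enc ++ v → x = y ∧ u = v := by
  induction x with
  | name r =>
    intro y u v h
    cases y <;> simp [SRole.enc] at h ⊢
    exact Name.enc_inj _ _ _ _ h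
  | inv s ih =>
    intro y u v h
    cases y <;> simp [SRole.enc] at h ⊢
    exact ih _ _ _ h
  | inter s t ih₁ ih₂ =>
    intro y u v h
    cases y <;> simp [SRole.enc] at h ⊢
    obtain ⟨e, h⟩ := ih₁ _ _ _ h
    exact ⟨⟨e, (ih₂ _ _ _ h).1⟩, (ih₂ _ _ _ h).2⟩
  | union s t ih₁ ih₂ =>
    intro y u v h
    cases y <;> simp [SRole.enc] at h ⊢
    obtain ⟨e, h⟩ := ih₁ _ _ _ h
    exact ⟨⟨e, (ih₂ _ _ _ h).1⟩, (ih₂ _ _ _ h).2⟩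
  | diff s t ih₁ ih₂ =>
    intro y u v h
    cases y <;> simp [SRole.enc] at h ⊢
    obtain ⟨e, h⟩ := ih₁ _ _ _ h
    exact ⟨⟨e, (ih₂ _ _ _ h).1⟩, (ih₂ _ _ _ h).2⟩

theorem encodeNat_inj (m n : ℕ) (h : Computability.encodeNat m = Computability.encodeNat n) :
    m = n := by
  rw [← Computability.decode_encodeNat m, h, Computability.decode_encodeNat]

mutual

theorem Concept.enc_inj : ∀ (x y : Concept) (u v : List Sym),
    x.enc ++ u = y.enc ++ v → x = y ∧ u = v
  | .bot, y, u, v, h => by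
      cases y <;> simp [Concept.enc] at h ⊢
      exact h
  | .name A, y, u, v, h => by
      cases y <;> simp [Concept.enc] at h ⊢
      exact Name.enc_inj _ _ _ _ h
  | .nominal o, y, u, v, h => by
      cases y <;> simp [Concept.enc] at h ⊢
      exact Name.enc_inj _ _ _ _ h
  | .neg C, y, u, v, h => by
      cases y <;> simp [Concept.enc] at h ⊢
      exact Concept.enc_inj C _ _ _ h
  | .inter C D, y, u, v, h => by
      cases y <;> simp [Concept.enc] at h ⊢
      obtain ⟨e₁, h⟩ := Concept.enc_inj C _ _ _ h
      obtain ⟨e₂, h⟩ := Concept.enc_inj D _ _ _ h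
      exact ⟨⟨e₁, e₂⟩, h⟩
  | .ex s C, y, u, v, h => by
      cases y <;> simp [Concept.enc] at h ⊢
      obtain ⟨e₁, h⟩ := SRole.enc_inj s _ _ _ h
      obtain ⟨e₂, h⟩ := Concept.enc_inj C _ _ _ h
      exact ⟨⟨e₁, e₂⟩, h⟩
  | .atLeast n s C, y, u, v, h => by
      cases y <;> simp [Concept.enc] at h ⊢
      obtain ⟨e₀, h⟩ := Name.enc_inj _ _ _ _ h
      obtain ⟨e₁, h⟩ := SRole.enc_inj s _ _ _ h
      obtain ⟨e₂, h⟩ := Concept.enc_inj C _ _ _ h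
      exact ⟨⟨encodeNat_inj _ _ e₀, e₁, e₂⟩, h⟩
  | .self s, y, u, v, h => by
      cases y <;> simp [Concept.enc] at h ⊢
      exact SRole.enc_inj s _ _ _ h
  | .exNFA 𝒜 C, y, u, v, h => by
      cases y <;> simp [Concept.enc] at h ⊢
      obtain ⟨e₁, h⟩ := NFAutomaton.enc_inj 𝒜 _ _ _ h
      obtain ⟨e₂, h⟩ := Concept.enc_inj C _ _ _ h
      exact ⟨⟨e₁, e₂⟩, h⟩

theorem NFAutomaton.enc_inj : ∀ (x y : NFAutomaton) (u v : List Sym),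
    x.enc ++ u = y.enc ++ v → x = y ∧ u = v
  | .states i f, y, u, v, h => by
      cases y <;> simp [NFAutomaton.enc] at h ⊢
      obtain ⟨e₁, h⟩ := listEnc_inj _ Name.enc_inj _ _ _ _ h
      obtain ⟨e₂, h⟩ := listEnc_inj _ Name.enc_inj _ _ _ _ h
      exact ⟨⟨e₁, e₂⟩, h⟩
  | .role q s q' 𝒜, y, u, v, h => by
      cases y <;> simp [NFAutomaton.enc] at h ⊢
      obtain ⟨e₁, h⟩ := Name.enc_inj _ _ _ _ h
      obtain ⟨e₂, h⟩ := SRole.enc_inj s _ _ _ h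
      obtain ⟨e₃, h⟩ := Name.enc_inj _ _ _ _ h
      obtain ⟨e₄, h⟩ := NFAutomaton.enc_inj 𝒜 _ _ _ h
      exact ⟨⟨e₁, e₂, e₃, e₄⟩, h⟩
  | .test q C q' 𝒜, y, u, v, h => by
      cases y <;> simp [NFAutomaton.enc] at h ⊢
      obtain ⟨e₁, h⟩ := Name.enc_inj _ _ _ _ h
      obtain ⟨e₂, h⟩ := Concept.enc_inj C _ _ _ h
      obtain ⟨e₃, h⟩ := Name.enc_inj _ _ _ _ h
      obtain ⟨e₄, h⟩ := NFAutomaton.enc_inj 𝒜 _ _ _ h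
      exact ⟨⟨e₁, e₂, e₃, e₄⟩, h⟩

end

theorem TAxiom.enc_inj (x y : TAxiom) (u v : List Sym) (h : x.enc ++ u = y.enc ++ v) :
    x = y ∧ u = v := by
  cases x <;> cases y <;> simp [TAxiom.enc] at h ⊢
  · obtain ⟨e₁, h⟩ := Concept.enc_inj _ _ _ _ h
    obtain ⟨e₂, h⟩ := Concept.enc_inj _ _ _ _ h
    exact ⟨⟨e₁, e₂⟩, h⟩
  · obtain ⟨e₁, h⟩ := SRole.enc_inj _ _ _ _ h
    obtain ⟨e₂, h⟩ := SRole.enc_inj _ _ _ _ h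
    exact ⟨⟨e₁, e₂⟩, h⟩

theorem AAxiom.enc_inj : ∀ (x y : AAxiom) (u v : List Sym),
    x.enc ++ u = y.enc ++ v → x = y ∧ u = v
  | .concept A a, y, u, v, h => by
      cases y <;> simp [AAxiom.enc] at h ⊢
      obtain ⟨e₁, h⟩ := Name.enc_inj _ _ _ _ h
      obtain ⟨e₂, h⟩ := Name.enc_inj _ _ _ _ h
      exact ⟨⟨e₁, e₂⟩, h⟩
  | .role r a b, y, u, v, h => by
      cases y <;> simp [AAxiom.enc] at h ⊢
      obtain ⟨e₁, h⟩ := Name.enc_inj _ _ _ _ h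
      obtain ⟨e₂, h⟩ := Name.enc_inj _ _ _ _ h
      obtain ⟨e₃, h⟩ := Name.enc_inj _ _ _ _ h
      exact ⟨⟨e₁, e₂, e₃⟩, h⟩
  | .eq a b, y, u, v, h => by
      cases y <;> simp [AAxiom.enc] at h ⊢
      obtain ⟨e₁, h⟩ := Name.enc_inj _ _ _ _ h
      obtain ⟨e₂, h⟩ := Name.enc_inj _ _ _ _ h
      exact ⟨⟨e₁, e₂⟩, h⟩
  | .neg α, y, u, v, h => by
      cases y <;> simp [AAxiom.enc] at h ⊢
      exact AAxiom.enc_inj α _ _ _ h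

theorem Term.enc_inj (x y : Term) (u v : List Sym) (h : x.enc ++ u = y.enc ++ v) :
    x = y ∧ u = v := by
  cases x <;> cases y <;> simp [Term.enc] at h ⊢
  · exact Name.enc_inj _ _ _ _ h
  · exact Name.enc_inj _ _ _ _ h

theorem CQ.enc_inj : ∀ (x y : CQ) (u v : List Sym), x.enc ++ u = y.enc ++ v → x = y ∧ u = v
  | .concept A t, y, u, v, h => by
      cases y <;> simp [CQ.enc] at h ⊢
      obtain ⟨e₁, h⟩ := Name.enc_inj _ _ _ _ h
      obtain ⟨e₂, h⟩ := Term.enc_inj _ _ _ _ h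
      exact ⟨⟨e₁, e₂⟩, h⟩
  | .role r s t, y, u, v, h => by
      cases y <;> simp [CQ.enc] at h ⊢
      obtain ⟨e₁, h⟩ := Name.enc_inj _ _ _ _ h
      obtain ⟨e₂, h⟩ := Term.enc_inj _ _ _ _ h
      obtain ⟨e₃, h⟩ := Term.enc_inj _ _ _ _ h
      exact ⟨⟨e₁, e₂, e₃⟩, h⟩
  | .and q q', y, u, v, h => by
      cases y <;> simp [CQ.enc] at h ⊢
      obtain ⟨e₁, h⟩ := CQ.enc_inj q _ _ _ h
      obtain ⟨e₂, h⟩ := CQ.enc_inj q' _ _ _ h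
      exact ⟨⟨e₁, e₂⟩, h⟩

/-- Distinct inputs are represented by distinct words. -/
theorem encInput_inj (K K' : KB) (q q' : CQ) (h : encInput K q = encInput K' q') :
    K = K' ∧ q = q' := by
  obtain ⟨e₁, h⟩ := listEnc_inj _ AAxiom.enc_inj _ _ _ _ h
  obtain ⟨e₂, h⟩ := listEnc_inj _ TAxiom.enc_inj _ _ _ _ h
  refine ⟨?_, (CQ.enc_inj q q' [] [] (by simpa using h)).1⟩
  cases K
  cases K'
  simp only at e₁ e₂
  rw [e₁, e₂]

end DL

/-!
The short accepting computations of a nondeterministic Turing machine are the tilings of a square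
of side `2 ^ N` in which each row constrains the next one and the input determines the first row.
As `N` may be polynomial in the length of the input, it remains to reduce the existence of such
tilings to the existence of a model of a knowledge base without a match of a rooted query.

The knowledge base requires a tree of depth `N` that has a leaf for every cell of the square and
every triple of tiles. Each leaf makes a claim that consists of a cell and a tile. For a triple
`(a, b, c)`, the claim is either negative, denying that one of three consecutive cells has its tile
`a`, `b` or `c`, or positive, asserting an admissible tile for the cell of the next row; the leaves
in the last row assert the tiles of the first one. If no positive claim coincides with a negative
one, then a leaf whose triple consists of asserted tiles has to make a positive claim, so that a
tiling can be read off row by row. Conversely, in the model given by a tiling, a leaf asserts the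
tile of the next row if its triple agrees with the tiling, and denies one of its tiles otherwise.

The query has a match if and only if some positive claim has the same bits as a negative one. It
contains a gadget for each bit, with one block for each of the two values. All bits are at the same
distance from the root, so that two bits of the same value can be compared by a pair of paths that
meet at the root; the loops at the elements that represent bits allow the block for the other value
to collapse to a point.

The knowledge base and the query consist of repetitive parts with parameters below `N`, and can be
printed by nested loops over counters in unary.
-/

/-! ### From `𝒜ℒ𝒞Self` to `𝒵ℐ𝒬` -/

namespace DL

theorem Concept.IsALCSelf.isZIQ : ∀ {C : Concept}, C.IsALCSelf → C.IsZIQ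
  | .bot, _ => by simp [Concept.IsZIQ]
  | .name _, _ => by simp [Concept.IsZIQ]
  | .nominal _, h => by simp [Concept.IsALCSelf] at h
  | .neg C, h => by
      simp only [Concept.IsALCSelf] at h
      simpa [Concept.IsZIQ] using Concept.IsALCSelf.isZIQ h
  | .inter C D, h => by
      simp only [Concept.IsALCSelf] at h
      simpa [Concept.IsZIQ] using ⟨Concept.IsALCSelf.isZIQ h.1, Concept.IsALCSelf.isZIQ h.2⟩
  | .ex s C, h => by
      simp only [Concept.IsALCSelf] at h
      simpa [Concept.IsZIQ] using Concept.IsALCSelf.isZIQ h.2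
  | .atLeast _ _ _, h => by simp [Concept.IsALCSelf] at h
  | .self _, _ => by simp [Concept.IsZIQ]
  | .exNFA _ _, h => by simp [Concept.IsALCSelf] at h

theorem KB.IsALCSelf.isZIQ {K : KB} (h : K.IsALCSelf) : K.IsZIQ := by
  intro C D hCD
  obtain ⟨C', D', e, hC, hD⟩ := h _ hCD
  cases e
  exact ⟨hC.isZIQ, hD.isZIQ⟩

/-! ### Connected queries -/

theorem CQ.HasRoleAtom.mem_terms : ∀ {q : CQ} {t u : Term}, q.HasRoleAtom t u →
    t ∈ q.terms ∧ u ∈ q.terms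
  | .concept _ _, _, _, h => by simp [CQ.HasRoleAtom] at h
  | .role _ _ _, _, _, h => by
      simp only [CQ.HasRoleAtom] at h
      simp [CQ.terms, h.1, h.2]
  | .and _ _, _, _, .inl h => ⟨.inl h.mem_terms.1, .inl h.mem_terms.2⟩
  | .and _ _, _, _, .inr h => ⟨.inr h.mem_terms.1, .inr h.mem_terms.2⟩

theorem CQ.HasRoleAtom.reachable {q : CQ} {t u : Term} (h : q.HasRoleAtom t u) :
    q.graph.Reachable ⟨t, h.mem_terms.1⟩ ⟨u, h.mem_terms.2⟩ := by
  by_cases e : t = u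
  · subst e
    exact SimpleGraph.Reachable.refl _
  · apply SimpleGraph.Adj.reachable
    rw [CQ.graph, SimpleGraph.fromRel_adj]
    exact ⟨by simpa using e, .inl h⟩

theorem CQ.graph_reachable_of_eqvGen {q : CQ} {t u : Term}
    (h : Relation.EqvGen q.HasRoleAtom t u) (ht : t ∈ q.terms) (hu : u ∈ q.terms) :
    q.graph.Reachable ⟨t, ht⟩ ⟨u, hu⟩ := by
  have key : t = u ∨ ∃ (ht : t ∈ q.terms) (hu : u ∈ q.terms),
      q.graph.Reachable ⟨t, ht⟩ ⟨u, hu⟩ := by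
    clear ht hu
    induction h with
    | rel _ _ h => exact .inr ⟨h.mem_terms.1, h.mem_terms.2, h.reachable⟩
    | refl _ => exact .inl rfl
    | symm _ _ _ ih =>
      obtain rfl | ⟨ht, hu, h⟩ := ih
      exacts [.inl rfl, .inr ⟨hu, ht, h.symm⟩]
    | trans _ _ _ _ _ ih ih' =>
      obtain rfl | ⟨ht, hu, h⟩ := ih
      · exact ih'
      · obtain rfl | ⟨_, hv, h'⟩ := ih'
        exacts [.inr ⟨ht, hu, h⟩, .inr ⟨ht, hv, h.trans h'⟩]
  obtain rfl | ⟨_, _, h⟩ := key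
  exacts [.refl _, h]

namespace Reduction

/-- The terms that occur in a list of queries. -/
def terms (l : List CQ) : Set Term := {t | ∃ q ∈ l, t ∈ q.terms}

/-- Two terms are linked if the role atoms of a list of queries connect them. -/
def Linked (l : List CQ) : Term → Term → Prop :=
  Relation.EqvGen fun t u => ∃ q ∈ l, q.HasRoleAtom t u

/-- The query graph of the conjunction of a list of queries is connected or empty. -/
def IsConnected (l : List CQ) : Prop := ∀ t ∈ terms l, ∀ u ∈ terms l, Linked l t u

@[simp] theorem terms_nil : terms [] = ∅ := by
  simp [terms]

@[simp] theorem terms_cons (q : CQ) (l : List CQ) : terms (q :: l) = q.terms ∪ terms l := by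
  ext t
  simp [terms]

@[simp] theorem terms_append (l m : List CQ) : terms (l ++ m) = terms l ∪ terms m := by
  ext t
  simp [terms, or_and_right, exists_or]

theorem terms_mono {l m : List CQ} (h : l ⊆ m) : terms l ⊆ terms m :=
  fun _ ⟨q, hq, ht⟩ => ⟨q, h hq, ht⟩

theorem Linked.mono {l m : List CQ} (h : l ⊆ m) {t u : Term} (htu : Linked l t u) :
    Linked m t u :=
  Relation.EqvGen.mono (fun _ _ ⟨q, hq, htu⟩ => ⟨q, h hq, htu⟩) _ _ htu

theorem IsConnected.of_linked {l : List CQ} (t : Term) (h : ∀ u ∈ terms l, Linked l t u) :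
    IsConnected l :=
  fun u hu v hv => ((h u hu).symm _ _).trans _ _ _ (h v hv)

theorem isConnected_singleton_role (r : Name) (t u : Term) : IsConnected [.role r t u] := by
  refine .of_linked t fun v hv => ?_
  obtain rfl | rfl : v = t ∨ v = u := by simpa [terms, CQ.terms] using hv
  · exact .refl _
  · exact .rel _ _ ⟨_, List.mem_singleton_self _, rfl, rfl⟩

theorem IsConnected.append {l m : List CQ} (hl : IsConnected l) (hm : IsConnected m) {t : Term}
    (htl : t ∈ terms l) (htm : t ∈ terms m) : IsConnected (l ++ m) := by
  refine .of_linked t fun u hu => ?_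
  rw [terms_append] at hu
  obtain hu | hu := hu
  · exact (hl t htl u hu).mono (by simp)
  · exact (hm t htm u hu).mono (by simp)

theorem IsConnected.append_of_terms_subset {l m : List CQ} (hl : IsConnected l)
    (h : terms m ⊆ terms l) : IsConnected (l ++ m) := by
  rw [IsConnected, terms_append, Set.union_eq_self_of_subset_right h]
  exact fun t ht u hu => (hl t ht u hu).mono (by simp)

theorem IsConnected.append_flatMap {ι : Type} {l : List CQ} {f : ι → List CQ}
    (hl : IsConnected l) {t : Term} (htl : t ∈ terms l) : ∀ {s : List ι},
    (∀ i ∈ s, IsConnected (f i)) → (∀ i ∈ s, t ∈ terms (f i)) → IsConnected (l ++ s.flatMap f)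
  | [], _, _ => by simpa using hl
  | i :: s, hf, ht => by
    rw [List.flatMap_cons, ← List.append_assoc]
    exact (hl.append (hf i (by simp)) htl (ht i (by simp))).append_flatMap
      (terms_mono (by simp) htl) (fun k hk => hf k (by simp [hk])) fun k hk => ht k (by simp [hk])

theorem isRooted_of_isConnected {q : CQ} (hq : IsConnected [q]) {a : Name}
    (ha : .ind a ∈ q.terms) : q.IsRooted := by
  refine ⟨⟨a, ha⟩, ?_⟩
  have : Nonempty q.terms := ⟨⟨_, ha⟩⟩
  refine SimpleGraph.Connected.mk fun t u => CQ.graph_reachable_of_eqvGen ?_ t.2 u.2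
  have h := hq t (by simp [terms]) u (by simp [terms])
  simpa only [Linked, List.mem_singleton, exists_eq_left] using h

/-- The conjunction of a list of queries and a last one. -/
def conjunction (l : List CQ) (q : CQ) : CQ := l.foldr .and q

theorem conjunction_holds {Δ : Type} {I : Interp Δ} {η : Name → Δ} {l : List CQ} {q : CQ} :
    (conjunction l q).Holds I η ↔ ∀ a ∈ l ++ [q], a.Holds I η := by
  induction l with
  | nil => simp [conjunction]
  | cons a l ih =>
    rw [List.cons_append, List.forall_mem_cons, ← ih]
    simp [conjunction, CQ.Holds]

theorem terms_conjunction (l : List CQ) (q : CQ) : (conjunction l q).terms = terms (l ++ [q]) := by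
  induction l with
  | nil => simp [conjunction, terms]
  | cons a l ih => rw [List.cons_append, terms_cons, ← ih]; rfl

theorem conjunction_hasRoleAtom {l : List CQ} {q : CQ} {t u : Term} :
    (conjunction l q).HasRoleAtom t u ↔ ∃ a ∈ l ++ [q], a.HasRoleAtom t u := by
  induction l with
  | nil => simp [conjunction]
  | cons a l ih =>
    rw [List.cons_append, List.exists_mem_cons_iff, ← ih]
    rfl

theorem isConnected_conjunction {l : List CQ} {q : CQ} (h : IsConnected (l ++ [q])) :
    IsConnected [conjunction l q] := by
  intro t ht u hu
  have e : terms [conjunction l q] = terms (l ++ [q]) := by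
    rw [← terms_conjunction]
    simp [terms]
  rw [e] at ht hu
  simpa only [Linked, List.mem_singleton, exists_eq_left, conjunction_hasRoleAtom] using h t ht u hu

end Reduction
end DL

namespace DL.Reduction

/-! ### Names -/

/-- The name that codes a list of numbers in unary. -/
def unaryName (l : List ℕ) : Name := l.flatMap fun a => List.replicate a true ++ [false]

theorem unaryName_cons (a : ℕ) (l : List ℕ) :
    unaryName (a :: l) = List.replicate a true ++ false :: unaryName l := by
  simp [unaryName]

theorem replicate_true_append_inj : ∀ {a b : ℕ} {u v : List Bool},
    List.replicate a true ++ false :: u = List.replicate b true ++ false :: v → a = b ∧ u = v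
  | 0, 0, _, _, h => by simpa using h
  | 0, _ + 1, _, _, h => by simp [List.replicate_succ] at h
  | _ + 1, 0, _, _, h => by simp [List.replicate_succ] at h
  | _ + 1, _ + 1, _, _, h => by
      simp only [List.replicate_succ, List.cons_append, List.cons.injEq, true_and] at h
      simpa using replicate_true_append_inj h

theorem unaryName_injective : Function.Injective unaryName
  | [], [], _ => rfl
  | [], b :: m, h => by simp [unaryName] at h
  | a :: l, [], h => by simp [unaryName] at h
  | a :: l, b :: m, h => by
    rw [unaryName_cons, unaryName_cons] at h
    obtain ⟨rfl, e⟩ := replicate_true_append_inj h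
    rw [unaryName_injective e]

/-- The two addresses of a leaf of the tree: the row and the column of a cell. -/
inductive Axis
  | row
  | column

/-- What a leaf claims: the tile of its cell, of the next cell of the row, or of the one after it
differs from the tile of its type, or the tile at the next column of the next row is admissible. -/
inductive Kind
  | left
  | middle
  | right
  | next

/-- The numbers that a leaf derives from its addresses `row` and `column`. -/
inductive Counter
  /-- `row + 1` -/
  | row
  /-- `column + 1` -/
  | column
  /-- `column + 2` -/
  | column'

/-- The bits of a claim: the digits of a row and of a column and, for each tile, whether the claim
is about this tile. -/
inductive ClaimBit (T : Type)
  | digit (x : Axis) (j : ℕ)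
  | tile (ρ : T)

/-- The concept names whose values at the leaves of the tree are governed by clauses. -/
inductive Letter (T : Type)
  /-- The `j`-th digit of the address `x` is `b`. -/
  | digit (x : Axis) (b : Bool) (j : ℕ)
  | leafType (τ : T × T × T)
  | claim (p : ClaimBit T)
  | positive
  | negative
  | kind (κ : Kind)
  | carry (g : Counter) (j : ℕ)
  | sum (g : Counter) (j : ℕ)
  /-- The `j`-th digit of `2 ^ N - (column + 2) + s`. -/
  | chain (s j : ℕ)
  /-- The `j`-th carry in the addition of `1` to the number with the digits `chain s`. -/
  | chainCarry (s j : ℕ)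
  /-- The next column is the `s`-th one. -/
  | columnEq (s : ℕ)
  /-- The next column is the `s`-th one or a later one. -/
  | columnGe (s : ℕ)
  /-- The input at the next column is not the symbol (or blank) coded by `c`. -/
  | symbolNe (c : ℕ)

/-- The concept names of the knowledge base. -/
inductive ConLabel (T : Type)
  | level (j : ℕ)
  | leaf
  /-- The successor of a leaf that represents the bit `p` of its claim. -/
  | value (p : ClaimBit T)
  | letter (a : Letter T)

/-- The role names of the knowledge base: the edges of the tree and, for `b = 0, 1`, the edges to
bits of value `b`. -/
inductive RoleLabel
  | edge
  | bit (b : Bool)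

/-- The variables of the query: the nodes below the root on the path to the leaf of a positive
claim, the leaf `target` of a negative claim and, for each bit `p`, the gadget that compares the
values of `p` at these leaves. The gadget consists of two blocks, one from `source` to `middle` and
one from `middle` to `sink`; a block is a pair of legs with a common `top`. -/
inductive Var (T : Type)
  | path (l : ℕ)
  | target
  | source (p : ClaimBit T)
  | middle (p : ClaimBit T)
  | sink (p : ClaimBit T)
  | top (p : ClaimBit T) (b : Bool)
  | leg (p : ClaimBit T) (b c : Bool) (l : ℕ)
  /-- The element between a leaf and the `source` or, for `b = true`, the `sink`. -/
  | witness (p : ClaimBit T) (b : Bool)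

/-- The number of an axis in the codes of names. -/
def Axis.code : Axis → ℕ
  | row => 0
  | column => 1

/-- The number of a kind in the codes of names. -/
def Kind.code : Kind → ℕ
  | left => 0
  | middle => 1
  | right => 2
  | next => 3

/-- The number of a counter in the codes of names. -/
def Counter.code : Counter → ℕ
  | row => 0
  | column => 1
  | column' => 2

theorem boolToNat_injective : Function.Injective Bool.toNat := by decide

theorem Axis.code_injective : Function.Injective Axis.code := by
  intro x y h
  cases x <;> cases y <;> trivial

theorem Kind.code_injective : Function.Injective Kind.code := by
  intro κ κ' h
  cases κ <;> cases κ' <;> trivial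

theorem Counter.code_injective : Function.Injective Counter.code := by
  intro g g' h
  cases g <;> cases g' <;> trivial

variable {T : Type} [Encodable T]

/-- The code of a bit of a claim as a list of numbers. -/
def ClaimBit.code : ClaimBit T → List ℕ
  | digit x j => [x.code, j]
  | tile ρ => [2, Encodable.encode ρ]

/-- The code of a letter; the first number tells the constructors apart, as in all codes below. -/
def Letter.code : Letter T → List ℕ
  | digit x b j => [0, x.code, b.toNat, j]
  | leafType τ => [1, Encodable.encode τ]
  | claim p => 2 :: p.code
  | positive => [3]
  | negative => [4]
  | kind κ => [5, κ.code]
  | carry g j => [6, g.code, j]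
  | sum g j => [7, g.code, j]
  | chain s j => [8, s, j]
  | chainCarry s j => [9, s, j]
  | columnEq s => [10, s]
  | columnGe s => [11, s]
  | symbolNe c => [12, c]

/-- The code of a concept label. -/
def ConLabel.code : ConLabel T → List ℕ
  | level j => [0, j]
  | leaf => [1]
  | value p => 2 :: p.code
  | letter a => 3 :: a.code

/-- The code of a role label. -/
def RoleLabel.code : RoleLabel → List ℕ
  | edge => [0]
  | bit b => [1, b.toNat]

/-- The code of a variable of the query. -/
def Var.code : Var T → List ℕ
  | path l => [0, l]
  | target => [1]
  | source p => 2 :: p.code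
  | middle p => 3 :: p.code
  | sink p => 4 :: p.code
  | top p b => 5 :: b.toNat :: p.code
  | leg p b c l => 6 :: b.toNat :: c.toNat :: l :: p.code
  | witness p b => 7 :: b.toNat :: p.code

theorem ClaimBit.code_injective : Function.Injective (ClaimBit.code (T := T)) := by
  intro p q h
  cases p with
  | digit x j =>
    cases q with
    | digit => simpa [ClaimBit.code, Axis.code_injective.eq_iff] using h
    | tile => cases x <;> simp [ClaimBit.code, Axis.code] at h
  | tile ρ =>
    cases q with
    | digit x => cases x <;> simp [ClaimBit.code, Axis.code] at h
    | tile => simpa [ClaimBit.code] using h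

theorem Letter.code_injective : Function.Injective (Letter.code (T := T)) := by
  intro a b h
  cases a <;> cases b <;>
    simp_all [Letter.code, Axis.code_injective.eq_iff, Kind.code_injective.eq_iff,
      Counter.code_injective.eq_iff, ClaimBit.code_injective.eq_iff, boolToNat_injective.eq_iff]

theorem ConLabel.code_injective : Function.Injective (ConLabel.code (T := T)) := by
  intro a b h
  cases a <;> cases b <;>
    simp_all [ConLabel.code, ClaimBit.code_injective.eq_iff, Letter.code_injective.eq_iff]

theorem RoleLabel.code_injective : Function.Injective RoleLabel.code := by
  intro r s h
  cases r <;> cases s <;> simp_all [RoleLabel.code, boolToNat_injective.eq_iff]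

theorem Var.code_injective : Function.Injective (Var.code (T := T)) := by
  intro x y h
  cases x <;> cases y <;>
    simp_all [Var.code, ClaimBit.code_injective.eq_iff, boolToNat_injective.eq_iff]

/-- The concept name with a given label. -/
def ConLabel.name (a : ConLabel T) : Name := unaryName a.code

/-- The role name with a given label. -/
def RoleLabel.name (r : RoleLabel) : Name := unaryName r.code

/-- The name of a variable of the query. -/
def Var.name (x : Var T) : Name := unaryName x.code

theorem ConLabel.name_injective : Function.Injective (ConLabel.name (T := T)) :=
  unaryName_injective.comp ConLabel.code_injective

theorem RoleLabel.name_injective : Function.Injective RoleLabel.name :=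
  unaryName_injective.comp RoleLabel.code_injective

theorem Var.name_injective : Function.Injective (Var.name (T := T)) :=
  unaryName_injective.comp Var.code_injective

/-- The individual name of the root of the tree. -/
def root : Name := unaryName []

/-! ### The knowledge base -/

/-- A clause: if all letters of the body hold, then some letter of the head does. -/
structure Clause (T : Type) where
  body : List (Letter T)
  head : List (Letter T)

/-- The atomic concept with a given label. -/
abbrev ConLabel.concept (a : ConLabel T) : Concept := .name a.name

/-- The role with a given label. -/
abbrev RoleLabel.role (r : RoleLabel) : SRole := .name r.name

/-- The leaves at which all letters of a list hold. -/
def bodyConcept : List (Letter T) → Concept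
  | [] => ConLabel.concept (T := T) .leaf
  | a :: l => .inter (ConLabel.letter a).concept (bodyConcept l)

/-- The elements at which some letter of a list holds. -/
def headConcept : List (Letter T) → Concept
  | [] => .bot
  | a :: l => .neg (.inter (.neg (ConLabel.letter a).concept) (.neg (headConcept l)))

/-- The clause holds at all leaves. -/
def Clause.toInclusion (φ : Clause T) : TAxiom := .gci (bodyConcept φ.body) (headConcept φ.head)

end DL.Reduction

namespace DL.Reduction

variable (T : Type) [Encodable T]

/-- Below a node of level `j` there is a node of level `j + 1` at which the `j`-th digits of the
addresses are `b` and `c`. -/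
def splitInclusion (j : ℕ) (b c : Bool) : TAxiom :=
  .gci (ConLabel.level (T := T) j).concept
    (.ex RoleLabel.edge.role (.inter (ConLabel.level (T := T) (j + 1)).concept
      (.inter (ConLabel.letter (T := T) (.digit .row b j)).concept
        (ConLabel.letter (T := T) (.digit .column c j)).concept)))

/-- The digits of the addresses are passed on along the edges. -/
def inheritInclusion (x : Axis) (b : Bool) (j : ℕ) : TAxiom :=
  .gci (ConLabel.letter (T := T) (.digit x b j)).concept
    (.neg (.ex RoleLabel.edge.role (.neg (ConLabel.letter (T := T) (.digit x b j)).concept)))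

/-- All bits can be read along loops at the leaves. -/
def loopInclusion : TAxiom :=
  .gci (ConLabel.leaf (T := T)).concept
    (.inter (.self (RoleLabel.bit false).role) (.self (RoleLabel.bit true).role))

/-- The inclusions about the nodes of level `j`. -/
def levelInclusions (j : ℕ) : List TAxiom :=
  [false, true].flatMap fun b => [splitInclusion T j b false, splitInclusion T j b true,
    inheritInclusion T .row b j, inheritInclusion T .column b j]

variable {T}

/-- Below a node of level `N` there is a leaf of type `τ`. -/
def leafInclusion (N : ℕ) (τ : T × T × T) : TAxiom :=
  .gci (ConLabel.level (T := T) N).concept (.ex RoleLabel.edge.role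
    (.inter (ConLabel.leaf (T := T)).concept (ConLabel.letter (.leafType τ)).concept))

/-- A leaf at which the bit `p` of the claim is `b` has a successor that represents this bit. -/
def claimInclusion (p : ClaimBit T) (b : Bool) : TAxiom :=
  let claim := (ConLabel.letter (.claim p)).concept
  .gci (.inter (ConLabel.leaf (T := T)).concept (bif b then claim else .neg claim))
    (.ex (RoleLabel.bit b).role (.inter (ConLabel.value p).concept
      (.inter (.self RoleLabel.edge.role) (.self (RoleLabel.bit !b).role))))

theorem bodyConcept_isALCSelf : ∀ l : List (Letter T), (bodyConcept l).IsALCSelf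
  | [] => by simp [bodyConcept, Concept.IsALCSelf]
  | _ :: l => by simp [bodyConcept, Concept.IsALCSelf, bodyConcept_isALCSelf l]

theorem headConcept_isALCSelf : ∀ l : List (Letter T), (headConcept l).IsALCSelf
  | [] => by simp [headConcept, Concept.IsALCSelf]
  | _ :: l => by simp [headConcept, Concept.IsALCSelf, headConcept_isALCSelf l]

section KnowledgeBase

variable [Fintype T]

/-- The bits of a claim about the cells of a square of side `2 ^ N`. -/
noncomputable def bits (N : ℕ) : List (ClaimBit T) :=
  [Axis.row, .column].flatMap (fun x => (List.range N).map (.digit x)) ++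
    (Finset.univ : Finset T).toList.map .tile

omit [Encodable T] in
@[simp] theorem digit_mem_bits {N j : ℕ} {x : Axis} :
    ClaimBit.digit x j ∈ bits (T := T) N ↔ j < N := by
  cases x <;> simp [bits]

omit [Encodable T] in
@[simp] theorem tile_mem_bits (N : ℕ) (ρ : T) : ClaimBit.tile ρ ∈ bits N := by
  simp [bits]

/-- The knowledge base whose models contain a tree of depth `N` with, for every pair of addresses
and every type, a leaf that satisfies the clauses `Φ`. -/
noncomputable def kb (N : ℕ) (Φ : List (Clause T)) : KB where
  abox := [.concept (ConLabel.level (T := T) 0).name root]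
  tbox := Φ.map Clause.toInclusion ++ ((List.range N).flatMap (levelInclusions T) ++
    ((Finset.univ : Finset (T × T × T)).toList.map (leafInclusion N) ++
      ((bits N).flatMap (fun p : ClaimBit T => [claimInclusion p false, claimInclusion p true]) ++
        [loopInclusion T])))

theorem kb_isALCSelf (N : ℕ) (Φ : List (Clause T)) : (kb N Φ).IsALCSelf := by
  intro τ hτ
  simp only [kb, List.mem_append, List.mem_map, List.mem_flatMap, levelInclusions, List.mem_cons,
    List.not_mem_nil, or_false] at hτ
  rcases hτ with ⟨φ, -, rfl⟩ | ⟨j, -, b, -, rfl | rfl | rfl | rfl⟩ | ⟨τ, -, rfl⟩ |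
    ⟨p, -, rfl | rfl⟩ | rfl
  · exact ⟨_, _, rfl, bodyConcept_isALCSelf _, headConcept_isALCSelf _⟩
  all_goals exact ⟨_, _, rfl, by simp [Concept.IsALCSelf], by simp [Concept.IsALCSelf]⟩

end KnowledgeBase

/-! ### The query -/

/-- The query atom for an edge of the tree. -/
def edgeAtom (t u : Term) : CQ := .role RoleLabel.edge.name t u

/-- The query atom for an edge to a bit of value `b`. -/
def bitAtom (b : Bool) (t u : Term) : CQ := .role (RoleLabel.bit b).name t u

/-- The atoms of a path of length `n` along edges of the tree. -/
def chainAtoms (t : ℕ → Term) (n : ℕ) : List CQ :=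
  (List.range n).map fun l => edgeAtom (t l) (t (l + 1))

/-- The variable with a given label. -/
abbrev Var.term (x : Var T) : Term := .var x.name

variable (T) in
/-- The terms on the path from the root to the leaf of the positive claim. -/
def pathTerm : ℕ → Term
  | 0 => .ind root
  | l + 1 => (Var.path (T := T) l).term

/-- The terms on the leg with the parameters `p`, `b`, `c`. -/
def legTerm (p : ClaimBit T) (b c : Bool) : ℕ → Term
  | 0 => (Var.top p b).term
  | l + 1 => (Var.leg p b c l).term

/-- A leg: a path down from the top of its block whose last node has a `b`-edge to `u`. -/
def legAtoms (N : ℕ) (p : ClaimBit T) (b c : Bool) (u : Term) : List CQ :=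
  chainAtoms (legTerm p b c) (N + 1) ++ [bitAtom b (legTerm p b c (N + 1)) u]

/-- A block: two legs with a common top, one ending in `u` and one in `v`. -/
def blockAtoms (N : ℕ) (p : ClaimBit T) (b : Bool) (u v : Term) : List CQ :=
  legAtoms N p b false u ++ legAtoms N p b true v

/-- Leads from a leaf `t` to a bit `u` of the claim made there, whatever the value of the bit: the
other one of the two edges can be a loop. -/
def readAtoms (t w u : Term) : List CQ := [bitAtom false t w, bitAtom true w u]

/-- The gadget that compares the bits `p` of two claims. If both are `b`, then the block with the
parameter `b` can be matched along the branches of the two leaves, and the other one can be matched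
by a single element. -/
def compareAtoms (N : ℕ) (p : ClaimBit T) : List CQ :=
  readAtoms (pathTerm T (N + 1)) (Var.witness p false).term (Var.source p).term ++
    blockAtoms N p false (Var.source p).term (Var.middle p).term ++
    blockAtoms N p true (Var.middle p).term (Var.sink p).term ++
    readAtoms (Var.target (T := T)).term (Var.witness p true).term (Var.sink p).term ++
    [.concept (ConLabel.value p).name (Var.source p).term,
      .concept (ConLabel.value p).name (Var.middle p).term,
      .concept (ConLabel.value p).name (Var.sink p).term]

variable (T) in
/-- The query: some positive and some negative claim have the same bits. -/
noncomputable def query [Fintype T] (N : ℕ) : CQ :=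
  conjunction (chainAtoms (pathTerm T) (N + 1) ++ (bits (T := T) N).flatMap (compareAtoms N) ++
      [.concept (ConLabel.letter (T := T) .positive).name (pathTerm T (N + 1))])
    (.concept (ConLabel.letter (T := T) .negative).name (Var.target (T := T)).term)

theorem mem_terms_chainAtoms {t : ℕ → Term} {n l : ℕ} (h : l ≤ n + 1) :
    t l ∈ terms (chainAtoms t (n + 1)) := by
  obtain h | rfl := Nat.lt_or_eq_of_le h
  · exact ⟨_, List.mem_map_of_mem (List.mem_range.2 h), .inl rfl⟩
  · exact ⟨_, List.mem_map_of_mem (List.mem_range.2 n.lt_succ_self), .inr rfl⟩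

theorem isConnected_chainAtoms (t : ℕ → Term) : ∀ n, IsConnected (chainAtoms t n)
  | 0 => fun u hu => by simp [chainAtoms, terms] at hu
  | 1 => isConnected_singleton_role _ _ _
  | n + 2 => by
    rw [chainAtoms, List.range_succ, List.map_append]
    exact (isConnected_chainAtoms t (n + 1)).append (isConnected_singleton_role _ _ _)
      (mem_terms_chainAtoms le_rfl) ⟨_, List.mem_singleton_self _, .inl rfl⟩

theorem terms_readAtoms (t w u : Term) : terms (readAtoms t w u) = {t, w, u} := by
  rw [readAtoms, terms_cons, terms_cons]
  simp [bitAtom, CQ.terms, Set.insert_comm u t, Set.pair_comm u w]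

theorem isConnected_readAtoms (t w u : Term) : IsConnected (readAtoms t w u) :=
  (isConnected_singleton_role _ t w).append (isConnected_singleton_role _ w u) (t := w)
    ⟨_, List.mem_singleton_self _, .inr rfl⟩ ⟨_, List.mem_singleton_self _, .inl rfl⟩

theorem mem_terms_legAtoms (N : ℕ) (p : ClaimBit T) (b c : Bool) (u : Term) :
    (Var.top p b).term ∈ terms (legAtoms N p b c u) ∧ u ∈ terms (legAtoms N p b c u) := by
  rw [legAtoms, terms_append]
  exact ⟨.inl (mem_terms_chainAtoms (t := legTerm p b c) (Nat.zero_le _)),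
    .inr ⟨_, List.mem_singleton_self _, .inr rfl⟩⟩

theorem isConnected_legAtoms (N : ℕ) (p : ClaimBit T) (b c : Bool) (u : Term) :
    IsConnected (legAtoms N p b c u) :=
  (isConnected_chainAtoms _ _).append (isConnected_singleton_role _ _ _)
    (mem_terms_chainAtoms le_rfl) ⟨_, List.mem_singleton_self _, .inl rfl⟩

theorem mem_terms_blockAtoms (N : ℕ) (p : ClaimBit T) (b : Bool) (u u' : Term) :
    u ∈ terms (blockAtoms N p b u u') ∧ u' ∈ terms (blockAtoms N p b u u') := by
  rw [blockAtoms, terms_append]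
  exact ⟨.inl (mem_terms_legAtoms _ _ _ _ _).2, .inr (mem_terms_legAtoms _ _ _ _ _).2⟩

theorem isConnected_blockAtoms (N : ℕ) (p : ClaimBit T) (b : Bool) (u u' : Term) :
    IsConnected (blockAtoms N p b u u') :=
  (isConnected_legAtoms _ _ _ _ _).append (isConnected_legAtoms _ _ _ _ _)
    (mem_terms_legAtoms _ _ _ _ _).1 (mem_terms_legAtoms _ _ _ _ _).1

theorem mem_terms_compareAtoms (N : ℕ) (p : ClaimBit T) :
    pathTerm T (N + 1) ∈ terms (compareAtoms N p) ∧
      (Var.target (T := T)).term ∈ terms (compareAtoms N p) := by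
  simp [compareAtoms, terms_readAtoms]

theorem isConnected_compareAtoms (N : ℕ) (p : ClaimBit T) : IsConnected (compareAtoms N p) := by
  have source_mem := mem_terms_blockAtoms N p false (Var.source p).term (Var.middle p).term
  have sink_mem := mem_terms_blockAtoms N p true (Var.middle p).term (Var.sink p).term
  refine ((((isConnected_readAtoms _ _ _).append (isConnected_blockAtoms _ _ _ _ _)
    (t := (Var.source p).term) ?_ source_mem.1).append (isConnected_blockAtoms _ _ _ _ _)
    (t := (Var.middle p).term) ?_ sink_mem.1).append (isConnected_readAtoms _ _ _)
    (t := (Var.sink p).term) ?_ ?_).append_of_terms_subset ?_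
  · simp [terms_readAtoms]
  · simp [source_mem]
  · simp [sink_mem]
  · simp [terms_readAtoms]
  · rintro t ⟨q, hq, ht⟩
    simp only [List.mem_cons, List.not_mem_nil, or_false] at hq
    rcases hq with rfl | rfl | rfl <;> cases ht <;> simp [source_mem, sink_mem]

theorem query_isRooted [Fintype T] {N : ℕ} (hN : 0 < N) : (query T N).IsRooted := by
  have root_mem : .ind root ∈ terms (chainAtoms (pathTerm T) (N + 1)) :=
    mem_terms_chainAtoms (t := pathTerm T) (Nat.zero_le _)
  have leaf_mem : pathTerm T (N + 1) ∈ terms (chainAtoms (pathTerm T) (N + 1)) :=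
    mem_terms_chainAtoms le_rfl
  have target_mem : (Var.target (T := T)).term ∈
      terms ((bits (T := T) N).flatMap (compareAtoms N)) :=
    terms_mono (fun q hq => List.mem_flatMap.2 ⟨_, digit_mem_bits (x := .row).2 hN, hq⟩)
      (mem_terms_compareAtoms N _).2
  refine isRooted_of_isConnected (isConnected_conjunction ?_) (a := root) ?_
  · refine (((isConnected_chainAtoms _ _).append_flatMap leaf_mem
      (fun p _ => isConnected_compareAtoms N p) fun p _ =>
        (mem_terms_compareAtoms N p).1).append_of_terms_subset ?_).append_of_terms_subset ?_
    · simp [CQ.terms, leaf_mem]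
    · simp [CQ.terms, target_mem]
  · rw [query, terms_conjunction]
    simp [root_mem]

end DL.Reduction

namespace DL.Reduction

/-! ### Models without a match of the query -/

/-- A clause is true under a valuation of the letters. -/
def Clause.Holds {T : Type} (v : Letter T → Prop) (φ : Clause T) : Prop :=
  (∀ a ∈ φ.body, v a) → ∃ a ∈ φ.head, v a

/-- The digits of a row and of a column, least significant ones first. -/
abbrev Addresses := Axis → ℕ → Bool

/-- Valuations of the letters at the leaves, one for each pair of addresses and each type, that
satisfy the clauses and such that no positive claim has the same bits as a negative one. -/
structure IsConsistentFamily {T : Type} [Fintype T] (N : ℕ) (Φ : List (Clause T))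
    (v : Addresses → T × T × T → Letter T → Prop) : Prop where
  type : ∀ z τ, v z τ (.leafType τ)
  digit : ∀ z τ x, ∀ j < N, v z τ (.digit x (z x j) j)
  clauses : ∀ z τ, ∀ φ ∈ Φ, φ.Holds (v z τ)
  claims : ∀ z τ z' τ', v z τ .positive → v z' τ' .negative →
    ∃ p ∈ bits N, ¬ (v z τ (.claim p) ↔ v z' τ' (.claim p))

variable {T : Type} [Encodable T] {Δ : Type} {I : Interp Δ}

theorem mem_bodyConcept {d : Δ} {l : List (Letter T)} : d ∈ (bodyConcept l).sem I ↔
    (∀ a ∈ l, d ∈ I.con (ConLabel.letter a).name) ∧ d ∈ I.con (ConLabel.leaf (T := T)).name := by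
  induction l with
  | nil => simp [bodyConcept, Concept.sem]
  | cons a l ih => simp [bodyConcept, Concept.sem, ih, and_assoc]

theorem mem_headConcept {d : Δ} {l : List (Letter T)} :
    d ∈ (headConcept l).sem I ↔ ∃ a ∈ l, d ∈ I.con (ConLabel.letter a).name := by
  induction l with
  | nil => simp [headConcept, Concept.sem]
  | cons a l ih =>
    simp only [headConcept, Concept.sem, Set.mem_compl_iff, Set.mem_inter_iff, ih,
      List.exists_mem_cons_iff, not_and_or, not_not]

theorem toInclusion_holds {φ : Clause T} : φ.toInclusion.Holds I ↔
    ∀ d ∈ I.con (ConLabel.leaf (T := T)).name,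
      φ.Holds fun a => d ∈ I.con (ConLabel.letter a).name := by
  simp only [Clause.toInclusion, TAxiom.Holds, Set.subset_def, mem_bodyConcept, mem_headConcept,
    Clause.Holds]
  exact ⟨fun h d hd hb => h d ⟨hb, hd⟩, fun h d hd => h d hd.2 hd.1⟩

theorem chainAtoms_holds {η : Name → Δ} {t : ℕ → Term} {n : ℕ} :
    (∀ a ∈ chainAtoms t n, a.Holds I η) ↔
      ∀ l < n, ((t l).sem I η, (t (l + 1)).sem I η) ∈ I.rol RoleLabel.edge.name := by
  simp [chainAtoms, edgeAtom, CQ.Holds]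

theorem legAtoms_holds {η : Name → Δ} {N : ℕ} {p : ClaimBit T} {b c : Bool} {u : Term} :
    (∀ a ∈ legAtoms N p b c u, a.Holds I η) ↔
      (∀ l < N + 1, ((legTerm p b c l).sem I η, (legTerm p b c (l + 1)).sem I η) ∈
        I.rol RoleLabel.edge.name) ∧
      ((legTerm p b c (N + 1)).sem I η, u.sem I η) ∈ I.rol (RoleLabel.bit b).name := by
  simp [legAtoms, chainAtoms_holds, bitAtom, CQ.Holds, or_imp,
    forall_and, -forall_eq_or_imp]

theorem readAtoms_holds {η : Name → Δ} {t w u : Term} :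
    (∀ a ∈ readAtoms t w u, a.Holds I η) ↔
      (t.sem I η, w.sem I η) ∈ I.rol (RoleLabel.bit false).name ∧
        (w.sem I η, u.sem I η) ∈ I.rol (RoleLabel.bit true).name := by
  simp [readAtoms, bitAtom, CQ.Holds]

variable (T) in
/-- A path along edges from the root to a leaf. -/
structure IsBranch (I : Interp Δ) (N : ℕ) (P : ℕ → Δ) : Prop where
  root : P 0 = I.ind root
  edge : ∀ l < N + 1, (P l, P (l + 1)) ∈ I.rol RoleLabel.edge.name
  leaf : P (N + 1) ∈ I.con (ConLabel.leaf (T := T)).name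

/-- `e` represents the bit `p` of the claim at the leaf `d`, whose value is `b`. -/
structure Represents (I : Interp Δ) (d : Δ) (p : ClaimBit T) (b : Bool) (e : Δ) : Prop where
  value : e ∈ I.con (ConLabel.value p).name
  edge : (e, e) ∈ I.rol RoleLabel.edge.name
  bit : (d, e) ∈ I.rol (RoleLabel.bit b).name
  bit_not : (e, e) ∈ I.rol (RoleLabel.bit !b).name

/-- The match of the query for two branches `P` and `Q` that end in leaves whose bits `V` are
represented by `x` and by `y`, respectively. -/
def matchValue (N : ℕ) (P Q : ℕ → Δ) (x y : ClaimBit T → Δ) (V : ClaimBit T → Bool) : Var T → Δ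
  | .path l => P (l + 1)
  | .target => Q (N + 1)
  | .source p => x p
  | .middle p => bif V p then x p else y p
  | .sink p => y p
  | .top p b => if V p = b then P 0 else bif b then y p else x p
  | .leg p b c l => if V p = b then (bif c then Q else P) (l + 1) else bif b then y p else x p
  | .witness p false => bif V p then P (N + 1) else x p
  | .witness p true => bif V p then Q (N + 1) else y p

section Match

variable {N : ℕ} {P Q : ℕ → Δ} {x y : ClaimBit T → Δ} {V : ClaimBit T → Bool} {η : Name → Δ}

theorem legAtoms_holds_of_matchValue (hη : ∀ a : Var T, η a.name = matchValue N P Q x y V a)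
    (hP : IsBranch T I N P) (hQ : IsBranch T I N Q) {p : ClaimBit T}
    (hx : Represents I (P (N + 1)) p (V p) (x p)) (hy : Represents I (Q (N + 1)) p (V p) (y p))
    (b c : Bool) {u : Term}
    (hu : u.sem I η = if V p = b then (bif c then y p else x p) else bif b then y p else x p) :
    ∀ a ∈ legAtoms N p b c u, a.Holds I η := by
  have leg_value : ∀ l, (legTerm p b c l).sem I η =
      if V p = b then (bif c then Q else P) l else bif b then y p else x p := by
    rintro (_ | l)
    · have : Q 0 = P 0 := hQ.root.trans hP.root.symm
      cases c <;> simp [legTerm, Term.sem, hη, matchValue, this]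
    · simp [legTerm, Term.sem, hη, matchValue]
  simp only [legAtoms_holds, leg_value, hu]
  obtain e | e := eq_or_ne (V p) b
  · subst e
    cases c <;> simp only [if_true, cond_true, cond_false]
    exacts [⟨hP.edge, hx.bit⟩, ⟨hQ.edge, hy.bit⟩]
  · have hx' := hx.bit_not
    have hy' := hy.bit_not
    rw [Bool.eq_not_of_ne e, Bool.not_not] at hx' hy'
    cases b <;> simp only [e, cond_true, cond_false]
    exacts [⟨fun _ _ => hx.edge, hx'⟩, ⟨fun _ _ => hy.edge, hy'⟩]

theorem readAtoms_holds_of_represents {t w u : Term} {p : ClaimBit T} {b : Bool}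
    (ht : ∀ c, (t.sem I η, t.sem I η) ∈ I.rol (RoleLabel.bit c).name)
    (hu : Represents I (t.sem I η) p b (u.sem I η))
    (hw : w.sem I η = bif b then t.sem I η else u.sem I η) :
    ∀ a ∈ readAtoms t w u, a.Holds I η := by
  rw [readAtoms_holds, hw]
  cases b
  exacts [⟨hu.bit, hu.bit_not⟩, ⟨ht _, hu.bit⟩]

theorem compareAtoms_holds_of_matchValue (hη : ∀ a : Var T, η a.name = matchValue N P Q x y V a)
    (hP : IsBranch T I N P) (hQ : IsBranch T I N Q) {p : ClaimBit T}
    (hx : Represents I (P (N + 1)) p (V p) (x p)) (hy : Represents I (Q (N + 1)) p (V p) (y p))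
    (loop : ∀ d ∈ I.con (ConLabel.leaf (T := T)).name, ∀ b,
      (d, d) ∈ I.rol (RoleLabel.bit b).name) :
    ∀ a ∈ compareAtoms N p, a.Holds I η := by
  have leg := legAtoms_holds_of_matchValue hη hP hQ hx hy
  have middle : (bif V p then x p else y p) ∈ I.con (ConLabel.value p).name := by
    cases V p
    exacts [hy.value, hx.value]
  simp only [compareAtoms, blockAtoms, List.forall_mem_append]
  refine ⟨⟨⟨⟨?_, leg _ _ ?_, leg _ _ ?_⟩, leg _ _ ?_, leg _ _ ?_⟩, ?_⟩, ?_⟩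
  · refine readAtoms_holds_of_represents (p := p) (b := V p) ?_ ?_ ?_ <;>
      simp only [pathTerm, Term.sem, hη, matchValue]
    exacts [loop _ hP.leaf, hx]
  iterate 4
    · cases h : V p <;> simp [Term.sem, hη, matchValue, h]
  · refine readAtoms_holds_of_represents (p := p) (b := V p) ?_ ?_ ?_ <;>
      simp only [Term.sem, hη, matchValue]
    exacts [loop _ hQ.leaf, hy]
  · simpa [CQ.Holds, Term.sem, hη, matchValue] using ⟨hx.value, middle, hy.value⟩

theorem query_holds_of_represents [Fintype T] (hP : IsBranch T I N P) (hQ : IsBranch T I N Q)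
    (hx : ∀ p ∈ bits N, Represents I (P (N + 1)) p (V p) (x p))
    (hy : ∀ p ∈ bits N, Represents I (Q (N + 1)) p (V p) (y p))
    (loop : ∀ d ∈ I.con (ConLabel.leaf (T := T)).name, ∀ b,
      (d, d) ∈ I.rol (RoleLabel.bit b).name)
    (positive : P (N + 1) ∈ I.con (ConLabel.letter (T := T) .positive).name)
    (negative : Q (N + 1) ∈ I.con (ConLabel.letter (T := T) .negative).name) :
    ∃ η, (query T N).Holds I η := by
  let η := Function.extend Var.name (matchValue N P Q x y V) fun _ => P 0
  have hη : ∀ a : Var T, η a.name = matchValue N P Q x y V a :=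
    Var.name_injective.extend_apply _ _
  have path_value : ∀ l, (pathTerm T l).sem I η = P l := by
    rintro (_ | l)
    exacts [hP.root.symm, hη _]
  refine ⟨η, conjunction_holds.2 ?_⟩
  simp only [List.forall_mem_append, List.forall_mem_flatMap, List.forall_mem_singleton,
    chainAtoms_holds, path_value, CQ.Holds]
  refine ⟨⟨⟨hP.edge, fun p hp => ?_⟩, positive⟩, ?_⟩
  · exact compareAtoms_holds_of_matchValue hη hP hQ (hx p hp) (hy p hp) loop
  · rw [Term.sem, hη]
    exact negative

end Match

section Models

variable [Fintype T] {N : ℕ} {Φ : List (Clause T)}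

theorem loop_of_models (h : (kb N Φ).Models I) :
    ∀ d ∈ I.con (ConLabel.leaf (T := T)).name, ∀ b, (d, d) ∈ I.rol (RoleLabel.bit b).name := by
  have loop : (loopInclusion T).Holds I := h.2 _ (by simp [kb])
  exact fun d hd b => b.casesOn (loop hd).1 (loop hd).2

theorem exists_represents (h : (kb N Φ).Models I) {d : Δ}
    (hd : d ∈ I.con (ConLabel.leaf (T := T)).name) {p : ClaimBit T} (hp : p ∈ bits N) {b : Bool}
    (hb : d ∈ I.con (ConLabel.letter (.claim p)).name ↔ b = true) :
    ∃ e, Represents I d p b e := by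
  have claim : (claimInclusion p b).Holds I := h.2 _ <| by
    simp only [kb, List.mem_append, List.mem_flatMap]
    exact .inr (.inr (.inr (.inl ⟨p, hp, by cases b <;> simp⟩)))
  have body : d ∈ (bif b then (ConLabel.letter (.claim p)).concept else
      .neg (ConLabel.letter (.claim p)).concept : Concept).sem I := by
    cases b <;> simpa [Concept.sem] using hb
  obtain ⟨e, ⟨value, edge, bit_not⟩, bit⟩ := claim ⟨hd, body⟩
  exact ⟨e, value, edge, bit, bit_not⟩

theorem inherit_of_models (h : (kb N Φ).Models I) {x : Axis} {b : Bool} {j : ℕ} (hj : j < N)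
    {d e : Δ} (hd : d ∈ I.con (ConLabel.letter (T := T) (.digit x b j)).name)
    (hde : (d, e) ∈ I.rol RoleLabel.edge.name) :
    e ∈ I.con (ConLabel.letter (T := T) (.digit x b j)).name := by
  have inherit : (inheritInclusion T x b j).Holds I := h.2 _ <| by
    simp only [kb, List.mem_append, List.mem_flatMap]
    exact .inr (.inl ⟨j, List.mem_range.2 hj, by cases x <;> cases b <;> simp [levelInclusions]⟩)
  by_contra he
  exact inherit hd ⟨e, he, hde⟩

theorem exists_child (h : (kb N Φ).Models I) {j : ℕ} (hj : j < N) {d : Δ}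
    (hd : d ∈ I.con (ConLabel.level (T := T) j).name) (b : Axis → Bool) :
    ∃ e, (d, e) ∈ I.rol RoleLabel.edge.name ∧ e ∈ I.con (ConLabel.level (T := T) (j + 1)).name ∧
      ∀ x, e ∈ I.con (ConLabel.letter (T := T) (.digit x (b x) j)).name := by
  have split : (splitInclusion T j (b .row) (b .column)).Holds I := h.2 _ <| by
    simp only [kb, List.mem_append, List.mem_flatMap]
    refine .inr (.inl ⟨j, List.mem_range.2 hj, ?_⟩)
    cases b .row <;> cases b .column <;> simp [levelInclusions]
  obtain ⟨e, ⟨level, row, column⟩, edge⟩ := split hd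
  exact ⟨e, edge, level, fun x => x.casesOn row column⟩

theorem exists_path (h : (kb N Φ).Models I) (z : Addresses) :
    ∃ P : ℕ → Δ, P 0 = I.ind root ∧
      (∀ l < N, (P l, P (l + 1)) ∈ I.rol RoleLabel.edge.name) ∧
      ∀ l ≤ N, P l ∈ I.con (ConLabel.level (T := T) l).name ∧
        ∀ j < l, ∀ x, P l ∈ I.con (ConLabel.letter (T := T) (.digit x (z x j) j)).name := by
  have root_mem : I.ind root ∈ I.con (ConLabel.level (T := T) 0).name :=
    h.1 _ (List.mem_singleton_self _)
  have child : ∀ l d, ∃ e, l < N → d ∈ I.con (ConLabel.level (T := T) l).name →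
      (d, e) ∈ I.rol RoleLabel.edge.name ∧ e ∈ I.con (ConLabel.level (T := T) (l + 1)).name ∧
        ∀ x, e ∈ I.con (ConLabel.letter (T := T) (.digit x (z x l) l)).name := by
    intro l d
    by_cases hl : l < N ∧ d ∈ I.con (ConLabel.level (T := T) l).name
    · obtain ⟨e, he⟩ := exists_child h hl.1 hl.2 (z · l)
      exact ⟨e, fun _ _ => he⟩
    · exact ⟨d, fun hl' hd => absurd ⟨hl', hd⟩ hl⟩
  choose next next_spec using child
  let P : ℕ → Δ := fun l => Nat.rec (I.ind root) next l
  have level : ∀ l ≤ N, P l ∈ I.con (ConLabel.level (T := T) l).name := by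
    intro l hl
    induction l with
    | zero => exact root_mem
    | succ l ih => exact (next_spec l _ hl (ih (by omega))).2.1
  have step := fun l (hl : l < N) => next_spec l (P l) hl (level l hl.le)
  refine ⟨P, rfl, fun l hl => (step l hl).1, fun l hl => ⟨level l hl, fun j hj x => ?_⟩⟩
  induction l, hj using Nat.le_induction with
  | base => exact (step j hl).2.2 x
  | succ l hjl ih =>
    exact inherit_of_models h (by omega) (ih (by omega)) (step l hl).1

theorem exists_branch (h : (kb N Φ).Models I) (z : Addresses) (τ : T × T × T) :
    ∃ P, IsBranch T I N P ∧ P (N + 1) ∈ I.con (ConLabel.letter (.leafType τ)).name ∧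
      ∀ x, ∀ j < N, P (N + 1) ∈ I.con (ConLabel.letter (T := T) (.digit x (z x j) j)).name := by
  obtain ⟨P, P_root, P_edge, P_level⟩ := exists_path h z
  have leaf : (leafInclusion N τ).Holds I := h.2 _ <| by
    simp only [kb, List.mem_append, List.mem_map]
    exact .inr (.inr (.inl ⟨τ, by simp, rfl⟩))
  obtain ⟨e, ⟨e_leaf, e_type⟩, e_edge⟩ := leaf (P_level N le_rfl).1
  have e_eq : Function.update P (N + 1) e (N + 1) = e := Function.update_self _ _ _
  have P_eq : ∀ l ≤ N, Function.update P (N + 1) e l = P l := fun l hl =>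
    Function.update_of_ne (by omega) _ _
  refine ⟨Function.update P (N + 1) e, ⟨?_, fun l hl => ?_, ?_⟩, ?_, fun x j hj => ?_⟩
  · rw [P_eq 0 N.zero_le, P_root]
  · obtain hl | rfl := Nat.lt_succ_iff_lt_or_eq.1 hl
    · rw [P_eq l hl.le, P_eq (l + 1) hl]
      exact P_edge l hl
    · rw [P_eq l le_rfl, e_eq]
      exact e_edge
  · rwa [e_eq]
  · rwa [e_eq]
  · rw [e_eq]
    exact inherit_of_models h hj ((P_level N le_rfl).2 j hj x) e_edge

theorem query_holds_of_eq_bits (h : (kb N Φ).Models I) {P Q : ℕ → Δ} (hP : IsBranch T I N P)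
    (hQ : IsBranch T I N Q)
    (positive : P (N + 1) ∈ I.con (ConLabel.letter (T := T) .positive).name)
    (negative : Q (N + 1) ∈ I.con (ConLabel.letter (T := T) .negative).name)
    (eq_bits : ∀ p ∈ bits N, P (N + 1) ∈ I.con (ConLabel.letter (T := T) (.claim p)).name ↔
      Q (N + 1) ∈ I.con (ConLabel.letter (.claim p)).name) :
    ∃ η, (query T N).Holds I η := by
  classical
  let V : ClaimBit T → Bool := fun p => decide (P (N + 1) ∈ I.con (ConLabel.letter (.claim p)).name)
  have represent : ∀ d ∈ I.con (ConLabel.leaf (T := T)).name,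
      (∀ p ∈ bits N, d ∈ I.con (ConLabel.letter (.claim p)).name ↔ V p = true) →
      ∃ x : ClaimBit T → Δ, ∀ p ∈ bits N, Represents I d p (V p) (x p) := by
    intro d hd hV
    have (p : ClaimBit T) : ∃ e, p ∈ bits N → Represents I d p (V p) e := by
      by_cases hp : p ∈ bits N
      · obtain ⟨e, he⟩ := exists_represents h hd hp (hV p hp)
        exact ⟨e, fun _ => he⟩
      · exact ⟨d, fun hp' => absurd hp' hp⟩
    exact Classical.skolem.1 this
  obtain ⟨x, hx⟩ := represent _ hP.leaf fun p _ => by simp [V]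
  obtain ⟨y, hy⟩ := represent _ hQ.leaf fun p hp => by simp [V, eq_bits p hp]
  exact query_holds_of_represents hP hQ hx hy (loop_of_models h) positive negative

theorem exists_isConsistentFamily_of_not_entails (h : ¬ (kb N Φ).Entails (query T N)) :
    ∃ v, IsConsistentFamily N Φ v := by
  simp only [KB.Entails, not_forall] at h
  obtain ⟨Δ, I, hI, not_holds⟩ := h
  choose P hP type digit using exists_branch hI
  refine ⟨fun z τ a => P z τ (N + 1) ∈ I.con (ConLabel.letter a).name, type, digit,
    fun z τ φ hφ => ?_, fun z τ z' τ' positive negative => ?_⟩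
  · have clause : φ.toInclusion.Holds I := hI.2 _ <| by
      simp only [kb, List.mem_append]
      exact .inl (List.mem_map_of_mem hφ)
    exact toInclusion_holds.1 clause _ (hP z τ).leaf
  · by_contra! eq_bits
    exact not_holds (query_holds_of_eq_bits hI (hP z τ) (hP z' τ') positive negative eq_bits)

end Models

end DL.Reduction

namespace DL.Reduction

/-! ### The model given by a consistent family -/

/-- The nodes of the tree: the inner node of level `l` on the branch with the addresses `z`, the
leaves, and the elements that represent the bits of their claims. -/
inductive Node (T : Type)
  | inner (l : ℕ) (z : Addresses)
  | leaf (z : Addresses) (τ : T × T × T)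
  | bit (z : Addresses) (τ : T × T × T) (p : ClaimBit T)

variable {T : Type}

/-- The concept names that hold at a node. -/
def NodeConcept (v : Addresses → T × T × T → Letter T → Prop) : ConLabel T → Node T → Prop
  | .level j, .inner l _ => l = j
  | .letter (.digit x b j), .inner l z => j < l ∧ z x j = b
  | .leaf, .leaf _ _ => True
  | .letter a, .leaf z τ => v z τ a
  | .value p, .bit _ _ q => q = p
  | _, _ => False

/-- The edges of the tree and the loops at its bits. -/
def NodeEdge (N : ℕ) : Node T → Node T → Prop
  | .inner l z, .inner m z' => l < N ∧ m = l + 1 ∧ ∀ x, ∀ j < l, z' x j = z x j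
  | .inner l z, .leaf z' _ => l = N ∧ z' = z
  | .bit z τ p, n => n = .bit z τ p
  | _, _ => False

/-- The edges from the leaves to their bits of value `b`, and the loops at the leaves and at the
other bits. -/
def NodeBit (v : Addresses → T × T × T → Letter T → Prop) (b : Bool) : Node T → Node T → Prop
  | .leaf z τ, .leaf z' τ' => z = z' ∧ τ = τ'
  | .leaf z τ, .bit z' τ' p => z = z' ∧ τ = τ' ∧ (v z τ (.claim p) ↔ b = true)
  | .bit z τ p, n => n = .bit z τ p ∧ ¬ (v z τ (.claim p) ↔ b = true)
  | _, _ => False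

/-- The role names that hold between nodes. -/
def NodeRole (N : ℕ) (v : Addresses → T × T × T → Letter T → Prop) :
    RoleLabel → Node T → Node T → Prop
  | .edge => NodeEdge N
  | .bit b => NodeBit v b

variable {N : ℕ} {v : Addresses → T × T × T → Letter T → Prop}

theorem NodeEdge.eq_bit_iff {n m : Node T} (h : NodeEdge N n m) {z : Addresses} {τ : T × T × T}
    {p : ClaimBit T} : n = .bit z τ p ↔ m = .bit z τ p := by
  constructor
  · rintro rfl
    exact h
  · rintro rfl
    rcases n with _ | _ | _
    exacts [h.elim, h.elim, h.symm]

theorem NodeBit.to_bit {b : Bool} {n : Node T} {z : Addresses} {τ : T × T × T} {p : ClaimBit T}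
    (h : NodeBit v b n (.bit z τ p)) :
    n = .bit z τ p ∨ n = .leaf z τ ∧ (v z τ (.claim p) ↔ b = true) := by
  rcases n with _ | _ | _
  · exact h.elim
  · obtain ⟨rfl, rfl, hb⟩ := h
    exact .inr ⟨rfl, hb⟩
  · exact .inl h.1.symm

theorem NodeConcept.exists_eq_bit {n : Node T} {p : ClaimBit T}
    (h : NodeConcept v (.value p) n) : ∃ z τ, n = .bit z τ p := by
  rcases n with _ | _ | ⟨z, τ, q⟩
  · exact h.elim
  · exact h.elim
  · cases h
    exact ⟨z, τ, rfl⟩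

theorem NodeConcept.exists_eq_leaf {n : Node T} {a : Letter T} (h : NodeConcept v (.letter a) n)
    (ha : ∀ x b j, a ≠ .digit x b j) : ∃ z τ, n = .leaf z τ ∧ v z τ a := by
  rcases n with _ | ⟨z, τ⟩ | _
  · cases a with
    | digit x b j => exact absurd rfl (ha x b j)
    | _ => exact h.elim
  · exact ⟨z, τ, rfl, by simpa [NodeConcept] using h⟩
  · simp [NodeConcept] at h

variable [Encodable T]

variable (N v) in
/-- The interpretation given by a family of valuations. -/
def treeInterp : Interp (Node T) where
  ind _ := .inner 0 fun _ _ => false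
  con A := {n | ∃ a, ConLabel.name a = A ∧ NodeConcept v a n}
  rol r := {p | ∃ s, RoleLabel.name s = r ∧ NodeRole N v s p.1 p.2}

variable {Φ : List (Clause T)}

@[simp] theorem mem_treeInterp_con {a : ConLabel T} {n : Node T} :
    n ∈ (treeInterp N v).con a.name ↔ NodeConcept v a n := by
  simp [treeInterp, ConLabel.name_injective.eq_iff]

@[simp] theorem mem_treeInterp_edge {n m : Node T} :
    (n, m) ∈ (treeInterp N v).rol RoleLabel.edge.name ↔ NodeEdge N n m := by
  simp [treeInterp, RoleLabel.name_injective.eq_iff, NodeRole]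

@[simp] theorem mem_treeInterp_bit {b : Bool} {n m : Node T} :
    (n, m) ∈ (treeInterp N v).rol (RoleLabel.bit b).name ↔ NodeBit v b n m := by
  simp [treeInterp, RoleLabel.name_injective.eq_iff, NodeRole]

theorem treeInterp_splitInclusion {j : ℕ} (hj : j < N) (b c : Bool) :
    (splitInclusion T j b c).Holds (treeInterp N v) := by
  rintro (⟨l, z⟩ | _ | _) hn <;> simp only [Concept.sem, mem_treeInterp_con, NodeConcept] at hn
  subst hn
  let z' : Addresses := fun x => Function.update (z x) l (x.casesOn b c)
  refine ⟨.inner (l + 1) z', ?_⟩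
  have agree : ∀ x, ∀ i < l, z' x i = z x i := fun x i hi => Function.update_of_ne hi.ne _ _
  simpa [Concept.sem, SRole.sem, NodeConcept, NodeEdge, hj, z'] using agree

theorem treeInterp_inheritInclusion [Fintype T] (h : IsConsistentFamily N Φ v) (x : Axis)
    (b : Bool) (j : ℕ) : (inheritInclusion T x b j).Holds (treeInterp N v) := by
  rintro n hn ⟨m, hm, hnm⟩
  simp only [Concept.sem, SRole.sem, Set.mem_compl_iff, mem_treeInterp_con,
    mem_treeInterp_edge] at hn hm hnm
  apply hm
  rcases n with ⟨l, z⟩ | ⟨z, τ⟩ | ⟨z, τ, p⟩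
  · obtain ⟨hj, rfl⟩ := hn
    rcases m with ⟨l', z'⟩ | ⟨z', τ⟩ | _
    · obtain ⟨-, rfl, agree⟩ := hnm
      exact ⟨by omega, agree x j hj⟩
    · obtain ⟨rfl, rfl⟩ := hnm
      exact h.digit _ _ _ _ hj
    · exact hnm.elim
  · exact hnm.elim
  · exact hn.elim

theorem treeInterp_leafInclusion [Fintype T] (h : IsConsistentFamily N Φ v) (τ : T × T × T) :
    (leafInclusion N τ).Holds (treeInterp N v) := by
  rintro (⟨l, z⟩ | _ | _) hn <;> simp only [Concept.sem, mem_treeInterp_con, NodeConcept] at hn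
  refine ⟨.leaf z τ, ?_⟩
  simp [Concept.sem, SRole.sem, NodeConcept, NodeEdge, hn, h.type]

theorem treeInterp_claimInclusion (p : ClaimBit T) (b : Bool) :
    (claimInclusion p b).Holds (treeInterp N v) := by
  rintro (_ | ⟨z, τ⟩ | _) ⟨hn, hb⟩ <;>
    simp only [Concept.sem, mem_treeInterp_con, NodeConcept] at hn
  have value_iff : v z τ (.claim p) ↔ b = true := by
    cases b <;> simpa [Concept.sem, NodeConcept] using hb
  refine ⟨.bit z τ p, ?_⟩
  cases b <;> simp [Concept.sem, SRole.sem, NodeConcept, NodeEdge, NodeBit, value_iff]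

theorem treeInterp_loopInclusion : (loopInclusion T).Holds (treeInterp N v) := by
  rintro (_ | _ | _) hn <;> simp only [Concept.sem, mem_treeInterp_con, NodeConcept] at hn
  simp [Concept.sem, SRole.sem, NodeBit]

theorem treeInterp_models [Fintype T] (h : IsConsistentFamily N Φ v) :
    (kb N Φ).Models (treeInterp N v) := by
  constructor
  · intro α hα
    obtain rfl := List.mem_singleton.1 hα
    exact mem_treeInterp_con.2 rfl
  · intro α hα
    simp only [kb, List.mem_append, List.mem_map, List.mem_flatMap, levelInclusions, List.mem_cons,
      List.not_mem_nil, or_false, List.mem_range] at hα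
    rcases hα with ⟨φ, hφ, rfl⟩ | ⟨j, hj, b, -, rfl | rfl | rfl | rfl⟩ | ⟨τ, -, rfl⟩ |
      ⟨p, -, rfl | rfl⟩ | rfl
    · rw [toInclusion_holds]
      rintro (_ | ⟨z, τ⟩ | _) hn <;> simp only [mem_treeInterp_con, NodeConcept] at hn
      simpa [Clause.Holds, NodeConcept] using h.clauses z τ φ hφ
    · exact treeInterp_splitInclusion hj b false
    · exact treeInterp_splitInclusion hj b true
    · exact treeInterp_inheritInclusion h .row b j
    · exact treeInterp_inheritInclusion h .column b j
    · exact treeInterp_leafInclusion h τ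
    · exact treeInterp_claimInclusion p false
    · exact treeInterp_claimInclusion p true
    · exact treeInterp_loopInclusion

variable {η : Name → Node T} {p : ClaimBit T}

theorem legTerm_eq_bit_iff {b c : Bool} {u : Term}
    (h : ∀ a ∈ legAtoms N p b c u, a.Holds (treeInterp N v) η) {z : Addresses}
    {τ : T × T × T} : (Var.top p b).term.sem (treeInterp N v) η = .bit z τ p ↔
      (legTerm p b c (N + 1)).sem (treeInterp N v) η = .bit z τ p := by
  have edge := (legAtoms_holds.1 h).1
  simp only [mem_treeInterp_edge] at edge
  have key : ∀ l ≤ N + 1, (Var.top p b).term.sem (treeInterp N v) η = .bit z τ p ↔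
      (legTerm p b c l).sem (treeInterp N v) η = .bit z τ p := by
    intro l hl
    induction l with
    | zero => rfl
    | succ l ih => exact (ih (by omega)).trans (edge l hl).eq_bit_iff
  exact key _ le_rfl

theorem eq_bit_of_top_eq_bit {b c : Bool} {u : Term}
    (h : ∀ a ∈ legAtoms N p b c u, a.Holds (treeInterp N v) η) {z : Addresses} {τ : T × T × T}
    (top_eq : (Var.top p b).term.sem (treeInterp N v) η = .bit z τ p) :
    u.sem (treeInterp N v) η = .bit z τ p := by
  have bit := (legAtoms_holds.1 h).2
  rw [(legTerm_eq_bit_iff h).1 top_eq, mem_treeInterp_bit] at bit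
  exact bit.1

theorem top_eq_bit_or_claim_iff {b c : Bool} {u : Term}
    (h : ∀ a ∈ legAtoms N p b c u, a.Holds (treeInterp N v) η) {z : Addresses} {τ : T × T × T}
    (hu : u.sem (treeInterp N v) η = .bit z τ p) :
    (Var.top p b).term.sem (treeInterp N v) η = .bit z τ p ∨ (v z τ (.claim p) ↔ b = true) := by
  have bit := (legAtoms_holds.1 h).2
  rw [hu, mem_treeInterp_bit] at bit
  exact bit.to_bit.imp (legTerm_eq_bit_iff h).2 And.right

theorem claim_iff_of_blockAtoms {b : Bool} {u u' : Term}
    (h : ∀ a ∈ blockAtoms N p b u u', a.Holds (treeInterp N v) η) {z z' : Addresses}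
    {τ τ' : T × T × T} (hu : u.sem (treeInterp N v) η = .bit z τ p)
    (hu' : u'.sem (treeInterp N v) η = .bit z' τ' p) :
    v z τ (.claim p) ↔ v z' τ' (.claim p) := by
  obtain ⟨leg, leg'⟩ := List.forall_mem_append.1 h
  rcases top_eq_bit_or_claim_iff leg hu with top_eq | claim_iff
  · have e := hu'.symm.trans (eq_bit_of_top_eq_bit leg' top_eq)
    cases e
    rfl
  · rcases top_eq_bit_or_claim_iff leg' hu' with top_eq | claim_iff'
    · have e := hu.symm.trans (eq_bit_of_top_eq_bit leg top_eq)
      cases e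
      rfl
    · rw [claim_iff, claim_iff']

theorem eq_of_readAtoms {t w u : Term} (h : ∀ a ∈ readAtoms t w u, a.Holds (treeInterp N v) η)
    {z z' : Addresses} {τ τ' : T × T × T} (ht : t.sem (treeInterp N v) η = .leaf z τ)
    (hu : u.sem (treeInterp N v) η = .bit z' τ' p) : z = z' ∧ τ = τ' := by
  obtain ⟨hw, hw'⟩ := readAtoms_holds.1 h
  rw [ht, mem_treeInterp_bit] at hw
  rw [hu, mem_treeInterp_bit] at hw'
  rcases hw'.to_bit with e | ⟨e, -⟩ <;> rw [e] at hw
  exacts [⟨hw.1, hw.2.1⟩, hw]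

theorem claim_iff_of_compareAtoms
    (h : ∀ a ∈ compareAtoms N p, a.Holds (treeInterp N v) η) {z z' : Addresses} {τ τ' : T × T × T}
    (leaf_eq : (pathTerm T (N + 1)).sem (treeInterp N v) η = .leaf z τ)
    (target_eq : (Var.target (T := T)).term.sem (treeInterp N v) η = .leaf z' τ') :
    v z τ (.claim p) ↔ v z' τ' (.claim p) := by
  simp only [compareAtoms, List.forall_mem_append] at h
  obtain ⟨⟨⟨⟨read, block⟩, block'⟩, read'⟩, values⟩ := h
  simp only [List.forall_mem_cons, CQ.Holds, mem_treeInterp_con] at values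
  obtain ⟨source, middle, sink, -⟩ := values
  obtain ⟨_, _, source_eq⟩ := source.exists_eq_bit
  obtain ⟨_, _, middle_eq⟩ := middle.exists_eq_bit
  obtain ⟨_, _, sink_eq⟩ := sink.exists_eq_bit
  obtain ⟨rfl, rfl⟩ := eq_of_readAtoms read leaf_eq source_eq
  obtain ⟨rfl, rfl⟩ := eq_of_readAtoms read' target_eq sink_eq
  exact (claim_iff_of_blockAtoms block source_eq middle_eq).trans
    (claim_iff_of_blockAtoms block' middle_eq sink_eq)

theorem treeInterp_not_holds [Fintype T] (h : IsConsistentFamily N Φ v) :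
    ¬ (query T N).Holds (treeInterp N v) η := by
  intro hq
  rw [query, conjunction_holds] at hq
  simp only [List.forall_mem_append, List.forall_mem_flatMap, List.forall_mem_singleton, CQ.Holds,
    mem_treeInterp_con] at hq
  obtain ⟨⟨⟨-, compare⟩, positive⟩, negative⟩ := hq
  obtain ⟨z, τ, leaf_eq, positive⟩ := positive.exists_eq_leaf (by simp)
  obtain ⟨z', τ', target_eq, negative⟩ := negative.exists_eq_leaf (by simp)
  obtain ⟨p, hp, ne⟩ := h.claims z τ z' τ' positive negative
  exact ne (claim_iff_of_compareAtoms (compare p hp) leaf_eq target_eq)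

theorem not_entails_iff_exists_isConsistentFamily [Fintype T] :
    ¬ (kb N Φ).Entails (query T N) ↔ ∃ v, IsConsistentFamily N Φ v := by
  refine ⟨exists_isConsistentFamily_of_not_entails, fun ⟨v, hv⟩ entails => ?_⟩
  obtain ⟨η, hη⟩ := entails _ _ (treeInterp_models hv)
  exact treeInterp_not_holds hv hη

end DL.Reduction

namespace DL.Reduction

/-! ### Binary numbers -/

theorem testBit_succ_iff (x j : ℕ) :
    (x + 1).testBit j = true ↔ ¬ (x.testBit j = true ↔ ∀ k < j, x.testBit k = true) := by
  induction j generalizing x with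
  | zero => simp only [Nat.testBit_zero, decide_eq_true_eq, not_lt_zero, false_imp_iff,
      implies_true, iff_true]; omega
  | succ j ih =>
    rw [Nat.forall_lt_succ_left]
    simp only [Nat.testBit_zero, Nat.testBit_succ, decide_eq_true_eq]
    rcases Nat.mod_two_eq_zero_or_one x with hx | hx
    · rw [show (x + 1) / 2 = x / 2 by omega]
      simp [hx]
    · rw [show (x + 1) / 2 = x / 2 + 1 by omega, ih]
      simp [hx]

theorem forall_testBit_iff {N x : ℕ} (hx : x < 2 ^ N) :
    (∀ k < N, x.testBit k = true) ↔ x + 1 = 2 ^ N := by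
  constructor
  · intro h
    suffices x = 2 ^ N - 1 by omega
    refine Nat.eq_of_testBit_eq fun k => ?_
    rw [Nat.testBit_two_pow_sub_one]
    by_cases hk : k < N
    · simp [hk, h]
    · have hlt : x < 2 ^ k := hx.trans_le (Nat.pow_le_pow_right two_pos (by omega))
      simpa [hk] using Nat.testBit_lt_two_pow hlt
  · intro h k hk
    simp [show x = 2 ^ N - 1 by omega, hk]

section ZMod

variable {N j : ℕ}

theorem testBit_val_natCast (hj : j < N) (n : ℕ) :
    (n : ZMod (2 ^ N)).val.testBit j = n.testBit j := by
  simp [ZMod.val_natCast, Nat.testBit_mod_two_pow, hj]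

theorem testBit_val_add_one_iff (x : ZMod (2 ^ N)) (hj : j < N) :
    (x + 1).val.testBit j = true ↔
      ¬ (x.val.testBit j = true ↔ ∀ k < j, x.val.testBit k = true) := by
  rw [← testBit_succ_iff, ← testBit_val_natCast hj (x.val + 1), Nat.cast_add_one,
    ZMod.natCast_zmod_val]

theorem forall_testBit_val_iff (x : ZMod (2 ^ N)) :
    (∀ k < N, x.val.testBit k = true) ↔ x + 1 = 0 := by
  have hx := x.val_lt
  rw [forall_testBit_iff hx, show x + 1 = ((x.val + 1 : ℕ) : ZMod (2 ^ N)) by simp,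
    ZMod.natCast_eq_zero_iff]
  exact ⟨fun h => (dvd_of_eq h.symm), fun h => le_antisymm hx (Nat.le_of_dvd (by omega) h)⟩

theorem testBit_val_neg_add_one (x : ZMod (2 ^ N)) (hj : j < N) :
    (-(x + 1)).val.testBit j = !x.val.testBit j := by
  have hx := x.val_lt
  have h : -(x + 1) = ((2 ^ N - (x.val + 1) : ℕ) : ZMod (2 ^ N)) := by
    rw [Nat.cast_sub hx, ZMod.natCast_self]
    simp
  rw [h, testBit_val_natCast hj, Nat.testBit_two_pow_sub_succ hx]
  simp [hj]

theorem eq_of_testBit_val_iff {x y : ZMod (2 ^ N)}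
    (h : ∀ j < N, x.val.testBit j = true ↔ y.val.testBit j = true) : x = y := by
  refine ZMod.val_injective _ (Nat.eq_of_testBit_eq fun j => ?_)
  by_cases hj : j < N
  · exact Bool.eq_iff_iff.2 (h j hj)
  · have hle : 2 ^ N ≤ 2 ^ j := Nat.pow_le_pow_right two_pos (by omega)
    rw [Nat.testBit_lt_two_pow (x.val_lt.trans_le hle),
      Nat.testBit_lt_two_pow (y.val_lt.trans_le hle)]

theorem exists_testBit_val_eq (N : ℕ) (f : ℕ → Bool) :
    ∃ x : ZMod (2 ^ N), ∀ j < N, x.val.testBit j = f j :=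
  ⟨Nat.ofBits fun j : Fin N => f j, fun j hj => by
    rw [testBit_val_natCast hj, Nat.testBit_ofBits_lt _ _ hj]⟩

theorem val_eq_iff_natCast_eq {s : ℕ} (hs : s < N) (x : ZMod (2 ^ N)) :
    x.val = s ↔ (s : ZMod (2 ^ N)) = x := by
  constructor
  · rintro rfl
    simp
  · rintro rfl
    exact ZMod.val_cast_of_lt (hs.trans Nat.lt_two_pow_self)

theorem natCast_add_one_ne_zero {L n : ℕ} (hn : n + 1 < L) : (n + 1 : ZMod L) ≠ 0 := by
  rw [← Nat.cast_succ, Ne, ZMod.natCast_eq_zero_iff]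
  exact Nat.not_dvd_of_pos_of_lt n.succ_pos hn

theorem val_add_one_eq_or {L : ℕ} [NeZero L] (x : ZMod L) :
    (x + 1).val = x.val + 1 ∨ x.val + 1 = L ∧ x + 1 = 0 := by
  have hcast : x + 1 = (x.val + 1 : ℕ) := by simp
  rcases (show x.val + 1 ≤ L from x.val_lt).lt_or_eq with hlt | heq
  · exact .inl (by rw [hcast, ZMod.val_cast_of_lt hlt])
  · exact .inr ⟨heq, by rw [hcast, heq, ZMod.natCast_self]⟩

theorem val_add_one_of_ne_zero {L : ℕ} [NeZero L] {x : ZMod L} (h : x + 1 ≠ 0) :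
    (x + 1).val = x.val + 1 :=
  (val_add_one_eq_or x).resolve_right fun h' => h h'.2

end ZMod

/-! ### Tilings -/

/-- A tiling problem: the tiles that may occur above three consecutive tiles of a row, at the
position of the middle one, and the tiles that may occur in the first row, depending on the input
symbol at their position, or `none` for a blank, and on whether they are the leftmost ones. -/
structure TileSystem (α T : Type) where
  next : T → T → T → Finset T
  first : Option α → Bool → Finset T

/-- A tiling of `L` rows, each of which is a cycle of length `L`. Rows and columns are counted
modulo `L`, but nothing is required of the first row as the successor of the last one. -/
structure TileSystem.IsTiling {α T : Type} (S : TileSystem α T) (w : List α) {L : ℕ}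
    (X : ZMod L → ZMod L → T) : Prop where
  first : ∀ i, X 0 i ∈ S.first w[i.val]? (decide (i = 0))
  next : ∀ t i, t + 1 ≠ 0 → X (t + 1) (i + 1) ∈ S.next (X t i) (X t (i + 1)) (X t (i + 2))

/-! ### The clauses -/

section Clauses

variable {T : Type}

/-- `b` is the successor of `a` in binary, with carries `c`. -/
def succClauses (a c b : ℕ → Letter T) (j : ℕ) : List (Clause T) :=
  [⟨[c j, a j], [c (j + 1)]⟩, ⟨[c (j + 1)], [c j]⟩, ⟨[c (j + 1)], [a j]⟩,
    ⟨[c j, a j, b j], []⟩, ⟨[c j], [a j, b j]⟩, ⟨[a j], [c j, b j]⟩, ⟨[b j], [a j, c j]⟩]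

/-- The digits of the number to which the counter adds `1`. -/
def Counter.digit : Counter → ℕ → Letter T
  | .row => .digit .row true
  | .column => .digit .column true
  | .column' => .sum .column

/-- The digits of the row and the column of a claim of the given kind. -/
def Kind.digit : Kind → Axis → ℕ → Letter T
  | .next, .row => .sum .row
  | _, .row => .digit .row true
  | .left, .column => .digit .column true
  | .right, .column => .sum .column'
  | _, .column => .sum .column

/-- A claim of kind `κ` is about the cell that belongs to this kind. -/
def copyClauses (κ : Kind) (x : Axis) (j : ℕ) : List (Clause T) :=
  [⟨[.kind κ, κ.digit x j], [.claim (.digit x j)]⟩,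
    ⟨[.kind κ, .claim (.digit x j)], [κ.digit x j]⟩]

/-- The clauses on the `j`-th digits. The numbers `chain 0` are the complements of the next
columns. -/
def bitClauses (j : ℕ) : List (Clause T) :=
  [.row, .column].map (fun x => ⟨[.digit x false j, .digit x true j], []⟩) ++
    ([⟨[.chain 0 j, .sum .column j], []⟩, ⟨[], [.chain 0 j, .sum .column j]⟩] ++
      ([.row, .column, .column'].flatMap (fun g => succClauses g.digit (.carry g) (.sum g) j) ++
        [.left, .middle, .right, .next].flatMap fun κ =>
          [.row, .column].flatMap fun x => copyClauses κ x j))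

/-- As `chain 0` is the complement of the next column, adding `1` to `chain s` overflows exactly
if this column is the `s`-th one. -/
def chainClauses (N s : ℕ) : List (Clause T) :=
  [⟨[], [.chainCarry s 0]⟩, ⟨[.chainCarry s N], [.columnEq s]⟩,
    ⟨[.columnEq s], [.chainCarry s N]⟩] ++
    (List.range N).flatMap (succClauses (.chain s) (.chainCarry s) (.chain (s + 1)))

/-- A leaf makes a claim of some kind; only those of the kind `next` are positive, and no others
are made in the last row. -/
def choiceClauses (N : ℕ) : List (Clause T) :=
  [.row, .column, .column'].map (fun g => ⟨[], [.carry g 0]⟩) ++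
    [⟨[], [.columnGe 0]⟩, ⟨[], [.kind .left, .kind .middle, .kind .right, .kind .next]⟩,
      ⟨[.carry .row N], [.kind .next]⟩, ⟨[.kind .left], [.negative]⟩,
      ⟨[.kind .middle], [.negative]⟩, ⟨[.kind .right], [.negative]⟩, ⟨[.kind .next], [.positive]⟩]

/-- A claim is about one tile only. -/
def uniqueClause (p : T × T) : Clause T := ⟨[.claim (.tile p.1), .claim (.tile p.2)], []⟩

variable {α : Type} (S : TileSystem α T)

/-- A leaf of type `(a, b, c)` claims that one of the three tiles at and after its position is not
`a`, `b`, `c`, respectively, or claims a tile above them. -/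
noncomputable def tileClauses (N : ℕ) (τ : T × T × T) : List (Clause T) :=
  [⟨[.kind .left, .leafType τ], [.claim (.tile τ.1)]⟩,
    ⟨[.kind .middle, .leafType τ], [.claim (.tile τ.2.1)]⟩,
    ⟨[.kind .right, .leafType τ], [.claim (.tile τ.2.2)]⟩,
    ⟨[.kind .next, .leafType τ],
      .carry .row N :: (S.next τ.1 τ.2.1 τ.2.2).toList.map fun ρ => .claim (.tile ρ)⟩]

variable [Encodable α]

/-- A leaf in the last row claims a tile of the first row, if the input symbol above it is `o`. -/
noncomputable def initClauses (N : ℕ) (o : Option α) : List (Clause T) :=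
  [⟨[.carry .row N, .columnEq 0], .symbolNe (Encodable.encode o) ::
      (S.first o true).toList.map fun ρ => .claim (.tile ρ)⟩,
    ⟨[.carry .row N], .columnEq 0 :: .symbolNe (Encodable.encode o) ::
      (S.first o false).toList.map fun ρ => .claim (.tile ρ)⟩]

/-- The `s`-th input symbol is `a`. -/
def letterClauses (s : ℕ) (a : α) : List (Clause T) :=
  [⟨[.symbolNe (Encodable.encode (some a)), .columnEq s], []⟩,
    ⟨[.columnGe s], [.columnEq s, .columnGe (s + 1)]⟩]

/-- The input is `w`, followed by blanks. -/
def wordClauses (w : List α) : List (Clause T) :=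
  w.zipIdx.flatMap (fun p => letterClauses p.2 p.1) ++
    [⟨[.columnGe w.length, .symbolNe (Encodable.encode (none : Option α))], []⟩]

/-- The clauses that do not depend on the input. -/
noncomputable def generalClauses [Fintype α] [Fintype T] (N : ℕ) : List (Clause T) :=
  open Classical in
  (List.range N).flatMap bitClauses ++ ((List.range N).flatMap (chainClauses N) ++
    (choiceClauses N ++ ((Finset.univ.filter fun p : T × T => p.1 ≠ p.2).toList.map uniqueClause ++
      (Finset.univ.toList.flatMap (tileClauses S N) ++
        (Finset.univ : Finset (Option α)).toList.flatMap (initClauses S N)))))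

/-- The clauses for tilings of a square of side `2 ^ N` with the input `w`. -/
noncomputable def clauses [Fintype α] [Fintype T] (N : ℕ) (w : List α) : List (Clause T) :=
  wordClauses w ++ generalClauses S N

end Clauses

/-! ### The meaning of the clauses -/

section Satisfies

variable {T α : Type} [Encodable α]

/-- The letters `b` hold the successor of the number held by `a`, with carries `c`, for which
nothing is said about an overflow after `N` digits. -/
structure AddsOne (N : ℕ) (u : Letter T → Prop) (a c b : ℕ → Letter T) : Prop where
  carry_zero : u (c 0)
  carry_succ : ∀ j < N, u (c (j + 1)) ↔ u (c j) ∧ u (a j)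
  sum : ∀ j < N, u (b j) ↔ ¬ (u (a j) ↔ u (c j))

/-- What the clauses say about a valuation. -/
structure Satisfies (S : TileSystem α T) (N : ℕ) (w : List α) (u : Letter T → Prop) : Prop where
  letter : ∀ s (h : s < w.length), u (.columnEq s) → ¬ u (.symbolNe (Encodable.encode (some w[s])))
  columnGe_succ : ∀ s < w.length, u (.columnGe s) → u (.columnEq s) ∨ u (.columnGe (s + 1))
  blank : u (.columnGe w.length) → ¬ u (.symbolNe (Encodable.encode (none : Option α)))
  digit : ∀ x, ∀ j < N, u (.digit x false j) → ¬ u (.digit x true j)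
  chain_zero : ∀ j < N, u (.chain 0 j) ↔ ¬ u (.sum .column j)
  counter : ∀ g : Counter, AddsOne N u g.digit (.carry g) (.sum g)
  copy : ∀ κ x, u (.kind κ) → ∀ j < N, u (.claim (.digit x j)) ↔ u (κ.digit x j)
  chain : ∀ s < N, AddsOne N u (.chain s) (.chainCarry s) (.chain (s + 1))
  columnEq : ∀ s < N, u (.columnEq s) ↔ u (.chainCarry s N)
  columnGe_zero : u (.columnGe 0)
  kind : ∃ κ, u (.kind κ)
  last : u (.carry .row N) → u (.kind .next)
  negative : ∀ κ, κ ≠ .next → u (.kind κ) → u .negative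
  positive : u (.kind .next) → u .positive
  unique : ∀ a b, u (.claim (.tile a)) → u (.claim (.tile b)) → a = b
  left : ∀ a b c, u (.kind .left) → u (.leafType (a, b, c)) → u (.claim (.tile a))
  middle : ∀ a b c, u (.kind .middle) → u (.leafType (a, b, c)) → u (.claim (.tile b))
  right : ∀ a b c, u (.kind .right) → u (.leafType (a, b, c)) → u (.claim (.tile c))
  next : ∀ a b c, u (.kind .next) → u (.leafType (a, b, c)) →
    u (.carry .row N) ∨ ∃ ρ ∈ S.next a b c, u (.claim (.tile ρ))
  first : ∀ o b, u (.carry .row N) → (b = true ↔ u (.columnEq 0)) →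
    u (.symbolNe (Encodable.encode o)) ∨ ∃ ρ ∈ S.first o b, u (.claim (.tile ρ))

variable {S : TileSystem α T} {N : ℕ} {w : List α} {u : Letter T → Prop}

theorem forall_mem_succClauses_holds {a c b : ℕ → Letter T} {j : ℕ} :
    (∀ φ ∈ succClauses a c b j, φ.Holds u) ↔
      (u (c (j + 1)) ↔ u (c j) ∧ u (a j)) ∧ (u (b j) ↔ ¬ (u (a j) ↔ u (c j))) := by
  simp only [succClauses, Clause.Holds, List.forall_mem_cons, List.exists_mem_cons_iff,
    List.not_mem_nil, false_and, exists_false, or_false, false_imp_iff, implies_true, and_true]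
  tauto

theorem forall_mem_copyClauses_holds {κ : Kind} {x : Axis} {j : ℕ} :
    (∀ φ ∈ copyClauses κ x j, φ.Holds u) ↔
      (u (.kind κ) → (u (.claim (.digit x j)) ↔ u (κ.digit x j))) := by
  simp only [copyClauses, Clause.Holds, List.forall_mem_cons, List.exists_mem_cons_iff,
    List.not_mem_nil, false_and, exists_false, or_false, false_imp_iff, implies_true, and_true]
  tauto

theorem forall_mem_bitClauses_holds {j : ℕ} : (∀ φ ∈ bitClauses j, φ.Holds u) ↔
    (∀ x, u (.digit x false j) → ¬ u (.digit x true j)) ∧ (u (.chain 0 j) ↔ ¬ u (.sum .column j)) ∧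
    (∀ g : Counter, (u (.carry g (j + 1)) ↔ u (.carry g j) ∧ u (g.digit j)) ∧
      (u (.sum g j) ↔ ¬ (u (g.digit j) ↔ u (.carry g j)))) ∧
    ∀ κ x, u (.kind κ) → (u (.claim (.digit x j)) ↔ u (κ.digit x j)) := by
  simp only [bitClauses, List.forall_mem_append, List.forall_mem_map, List.forall_mem_flatMap,
    forall_mem_succClauses_holds, forall_mem_copyClauses_holds]
  refine and_congr ?_ (and_congr ?_ (and_congr ?_ ?_))
  · simp only [Clause.Holds, List.forall_mem_cons, List.not_mem_nil, false_and, exists_false,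
      false_imp_iff, implies_true, and_true]
    exact ⟨fun h x h₀ h₁ => by cases x <;> tauto, fun h => ⟨fun h' => h _ h'.1 h'.2,
      fun h' => h _ h'.1 h'.2⟩⟩
  · simp only [Clause.Holds, List.forall_mem_cons, List.exists_mem_cons_iff, List.not_mem_nil,
      false_and, exists_false, or_false, false_imp_iff, implies_true, and_true]
    tauto
  · exact ⟨fun h g => h g (by cases g <;> simp), fun h g _ => h g⟩
  · exact ⟨fun h κ x => h κ (by cases κ <;> simp) x (by cases x <;> simp), fun h κ _ x _ => h κ x⟩

theorem forall_mem_chainClauses_holds {s : ℕ} : (∀ φ ∈ chainClauses N s, φ.Holds u) ↔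
    AddsOne N u (.chain s) (.chainCarry s) (.chain (s + 1)) ∧
      (u (.columnEq s) ↔ u (.chainCarry s N)) := by
  simp only [chainClauses, List.forall_mem_append, List.forall_mem_flatMap, List.mem_range,
    forall_mem_succClauses_holds]
  simp only [Clause.Holds, List.forall_mem_cons, List.exists_mem_cons_iff, List.not_mem_nil,
    false_and, exists_false, or_false, false_imp_iff, implies_true, and_true, true_imp_iff]
  exact ⟨fun ⟨⟨h₀, h₁, h₂⟩, h⟩ => ⟨⟨h₀, fun j hj => (h j hj).1, fun j hj => (h j hj).2⟩, h₂, h₁⟩,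
    fun ⟨h, h'⟩ => ⟨⟨h.carry_zero, h'.2, h'.1⟩, fun j hj => ⟨h.carry_succ j hj, h.sum j hj⟩⟩⟩

theorem forall_mem_choiceClauses_holds : (∀ φ ∈ choiceClauses N, φ.Holds u) ↔
    (∀ g, u (.carry g 0)) ∧ u (.columnGe 0) ∧ (∃ κ, u (.kind κ)) ∧
    (u (.carry .row N) → u (.kind .next)) ∧ (∀ κ, κ ≠ .next → u (.kind κ) → u .negative) ∧
    (u (.kind .next) → u .positive) := by
  simp only [choiceClauses, List.forall_mem_append, List.forall_mem_map, Clause.Holds,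
    List.forall_mem_cons, List.exists_mem_cons_iff, List.not_mem_nil, false_and, exists_false,
    or_false, false_imp_iff, implies_true, and_true, true_imp_iff]
  constructor
  · rintro ⟨h₁, h₂, h₃, h₄, h₅, h₆, h₇, h₈⟩
    refine ⟨fun g => by cases g <;> tauto, h₂, ?_, h₄, fun κ hκ => by cases κ <;> tauto, h₈⟩
    rcases h₃ with h | h | h | h <;> exact ⟨_, h⟩
  · rintro ⟨h₁, h₂, ⟨κ, hκ⟩, h₄, h₅, h₆⟩
    exact ⟨⟨h₁ _, h₁ _, h₁ _⟩, h₂, by cases κ <;> tauto, h₄, h₅ _ nofun, h₅ _ nofun, h₅ _ nofun,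
      h₆⟩

theorem uniqueClause_holds {a b : T} : (uniqueClause (a, b)).Holds u ↔
    ¬ (u (.claim (.tile a)) ∧ u (.claim (.tile b))) := by
  simp [uniqueClause, Clause.Holds]

omit [Encodable α] in
theorem forall_mem_tileClauses_holds {a b c : T} :
    (∀ φ ∈ tileClauses S N (a, b, c), φ.Holds u) ↔
    (u (.kind .left) → u (.leafType (a, b, c)) → u (.claim (.tile a))) ∧
    (u (.kind .middle) → u (.leafType (a, b, c)) → u (.claim (.tile b))) ∧
    (u (.kind .right) → u (.leafType (a, b, c)) → u (.claim (.tile c))) ∧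
    (u (.kind .next) → u (.leafType (a, b, c)) →
      u (.carry .row N) ∨ ∃ ρ ∈ S.next a b c, u (.claim (.tile ρ))) := by
  simp [tileClauses, Clause.Holds]

theorem forall_mem_initClauses_holds {o : Option α} :
    (∀ φ ∈ initClauses S N o, φ.Holds u) ↔
    ∀ b, u (.carry .row N) → (b = true ↔ u (.columnEq 0)) →
      u (.symbolNe (Encodable.encode o)) ∨ ∃ ρ ∈ S.first o b, u (.claim (.tile ρ)) := by
  simp only [initClauses, Clause.Holds, List.forall_mem_cons, List.exists_mem_cons_iff,
    List.mem_map, exists_exists_and_eq_and, Finset.mem_toList, List.not_mem_nil, false_imp_iff,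
    implies_true, and_true, Bool.forall_bool, true_iff, Bool.false_eq_true, false_iff]
  tauto

theorem forall_mem_letterClauses_holds {s : ℕ} {a : α} :
    (∀ φ ∈ letterClauses s a, φ.Holds u) ↔
    (u (.columnEq s) → ¬ u (.symbolNe (Encodable.encode (some a)))) ∧
      (u (.columnGe s) → u (.columnEq s) ∨ u (.columnGe (s + 1))) := by
  simp only [letterClauses, Clause.Holds, List.forall_mem_cons, List.exists_mem_cons_iff,
    List.not_mem_nil, false_and, exists_false, or_false, false_imp_iff, implies_true, and_true]
  tauto

theorem forall_mem_wordClauses_holds :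
    (∀ φ ∈ wordClauses w, φ.Holds u) ↔
    (∀ s (h : s < w.length), u (.columnEq s) → ¬ u (.symbolNe (Encodable.encode (some w[s])))) ∧
    (∀ s < w.length, u (.columnGe s) → u (.columnEq s) ∨ u (.columnGe (s + 1))) ∧
    (u (.columnGe w.length) → ¬ u (.symbolNe (Encodable.encode (none : Option α)))) := by
  have hzip (P : ℕ → α → Prop) :
      (∀ p ∈ w.zipIdx, P p.2 p.1) ↔ ∀ s (h : s < w.length), P s w[s] := by
    simp only [Prod.forall, List.mem_zipIdx_iff_getElem?, List.getElem?_eq_some_iff]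
    exact ⟨fun h s hs => h _ s ⟨hs, rfl⟩, fun h a s ⟨hs, ha⟩ => ha ▸ h s hs⟩
  rw [wordClauses, List.forall_mem_append, List.forall_mem_flatMap, List.forall_mem_singleton,
    ← and_assoc]
  refine and_congr ?_ (by simp [Clause.Holds])
  simp only [forall_mem_letterClauses_holds]
  rw [hzip fun s a => (u (.columnEq s) → ¬ u (.symbolNe (Encodable.encode (some a)))) ∧
    (u (.columnGe s) → u (.columnEq s) ∨ u (.columnGe (s + 1)))]
  simp only [forall_and]

theorem forall_mem_clauses_holds [Fintype α] [Fintype T] :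
    (∀ φ ∈ clauses S N w, φ.Holds u) ↔ Satisfies S N w u := by
  rw [clauses, generalClauses]
  simp only [List.forall_mem_append, List.forall_mem_flatMap, List.forall_mem_map,
    List.mem_range, Finset.mem_toList, Finset.mem_filter, Finset.mem_univ, true_and,
    true_imp_iff, Prod.forall, forall_mem_wordClauses_holds, forall_mem_bitClauses_holds,
    forall_mem_chainClauses_holds, forall_mem_choiceClauses_holds, uniqueClause_holds,
    forall_mem_tileClauses_holds, forall_mem_initClauses_holds]
  constructor
  · rintro ⟨⟨hletter, hge, hblank⟩, hbit, hchain, ⟨hcarry, hge₀, hkind, hlast, hneg, hpos⟩,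
      hunique, htile, hfirst⟩
    exact {
      letter := hletter
      columnGe_succ := hge
      blank := hblank
      digit := fun x j hj => (hbit j hj).1 x
      chain_zero := fun j hj => (hbit j hj).2.1
      counter := fun g => ⟨hcarry g, fun j hj => ((hbit j hj).2.2.1 g).1,
        fun j hj => ((hbit j hj).2.2.1 g).2⟩
      copy := fun κ x hκ j hj => (hbit j hj).2.2.2 κ x hκ
      chain := fun s hs => (hchain s hs).1
      columnEq := fun s hs => (hchain s hs).2
      columnGe_zero := hge₀
      kind := hkind
      last := hlast
      negative := hneg
      positive := hpos
      unique := fun a b ha hb => not_not.1 fun hab => hunique a b hab ⟨ha, hb⟩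
      left := fun a b c => (htile a b c).1
      middle := fun a b c => (htile a b c).2.1
      right := fun a b c => (htile a b c).2.2.1
      next := fun a b c => (htile a b c).2.2.2
      first := hfirst }
  · intro h
    exact ⟨⟨h.letter, h.columnGe_succ, h.blank⟩, fun j hj => ⟨fun x => h.digit x j hj,
      h.chain_zero j hj, fun g => ⟨(h.counter g).carry_succ j hj, (h.counter g).sum j hj⟩,
      fun κ x hκ => h.copy κ x hκ j hj⟩, fun s hs => ⟨h.chain s hs, h.columnEq s hs⟩,
      ⟨fun g => (h.counter g).carry_zero, h.columnGe_zero, h.kind, h.last, h.negative, h.positive⟩,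
      fun a b hab h' => hab (h.unique a b h'.1 h'.2),
      fun a b c => ⟨h.left a b c, h.middle a b c, h.right a b c, h.next a b c⟩, h.first⟩

end Satisfies

end DL.Reduction

namespace DL.Reduction

/-! ### Valuations and tilings -/

section Arithmetic

variable {T : Type} {N : ℕ} {u : Letter T → Prop} {a b c : ℕ → Letter T} {x : ZMod (2 ^ N)}

/-- The letters `a 0, …, a (N - 1)` hold the number `x` in binary, the lowest digit first. -/
def IsBinary (N : ℕ) (u : Letter T → Prop) (a : ℕ → Letter T) (x : ZMod (2 ^ N)) : Prop :=
  ∀ j < N, u (a j) ↔ x.val.testBit j = true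

theorem AddsOne.carry_iff (h : AddsOne N u a c b) (ha : IsBinary N u a x) :
    ∀ j ≤ N, u (c j) ↔ ∀ k < j, x.val.testBit k = true
  | 0, _ => by simpa using h.carry_zero
  | j + 1, hj => by
    rw [h.carry_succ j hj, h.carry_iff ha j (by omega), ha j hj, Nat.forall_lt_succ_right]

theorem AddsOne.overflow_iff (h : AddsOne N u a c b) (ha : IsBinary N u a x) :
    u (c N) ↔ x + 1 = 0 := by
  rw [h.carry_iff ha N le_rfl, forall_testBit_val_iff]

theorem AddsOne.isBinary (h : AddsOne N u a c b) (ha : IsBinary N u a x) :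
    IsBinary N u b (x + 1) := fun j hj => by
  rw [h.sum j hj, ha j hj, h.carry_iff ha j hj.le, testBit_val_add_one_iff x hj]

theorem addsOne_of_isBinary (ha : IsBinary N u a x) (hb : IsBinary N u b (x + 1))
    (hc : ∀ j, u (c j) ↔ ∀ k < j, x.val.testBit k = true) : AddsOne N u a c b where
  carry_zero := by simp [hc]
  carry_succ j hj := by rw [hc, hc, ha j hj, Nat.forall_lt_succ_right]
  sum j hj := by rw [hb j hj, ha j hj, hc, testBit_val_add_one_iff x hj]

end Arithmetic

section Claims

variable {T α : Type} {N : ℕ}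

/-- The cell in row `t` and column `i`. -/
def cell (t i : ZMod (2 ^ N)) : Axis → ZMod (2 ^ N)
  | .row => t
  | .column => i

/-- The number to which the counter adds `1` at a leaf with the position `p`. -/
def Counter.value : Counter → (Axis → ZMod (2 ^ N)) → ZMod (2 ^ N)
  | .row, p => p .row
  | .column, p => p .column
  | .column', p => p .column + 1

/-- The cell that a claim of the given kind is about at a leaf with the position `p`. -/
def Kind.cell : Kind → (Axis → ZMod (2 ^ N)) → Axis → ZMod (2 ^ N)
  | .left, p => p
  | .middle, p => Reduction.cell (p .row) (p .column + 1)
  | .right, p => Reduction.cell (p .row) (p .column + 2)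
  | .next, p => Reduction.cell (p .row + 1) (p .column + 1)

/-- The letter for positive or negative claims, depending on the kind of the claim. -/
def Kind.sign : Kind → Letter T
  | .next => .positive
  | _ => .negative

/-- The leaf with the valuation `u` makes a claim about the cell `q` and the tile `ρ`. -/
structure Claims (N : ℕ) (u : Letter T → Prop) (q : Axis → ZMod (2 ^ N)) (ρ : T) : Prop where
  digit : ∀ x, IsBinary N u (fun j => .claim (.digit x j)) (q x)
  tile : ∀ σ, u (.claim (.tile σ)) ↔ σ = ρ

/-- The claims, given by a kind and a tile, between which a leaf of type `τ` at the position `p`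
has to choose. -/
def Admissible (S : TileSystem α T) (w : List α) (p : Axis → ZMod (2 ^ N)) (τ : T × T × T) :
    Kind → T → Prop
  | .left, ρ => p .row + 1 ≠ 0 ∧ ρ = τ.1
  | .middle, ρ => p .row + 1 ≠ 0 ∧ ρ = τ.2.1
  | .right, ρ => p .row + 1 ≠ 0 ∧ ρ = τ.2.2
  | .next, ρ =>
    if p .row + 1 = 0 then ρ ∈ S.first w[(p .column + 1).val]? (decide (p .column + 1 = 0))
    else ρ ∈ S.next τ.1 τ.2.1 τ.2.2

end Claims

section Soundness

variable {T α : Type} [Encodable α] {S : TileSystem α T} {N : ℕ} {w : List α}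
  {u : Letter T → Prop} {p : Axis → ZMod (2 ^ N)}

namespace Satisfies

theorem isBinary_counter_digit (h : Satisfies S N w u)
    (hp : ∀ x, IsBinary N u (.digit x true) (p x)) :
    ∀ g : Counter, IsBinary N u g.digit (g.value p)
  | .row => hp .row
  | .column => hp .column
  | .column' => (h.counter .column).isBinary (hp .column)

theorem isBinary_sum (h : Satisfies S N w u)
    (hp : ∀ x, IsBinary N u (.digit x true) (p x)) (g : Counter) :
    IsBinary N u (.sum g) (g.value p + 1) :=
  (h.counter g).isBinary (h.isBinary_counter_digit hp g)

theorem carry_row_iff (h : Satisfies S N w u) (hp : ∀ x, IsBinary N u (.digit x true) (p x)) :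
    u (.carry .row N) ↔ p .row + 1 = 0 :=
  (h.counter .row).overflow_iff (hp .row)

theorem isBinary_kind_digit (h : Satisfies S N w u)
    (hp : ∀ x, IsBinary N u (.digit x true) (p x)) (κ : Kind) (x : Axis) :
    IsBinary N u (κ.digit x) (κ.cell p x) := by
  have hright := h.isBinary_sum hp .column'
  rw [Counter.value, add_assoc, one_add_one_eq_two] at hright
  cases κ <;> cases x
  exacts [hp .row, hp .column, hp .row, h.isBinary_sum hp .column, hp .row, hright,
    h.isBinary_sum hp .row, h.isBinary_sum hp .column]

theorem claims (h : Satisfies S N w u) (hp : ∀ x, IsBinary N u (.digit x true) (p x)) {κ : Kind}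
    (hκ : u (.kind κ)) {ρ : T} (hρ : u (.claim (.tile ρ))) : Claims N u (κ.cell p) ρ where
  digit x j hj := (h.copy κ x hκ j hj).trans (h.isBinary_kind_digit hp κ x j hj)
  tile σ := ⟨fun hσ => h.unique σ ρ hσ hρ, fun hσ => hσ ▸ hρ⟩

theorem columnEq_iff (h : Satisfies S N w u) (hp : ∀ x, IsBinary N u (.digit x true) (p x))
    {s : ℕ} (hs : s < N) : u (.columnEq s) ↔ (p .column + 1).val = s := by
  have hchain : ∀ s ≤ N, IsBinary N u (.chain s) (s - (p .column + 1 + 1)) := by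
    intro s
    induction s with
    | zero =>
      intro _ j hj
      rw [h.chain_zero j hj, h.isBinary_sum hp .column j hj, Nat.cast_zero, zero_sub,
        testBit_val_neg_add_one _ hj]
      simp [Counter.value]
    | succ s ih =>
      intro hs
      have := (h.chain s hs).isBinary (ih (by omega))
      rwa [sub_add_eq_add_sub, ← Nat.cast_succ] at this
  rw [h.columnEq s hs, (h.chain s hs).overflow_iff (hchain s hs.le), val_eq_iff_natCast_eq hs,
    ← sub_eq_zero (a := (s : ZMod (2 ^ N)))]
  ring_nf

theorem columnGe_of_le (h : Satisfies S N w u) (hw : w.length ≤ N)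
    (hp : ∀ x, IsBinary N u (.digit x true) (p x)) :
    ∀ s ≤ w.length, s ≤ (p .column + 1).val → u (.columnGe s)
  | 0, _, _ => h.columnGe_zero
  | s + 1, hs, hle =>
    (h.columnGe_succ s hs (h.columnGe_of_le hw hp s (by omega) (by omega))).resolve_left
      fun heq => Nat.ne_of_gt hle ((h.columnEq_iff hp (by omega)).1 heq)

theorem not_symbolNe (h : Satisfies S N w u) (hw : w.length ≤ N)
    (hp : ∀ x, IsBinary N u (.digit x true) (p x)) :
    ¬ u (.symbolNe (Encodable.encode w[(p .column + 1).val]?)) := by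
  by_cases hlt : (p .column + 1).val < w.length
  · rw [List.getElem?_eq_getElem hlt]
    exact h.letter _ hlt ((h.columnEq_iff hp (hlt.trans_le hw)).2 rfl)
  · rw [List.getElem?_eq_none (not_lt.1 hlt)]
    exact h.blank (h.columnGe_of_le hw hp _ le_rfl (not_lt.1 hlt))

theorem exists_first (h : Satisfies S N w u) (hw : w.length ≤ N) (hN : 0 < N)
    (hp : ∀ x, IsBinary N u (.digit x true) (p x)) (hrow : p .row + 1 = 0) :
    ∃ ρ ∈ S.first w[(p .column + 1).val]? (decide (p .column + 1 = 0)), u (.claim (.tile ρ)) := by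
  refine (h.first _ _ ((h.carry_row_iff hp).2 hrow) ?_).resolve_left (h.not_symbolNe hw hp)
  rw [h.columnEq_iff hp hN, ZMod.val_eq_zero, decide_eq_true_iff]

theorem exists_admissible (h : Satisfies S N w u) (hw : w.length ≤ N) (hN : 0 < N)
    (hp : ∀ x, IsBinary N u (.digit x true) (p x)) {τ : T × T × T} (hτ : u (.leafType τ)) :
    ∃ κ ρ, Admissible S w p τ κ ρ ∧ u κ.sign ∧ Claims N u (κ.cell p) ρ := by
  obtain ⟨a, b, c⟩ := τ
  by_cases hrow : p .row + 1 = 0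
  · have hnext := h.last ((h.carry_row_iff hp).2 hrow)
    obtain ⟨ρ, hρ, hclaim⟩ := h.exists_first hw hN hp hrow
    exact ⟨.next, ρ, by rwa [Admissible, if_pos hrow], h.positive hnext, h.claims hp hnext hclaim⟩
  · obtain ⟨κ, hκ⟩ := h.kind
    cases κ with
    | left =>
      exact ⟨.left, a, ⟨hrow, rfl⟩, h.negative .left nofun hκ,
        h.claims hp hκ (h.left a b c hκ hτ)⟩
    | middle =>
      exact ⟨.middle, b, ⟨hrow, rfl⟩, h.negative .middle nofun hκ,
        h.claims hp hκ (h.middle a b c hκ hτ)⟩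
    | right =>
      exact ⟨.right, c, ⟨hrow, rfl⟩, h.negative .right nofun hκ,
        h.claims hp hκ (h.right a b c hκ hτ)⟩
    | next =>
      obtain ⟨ρ, hρ, hclaim⟩ := (h.next a b c hκ hτ).resolve_left fun hlast =>
        hrow ((h.carry_row_iff hp).1 hlast)
      exact ⟨.next, ρ, by rwa [Admissible, if_neg hrow], h.positive hκ, h.claims hp hκ hclaim⟩

end Satisfies

variable [Fintype α] [Fintype T] {v : Addresses → T × T × T → Letter T → Prop}

theorem IsConsistentFamily.satisfies (h : IsConsistentFamily N (Reduction.clauses S N w) v)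
    (z : Addresses) (τ : T × T × T) : Satisfies S N w (v z τ) :=
  forall_mem_clauses_holds.1 (h.clauses z τ)

theorem IsConsistentFamily.isBinary (h : IsConsistentFamily N (Reduction.clauses S N w) v)
    (p : Axis → ZMod (2 ^ N)) (τ : T × T × T) (x : Axis) :
    IsBinary N (v (fun x j => (p x).val.testBit j) τ) (.digit x true) (p x) := fun j hj => by
  have hdigit := h.digit (fun x j => (p x).val.testBit j) τ x j hj
  refine ⟨fun htrue => not_not.1 fun hfalse => ?_, fun htrue => by simpa only [htrue] using hdigit⟩
  rw [Bool.not_eq_true] at hfalse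
  simp only [hfalse] at hdigit
  exact (h.satisfies _ τ).digit x j hj hdigit htrue

theorem IsConsistentFamily.not_claims {Φ : List (Clause T)} (h : IsConsistentFamily N Φ v)
    {z z' : Addresses} {τ τ' : T × T × T} {q : Axis → ZMod (2 ^ N)} {ρ : T}
    (hpos : v z τ .positive) (hq : Claims N (v z τ) q ρ) (hneg : v z' τ' .negative) :
    ¬ Claims N (v z' τ') q ρ := by
  intro hq'
  obtain ⟨b | σ, hb, hne⟩ := h.claims z τ z' τ' hpos hneg
  · rename_i j
    rw [digit_mem_bits] at hb
    exact hne ((hq.digit b j hb).trans (hq'.digit b j hb).symm)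
  · exact hne ((hq.tile σ).trans (hq'.tile σ).symm)

end Soundness

end DL.Reduction

namespace DL.Reduction

section Existence

variable {α T : Type} {S : TileSystem α T} {w : List α}

theorem TileSystem.exists_isTiling {L : ℕ} [NeZero L] {P : ZMod L → ZMod L → T → Prop}
    (hfirst : ∀ i, ∃ ρ ∈ S.first w[i.val]? (decide (i = 0)), P 0 i ρ)
    (hnext : ∀ t i a b c, t + 1 ≠ 0 → P t i a → P t (i + 1) b → P t (i + 2) c →
      ∃ ρ ∈ S.next a b c, P (t + 1) (i + 1) ρ) :
    ∃ X, S.IsTiling w (L := L) X := by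
  have hsucc : ∀ (t : ZMod L) (R : ZMod L → T), ∃ R' : ZMod L → T, t + 1 ≠ 0 → (∀ i, P t i (R i)) →
      ∀ i, R' (i + 1) ∈ S.next (R i) (R (i + 1)) (R (i + 2)) ∧ P (t + 1) (i + 1) (R' (i + 1)) := by
    intro t R
    by_cases h : t + 1 ≠ 0 ∧ ∀ i, P t i (R i)
    · choose g hg hg' using fun i => hnext t i _ _ _ h.1 (h.2 i) (h.2 (i + 1)) (h.2 (i + 2))
      exact ⟨fun i => g (i - 1), fun _ _ i => by simpa using ⟨hg i, hg' i⟩⟩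
    · exact ⟨R, fun h₁ h₂ => absurd ⟨h₁, h₂⟩ h⟩
  choose row₀ hrow₀ hrow₀' using hfirst
  choose succ hsucc using hsucc
  let row (n : ℕ) : ZMod L → T := Nat.rec row₀ (fun n R => succ n R) n
  have hrow (n : ℕ) (hn : n < L) : ∀ i, P n i (row n i) := by
    induction n with
    | zero => simpa [row] using hrow₀'
    | succ n ih =>
      intro i
      simpa using (hsucc n (row n) (natCast_add_one_ne_zero hn) (ih (by omega)) (i - 1)).2
  refine ⟨fun t => row t.val, fun i => by simpa [row] using hrow₀ i, fun t i ht => ?_⟩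
  rw [val_add_one_of_ne_zero ht]
  have hne : (t.val + 1 : ZMod L) ≠ 0 := by simpa using ht
  exact (hsucc _ (row t.val) hne (hrow _ t.val_lt) i).1

variable [Encodable α] {N : ℕ}

theorem IsConsistentFamily.exists_isTiling [Fintype α] [Fintype T]
    {v : Addresses → T × T × T → Letter T → Prop}
    (h : IsConsistentFamily N (Reduction.clauses S N w) v) (hw : w.length ≤ N) (hN : 0 < N)
    [Nonempty T] : ∃ X, S.IsTiling w (L := 2 ^ N) X := by
  have hclaim (p : Axis → ZMod (2 ^ N)) (τ : T × T × T) :=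
    (h.satisfies _ τ).exists_admissible hw hN (h.isBinary p τ) (h.type _ τ)
  refine TileSystem.exists_isTiling (P := fun t i ρ =>
    ∃ z τ, v z τ .positive ∧ Claims N (v z τ) (cell t i) ρ) (fun i => ?_) ?_
  · obtain ⟨ρ₀⟩ := ‹Nonempty T›
    obtain ⟨κ, ρ, hadm, hsign, hρ⟩ := hclaim (cell (-1) (i - 1)) (ρ₀, ρ₀, ρ₀)
    cases κ with
    | next =>
      simp only [Admissible, Kind.cell, cell, neg_add_cancel, sub_add_cancel, if_true] at hadm hρ
      exact ⟨ρ, hadm, _, _, hsign, hρ⟩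
    | _ => exact absurd (neg_add_cancel 1) hadm.1
  · rintro t i a b c ht ⟨_, _, ha, ha'⟩ ⟨_, _, hb, hb'⟩ ⟨_, _, hc, hc'⟩
    obtain ⟨κ, ρ, hadm, hsign, hρ⟩ := hclaim (cell t i) (a, b, c)
    cases κ with
    | left =>
      obtain ⟨-, rfl⟩ := hadm
      exact absurd hρ (h.not_claims ha ha' hsign)
    | middle =>
      obtain ⟨-, rfl⟩ := hadm
      exact absurd hρ (h.not_claims hb hb' hsign)
    | right =>
      obtain ⟨-, rfl⟩ := hadm
      exact absurd hρ (h.not_claims hc hc' hsign)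
    | next =>
      exact ⟨ρ, (if_neg ht).mp hadm, _, _, hsign, hρ⟩

/-- The valuation of a leaf of type `τ` at the position `p` that makes a claim of kind `κ` about
the tile `ρ`. -/
def leafValuation (w : List α) (p : Axis → ZMod (2 ^ N)) (τ : T × T × T) (κ : Kind) (ρ : T) :
    Letter T → Prop
  | .digit x b j => b = (p x).val.testBit j
  | .leafType σ => σ = τ
  | .claim (.digit x j) => (κ.cell p x).val.testBit j = true
  | .claim (.tile σ) => σ = ρ
  | .positive => κ = .next
  | .negative => κ ≠ .next
  | .kind κ' => κ' = κ
  | .carry g j => ∀ k < j, (g.value p).val.testBit k = true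
  | .sum g j => (g.value p + 1).val.testBit j = true
  | .chain s j => (s - (p .column + 1 + 1) : ZMod (2 ^ N)).val.testBit j = true
  | .chainCarry s j => ∀ k < j, (s - (p .column + 1 + 1) : ZMod (2 ^ N)).val.testBit k = true
  | .columnEq s => (p .column + 1).val = s
  | .columnGe s => s ≤ (p .column + 1).val
  | .symbolNe c => c ≠ Encodable.encode w[(p .column + 1).val]?

theorem isBinary_leafValuation_kind_digit {p : Axis → ZMod (2 ^ N)} {τ : T × T × T} {κ : Kind}
    {ρ : T} (κ' : Kind) (x : Axis) :
    IsBinary N (leafValuation w p τ κ ρ) (κ'.digit x) (κ'.cell p x) := fun j _ => by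
  cases κ' <;> cases x <;>
    simp [Kind.digit, Kind.cell, cell, leafValuation, Counter.value, add_assoc, one_add_one_eq_two]

variable {p : Axis → ZMod (2 ^ N)} {τ : T × T × T} {κ : Kind} {ρ : T}

theorem leafValuation_carry_row : leafValuation w p τ κ ρ (.carry .row N) ↔ p .row + 1 = 0 :=
  forall_testBit_val_iff _

theorem leafValuation_columnEq_iff {s : ℕ} (hs : s < N) :
    leafValuation w p τ κ ρ (.columnEq s) ↔ leafValuation w p τ κ ρ (.chainCarry s N) := by
  simp only [leafValuation]
  rw [forall_testBit_val_iff, val_eq_iff_natCast_eq hs, ← sub_eq_zero]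
  ring_nf

theorem addsOne_leafValuation_counter (g : Counter) :
    AddsOne N (leafValuation w p τ κ ρ) g.digit (.carry g) (.sum g) := by
  refine addsOne_of_isBinary (x := g.value p) (fun j _ => ?_) (fun _ _ => .rfl) fun _ => .rfl
  cases g <;> simp [Counter.digit, leafValuation, Counter.value]

theorem addsOne_leafValuation_chain (s : ℕ) :
    AddsOne N (leafValuation w p τ κ ρ) (.chain s) (.chainCarry s) (.chain (s + 1)) := by
  refine addsOne_of_isBinary (x := s - (p .column + 1 + 1)) (fun _ _ => .rfl) (fun j _ => ?_)
    fun _ => .rfl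
  simp only [leafValuation, Nat.cast_succ, sub_add_eq_add_sub]

theorem symbolNe_or_exists_mem_first_of_admissible (hadm : Admissible S w p τ κ ρ)
    (hrow : p .row + 1 = 0) {o : Option α} {b : Bool} (hb : b = true ↔ p .column + 1 = 0) :
    leafValuation w p τ κ ρ (.symbolNe (Encodable.encode o)) ∨
      ∃ σ ∈ S.first o b, leafValuation w p τ κ ρ (.claim (.tile σ)) := by
  obtain rfl : b = decide (p .column + 1 = 0) := Bool.eq_iff_iff.2 (by rwa [decide_eq_true_iff])
  refine or_iff_not_imp_left.2 fun hcode => ⟨ρ, ?_, rfl⟩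
  obtain rfl : o = _ := Encodable.encode_injective (not_not.1 hcode)
  cases κ with
  | next => exact (if_pos hrow).mp hadm
  | _ => exact absurd hrow hadm.1

theorem satisfies_leafValuation (hadm : Admissible S w p τ κ ρ) :
    Satisfies S N w (leafValuation w p τ κ ρ) where
  letter s hs heq hne :=
    hne (by rw [show (p .column + 1).val = s from heq, List.getElem?_eq_getElem])
  columnGe_succ s _ hle := by
    simp only [leafValuation] at hle ⊢
    omega
  blank hle hne := hne (by rw [List.getElem?_eq_none hle])
  digit x j _ hfalse htrue := Bool.noConfusion (hfalse.trans htrue.symm)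
  chain_zero j hj := by
    simp only [leafValuation, Counter.value, Nat.cast_zero, zero_sub, testBit_val_neg_add_one _ hj]
    simp
  counter := addsOne_leafValuation_counter
  copy κ' x hκ j hj := by
    obtain rfl : κ' = κ := hκ
    exact (isBinary_leafValuation_kind_digit κ' x j hj).symm
  chain s _ := addsOne_leafValuation_chain s
  columnEq _ := leafValuation_columnEq_iff
  columnGe_zero := Nat.zero_le _
  kind := ⟨κ, rfl⟩
  last hrow := by
    cases κ with
    | next => rfl
    | _ => exact absurd (leafValuation_carry_row.1 hrow) hadm.1
  negative κ' hne hκ := by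
    obtain rfl : κ' = κ := hκ
    exact hne
  positive hκ := Eq.symm hκ
  unique a b ha hb := Eq.trans ha (Eq.symm hb)
  left a b c hκ hτ := by
    obtain ⟨rfl, rfl⟩ : .left = κ ∧ (a, b, c) = τ := ⟨hκ, hτ⟩
    exact hadm.2.symm
  middle a b c hκ hτ := by
    obtain ⟨rfl, rfl⟩ : .middle = κ ∧ (a, b, c) = τ := ⟨hκ, hτ⟩
    exact hadm.2.symm
  right a b c hκ hτ := by
    obtain ⟨rfl, rfl⟩ : .right = κ ∧ (a, b, c) = τ := ⟨hκ, hτ⟩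
    exact hadm.2.symm
  next a b c hκ hτ := by
    obtain ⟨rfl, rfl⟩ : .next = κ ∧ (a, b, c) = τ := ⟨hκ, hτ⟩
    rw [leafValuation_carry_row]
    exact or_iff_not_imp_left.2 fun hrow => ⟨ρ, (if_neg hrow).mp hadm, rfl⟩
  first _ _ hrow hb := symbolNe_or_exists_mem_first_of_admissible hadm
    (leafValuation_carry_row.1 hrow) (hb.trans (ZMod.val_eq_zero _))

theorem claims_leafValuation : Claims N (leafValuation w p τ κ ρ) (κ.cell p) ρ where
  digit _ _ _ := .rfl
  tile _ := .rfl

omit [Encodable α] in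
theorem TileSystem.IsTiling.exists_admissible {X : ZMod (2 ^ N) → ZMod (2 ^ N) → T}
    (hX : S.IsTiling w X) (p : Axis → ZMod (2 ^ N)) (τ : T × T × T) :
    ∃ κ ρ, Admissible S w p τ κ ρ ∧ (κ = .next ↔ X (κ.cell p .row) (κ.cell p .column) = ρ) := by
  by_cases hrow : p .row + 1 = 0
  · refine ⟨.next, X 0 (p .column + 1), (if_pos hrow).mpr (hX.first _), ?_⟩
    simp [Kind.cell, cell, hrow]
  by_cases hleft : X (p .row) (p .column) = τ.1
  · by_cases hmiddle : X (p .row) (p .column + 1) = τ.2.1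
    · by_cases hright : X (p .row) (p .column + 2) = τ.2.2
      · refine ⟨.next, _, (if_neg hrow).mpr ?_, iff_of_true rfl rfl⟩
        rw [← hleft, ← hmiddle, ← hright]
        exact hX.next _ _ hrow
      · exact ⟨.right, _, ⟨hrow, rfl⟩, iff_of_false nofun hright⟩
    · exact ⟨.middle, _, ⟨hrow, rfl⟩, iff_of_false nofun hmiddle⟩
  · exact ⟨.left, _, ⟨hrow, rfl⟩, iff_of_false nofun hleft⟩

omit [Encodable α] in
theorem Claims.unique [Fintype T] {u u' : Letter T → Prop} {q q' : Axis → ZMod (2 ^ N)} {ρ ρ' : T}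
    (h : Claims N u q ρ) (h' : Claims N u' q' ρ')
    (hbits : ∀ b ∈ bits N, u (.claim b) ↔ u' (.claim b)) : q = q' ∧ ρ = ρ' := by
  refine ⟨funext fun x => eq_of_testBit_val_iff fun j hj => ?_, ?_⟩
  · rw [← h.digit x j hj, ← h'.digit x j hj]
    exact hbits _ (digit_mem_bits.2 hj)
  · rw [← h'.tile, ← hbits _ (tile_mem_bits N ρ), h.tile]

theorem TileSystem.IsTiling.exists_isConsistentFamily [Fintype α] [Fintype T]
    {X : ZMod (2 ^ N) → ZMod (2 ^ N) → T} (hX : S.IsTiling w X) :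
    ∃ v, IsConsistentFamily N (clauses S N w) v := by
  choose p hp using fun (z : Addresses) x => exists_testBit_val_eq N (z x)
  choose κ ρ hadm hκ using fun z => hX.exists_admissible (p z)
  refine ⟨fun z τ => leafValuation w (p z) τ (κ z τ) (ρ z τ), fun _ _ => rfl,
    fun z _ x j hj => (hp z x j hj).symm,
    fun z τ => forall_mem_clauses_holds.2 (satisfies_leafValuation (hadm z τ)), ?_⟩
  intro z τ z' τ' hpos hneg
  by_contra! hbits
  obtain ⟨hcell, htile⟩ := claims_leafValuation.unique claims_leafValuation hbits
  have hclaim := (hκ z τ).1 hpos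
  rw [hcell, htile] at hclaim
  exact hneg ((hκ z' τ').2 hclaim)

theorem entails_iff_not_exists_isTiling [Fintype α] [Fintype T] [Encodable T] [Nonempty T]
    (hw : w.length ≤ N) (hN : 0 < N) : (kb N (clauses S N w)).Entails (query T N) ↔
      ¬ ∃ X, S.IsTiling w (L := 2 ^ N) X := by
  rw [← not_iff_not, not_not, not_entails_iff_exists_isConsistentFamily]
  exact ⟨fun ⟨_, hv⟩ => hv.exists_isTiling hw hN, fun ⟨_, hX⟩ => hX.exists_isConsistentFamily⟩

end Existence

end DL.Reduction

/-! ### Computations as tilings -/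

namespace NTM

open Turing (Dir)
open DL.Reduction (TileSystem val_add_one_eq_or val_add_one_of_ne_zero
  natCast_add_one_ne_zero)

variable {α : Type} (M : NTM α)

/-- A transition, or `none` for a pause in the accepting state. -/
abbrev Instr := Option (M.Q × M.Γ × Dir)

/-- A tile describes a cell at some time: whether it is the leftmost one, its symbol, and, if the
head is there, the state and the next instruction. -/
abbrev Tile := Bool × M.Γ × Option (M.Q × M.Instr)

noncomputable instance : Fintype M.Tile :=
  have := M.finQ
  have := M.finΓ
  have : Finite Dir := Finite.of_injective (· = Dir.left) fun d e => by cases d <;> cases e <;> simp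
  Fintype.ofFinite _

noncomputable instance : Encodable M.Tile := Fintype.toEncodable _

instance : Nonempty M.Tile := ⟨(true, M.blank, none)⟩

variable {M}

/-- The instruction may be executed in the state `q` with the head on the symbol `γ`. -/
def Enabled (q : M.Q) (γ : M.Γ) : M.Instr → Prop
  | none => q = M.accept
  | some d => q ≠ M.accept ∧ d ∈ M.δ q γ

namespace Cfg

/-- The configuration after an instruction. -/
def next (c : M.Cfg) : M.Instr → M.Cfg
  | none => c
  | some (q, b, d) => ⟨q, move d c.head, Function.update c.tape c.head b⟩

/-- What can be seen of the `i`-th cell: whether it is the leftmost one, its symbol, and the state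
if the head is there. -/
def view (c : M.Cfg) (i : ℕ) : Bool × M.Γ × Option M.Q :=
  (decide (i = 0), c.tape i, if c.head = i then some c.state else none)

/-- The tile for the `i`-th cell if `tr` is the next instruction. -/
def tile (c : M.Cfg) (tr : M.Instr) (i : ℕ) : M.Tile :=
  (decide (i = 0), c.tape i, if c.head = i then some (c.state, tr) else none)

end Cfg

namespace Tile

/-- The tile without the instruction. -/
def view (x : M.Tile) : Bool × M.Γ × Option M.Q := (x.1, x.2.1, x.2.2.map Prod.fst)

/-- The instruction, if any, may be executed. -/
def IsValid (x : M.Tile) : Prop := ∀ q tr, x.2.2 = some (q, tr) → Enabled q x.2.1 tr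

/-- The symbol after the instruction. -/
def written (x : M.Tile) : M.Γ :=
  match x.2.2 with
  | some (_, some (_, b, _)) => b
  | _ => x.2.1

/-- The new state if the head moves from this cell to the left. -/
def toLeft (x : M.Tile) : Option M.Q :=
  match x.2.2 with
  | some (_, some (q, _, Dir.left)) => if x.1 then none else some q
  | _ => none

/-- The new state if the head stays at this cell. -/
def stay (x : M.Tile) : Option M.Q :=
  match x.2.2 with
  | some (q, none) => some q
  | some (_, some (q, _, Dir.left)) => if x.1 then some q else none
  | _ => none

/-- The new state if the head moves from this cell to the right. -/
def toRight (x : M.Tile) : Option M.Q :=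
  match x.2.2 with
  | some (_, some (q, _, Dir.right)) => some q
  | _ => none

/-- What can be seen of the cell of `y` after the instruction, where `x` and `z` are the tiles on
its left and on its right. -/
def nextView (x y z : M.Tile) : Bool × M.Γ × Option M.Q :=
  (y.1, y.written, x.toRight <|> y.stay <|> z.toLeft)

end Tile

variable (M) in
/-- The tiling problem whose solutions are the accepting computations of `M`. -/
noncomputable def tileSystem : TileSystem α M.Tile :=
  open Classical in
  { next x y z := Finset.univ.filter fun t => t.IsValid ∧ t.view = Tile.nextView x y z
    first o b := Finset.univ.filter fun t => t.IsValid ∧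
      t.view = (b, (o.map M.input).getD M.blank, if b then some M.start else none) }

theorem Cfg.head_next (c : M.Cfg) (tr : M.Instr) :
    (c.next tr).head = c.head ∨ (c.next tr).head = c.head + 1 ∨ (c.next tr).head + 1 = c.head := by
  rcases tr with - | ⟨q, b, d | d⟩
  · exact .inl rfl
  · change c.head - 1 = _ ∨ c.head - 1 = _ ∨ c.head - 1 + 1 = _
    omega
  · exact .inr (.inl rfl)

theorem Cfg.view_init (w : List α) (i : ℕ) : (M.init w).view i =
    (decide (i = 0), (w[i]?.map M.input).getD M.blank,
      if decide (i = 0) = true then some M.start else none) := by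
  simp [Cfg.view, init, eq_comm]

namespace Tile

theorem view_tile (c : M.Cfg) (tr : M.Instr) (i : ℕ) : (c.tile tr i).view = c.view i := by
  simp only [view, Cfg.tile, Cfg.view]
  split_ifs <;> rfl

theorem isValid_tile {c : M.Cfg} {tr : M.Instr} (h : Enabled c.state (c.tape c.head) tr) (i : ℕ) :
    (c.tile tr i).IsValid := by
  intro q tr' heq
  simp only [Cfg.tile, Option.ite_none_right_eq_some, Option.some.injEq, Prod.mk.injEq] at heq
  obtain ⟨rfl, rfl, rfl⟩ := heq
  exact h

theorem written_tile (c : M.Cfg) (tr : M.Instr) (i : ℕ) :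
    (c.tile tr i).written = (c.next tr).tape i := by
  by_cases h : c.head = i
  · subst h
    rcases tr with - | ⟨q, b, d⟩ <;> simp [written, Cfg.tile, Cfg.next]
  · rcases tr with - | ⟨q, b, d⟩ <;>
      simp [written, Cfg.tile, Cfg.next, h, Function.update_of_ne (Ne.symm h)]

theorem toLeft_tile (c : M.Cfg) (tr : M.Instr) (i : ℕ) : (c.tile tr i).toLeft =
    if c.head = i ∧ (c.next tr).head + 1 = i then some (c.next tr).state else none := by
  by_cases h : c.head = i
  · subst h
    rcases tr with - | ⟨q, b, d | d⟩
    · simp [toLeft, Cfg.tile, Cfg.next]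
    · by_cases h₀ : c.head = 0
      · simp [toLeft, Cfg.tile, Cfg.next, move, h₀]
      · simp [toLeft, Cfg.tile, Cfg.next, move, h₀, Nat.sub_add_cancel (Nat.pos_of_ne_zero h₀)]
    · simp [toLeft, Cfg.tile, Cfg.next, move, add_assoc]
  · simp [toLeft, Cfg.tile, h]

theorem stay_tile (c : M.Cfg) (tr : M.Instr) (i : ℕ) : (c.tile tr i).stay =
    if c.head = i ∧ (c.next tr).head = i then some (c.next tr).state else none := by
  by_cases h : c.head = i
  · subst h
    rcases tr with - | ⟨q, b, d | d⟩
    · simp [stay, Cfg.tile, Cfg.next]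
    · by_cases h₀ : c.head = 0
      · simp [stay, Cfg.tile, Cfg.next, move, h₀]
      · simp [stay, Cfg.tile, Cfg.next, move, h₀, show c.head - 1 ≠ c.head by omega]
    · simp [stay, Cfg.tile, Cfg.next, move]
  · simp [stay, Cfg.tile, h]

theorem toRight_tile (c : M.Cfg) (tr : M.Instr) (i : ℕ) : (c.tile tr i).toRight =
    if c.head = i ∧ (c.next tr).head = i + 1 then some (c.next tr).state else none := by
  by_cases h : c.head = i
  · subst h
    rcases tr with - | ⟨q, b, d | d⟩ <;> simp [toRight, Cfg.tile, Cfg.next, move]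
  · simp [toRight, Cfg.tile, h]

theorem nextView_tile {L : ℕ} [NeZero L] {c : M.Cfg} (hc : c.head + 1 < L) (tr : M.Instr)
    (i : ZMod L) : nextView (c.tile tr i.val) (c.tile tr (i + 1).val) (c.tile tr (i + 2).val) =
      (c.next tr).view (i + 1).val := by
  have hsucc (x : ZMod L) : (x + 1).val = x.val + 1 ∨ x.val + 1 = L ∧ (x + 1).val = 0 :=
    (val_add_one_eq_or x).imp_right <| And.imp_right fun h => by rw [h, ZMod.val_zero]
  have h₁ := hsucc i
  have h₂ := hsucc (i + 1)
  rw [add_assoc, one_add_one_eq_two] at h₂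
  have hhead := c.head_next tr
  have hcases : (c.next tr).head = (i + 1).val ↔
      c.head = i.val ∧ (c.next tr).head = i.val + 1 ∨
        c.head = (i + 1).val ∧ (c.next tr).head = (i + 1).val ∨
          c.head = (i + 2).val ∧ (c.next tr).head + 1 = (i + 2).val := by
    omega
  rw [nextView, written_tile, toRight_tile, stay_tile, toLeft_tile, Cfg.view]
  rw [if_congr hcases rfl rfl]
  clear hcases hhead h₁ h₂ hsucc
  split_ifs <;> first | rfl | tauto

end Tile

theorem exists_eq_tile {L : ℕ} [NeZero L] {c : M.Cfg} (hc : c.head < L) {R : ZMod L → M.Tile}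
    (hvalid : ∀ i, (R i).IsValid) (hview : ∀ i, (R i).view = c.view i.val) :
    ∃ tr, Enabled c.state (c.tape c.head) tr ∧ ∀ i, R i = c.tile tr i.val := by
  simp only [Tile.view, Cfg.view, Prod.mk.injEq] at hview
  have hval := ZMod.val_cast_of_lt hc
  have hhead := (hview c.head).2.2
  rw [hval, if_pos rfl] at hhead
  obtain ⟨⟨q, tr⟩, htr, rfl⟩ := Option.map_eq_some_iff.1 hhead
  refine ⟨tr, ?_, fun i => ?_⟩
  · have := hvalid _ _ _ htr
    rwa [(hview _).2.1, hval] at this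
  · refine Prod.ext (hview i).1 (Prod.ext (hview i).2.1 ?_)
    by_cases hi : c.head = i.val
    · rw [← ZMod.natCast_zmod_val i, ← hi, htr]
      simp [Cfg.tile, hval]
    · have := (hview i).2.2
      rw [if_neg hi, Option.map_eq_none_iff] at this
      simp [Cfg.tile, this, hi]

theorem Reaches.snoc {n : ℕ} {c d e : M.Cfg} (h : M.Reaches n c d) (h' : M.Step d e) :
    M.Reaches (n + 1) c e := by
  induction n generalizing c with
  | zero =>
    cases h
    exact ⟨e, h', rfl⟩
  | succ n ih =>
    obtain ⟨c', hc, h⟩ := h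
    exact ⟨c', hc, ih h⟩

theorem exists_run : ∀ (n : ℕ) (c₀ c' : M.Cfg), M.Reaches n c₀ c' → c'.state = M.accept →
    ∃ (c : ℕ → M.Cfg) (tr : ℕ → M.Instr), c 0 = c₀ ∧ ∀ t, c (t + 1) = (c t).next (tr t) ∧
      Enabled (c t).state ((c t).tape (c t).head) (tr t)
  | 0, c₀, c', h, ha => by
    cases h
    exact ⟨fun _ => c₀, fun _ => none, rfl, fun t => ⟨rfl, ha⟩⟩
  | n + 1, c₀, c', ⟨d, ⟨hne, q, b, m, hδ, hd⟩, h⟩, ha => by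
    obtain ⟨c, tr, h₀, hc⟩ := exists_run n d c' h ha
    refine ⟨fun t => t.casesOn c₀ c, fun t => t.casesOn (some (q, b, m)) tr, rfl, fun t => ?_⟩
    cases t with
    | zero => exact ⟨h₀.trans hd, hne, hδ⟩
    | succ t => exact hc t

variable {L : ℕ} [NeZero L] {w : List α}

theorem exists_isTiling_of_accepts {n : ℕ} {c' : M.Cfg} (h : M.Reaches n (M.init w) c')
    (ha : c'.state = M.accept) : ∃ X, M.tileSystem.IsTiling w (L := L) X := by
  obtain ⟨c, tr, h₀, hc⟩ := exists_run n _ _ h ha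
  have hhead (t : ℕ) : (c t).head ≤ t := by
    induction t with
    | zero => exact h₀ ▸ le_rfl
    | succ t ih =>
      have := (c t).head_next (tr t)
      rw [(hc t).1]
      omega
  refine ⟨fun t i => (c t.val).tile (tr t.val) i.val, fun i => ?_, fun t i ht => ?_⟩
  · simp only [tileSystem, Finset.mem_filter_univ, Tile.view_tile]
    exact ⟨Tile.isValid_tile (hc _).2 _, by simp [h₀, Cfg.view_init]⟩
  · have hlt := (t + 1).val_lt
    rw [val_add_one_of_ne_zero ht] at hlt ⊢
    simp only [tileSystem, Finset.mem_filter_univ]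
    refine ⟨Tile.isValid_tile (hc _).2 _, ?_⟩
    rw [Tile.view_tile, (hc _).1, Tile.nextView_tile ((Nat.succ_le_succ (hhead _)).trans_lt hlt)]

theorem accepts_of_isTiling (hbound : ∀ n c, M.Reaches n (M.init w) c → n + 1 < L)
    {X : ZMod L → ZMod L → M.Tile} (hX : M.tileSystem.IsTiling w X) :
    ∃ n c, M.Reaches n (M.init w) c ∧ c.state = M.accept := by
  by_contra! hno
  have hrow (n : ℕ) (hn : n < L) : ∃ c tr, M.Reaches n (M.init w) c ∧ c.head ≤ n ∧
      Enabled c.state (c.tape c.head) tr ∧ ∀ i, X n i = c.tile tr i.val := by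
    induction n with
    | zero =>
      have hfirst := hX.first
      simp only [tileSystem, Finset.mem_filter_univ] at hfirst
      obtain ⟨tr, htr, hX₀⟩ := exists_eq_tile (c := M.init w) hn (fun i => (hfirst i).1)
        fun i => by simpa [Cfg.view_init] using (hfirst i).2
      exact ⟨_, tr, rfl, le_rfl, htr, by simpa using hX₀⟩
    | succ n ih =>
      obtain ⟨c, tr, hreach, hhead, htr, hXn⟩ := ih (by omega)
      have hstep : M.Step c (c.next tr) := by
        rcases tr with - | ⟨q, b, d⟩
        · exact absurd htr (hno _ _ hreach)
        · exact ⟨htr.1, q, b, d, htr.2, rfl⟩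
      have hnext (i : ZMod L) := hX.next n (i - 1) (natCast_add_one_ne_zero hn)
      simp only [tileSystem, Finset.mem_filter_univ, hXn] at hnext
      have hview (i : ZMod L) := Tile.nextView_tile (L := L) (c := c) (by omega) tr (i - 1)
      have := c.head_next tr
      obtain ⟨tr', htr', hX'⟩ := exists_eq_tile (c := c.next tr) (by omega)
        (fun i => (hnext i).1) fun i => by rw [(hnext i).2, hview, sub_add_cancel]
      exact ⟨_, tr', hreach.snoc hstep, by omega, htr', by simpa using hX'⟩
  obtain ⟨c, -, hreach, -⟩ := hrow (L - 1) (Nat.sub_lt (NeZero.pos L) one_pos)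
  have := hbound _ _ hreach
  omega

end NTM

/-! ### Stack programs -/

namespace StackProgram

open Turing Function StateTransition

variable {K : Type} (Γ : K → Type)

/-- Programs that work on stacks. The loop `loop k c` pops a symbol `x` from the stack `k` and runs
`c x`, until the stack `k` is empty. -/
inductive Cmd where
  | skip
  | push (k : K) (x : Γ k)
  | seq (a b : Cmd)
  | loop (k : K) (c : Γ k → Cmd)

/-- The contents of the stacks. -/
abbrev Stacks := ∀ k, List (Γ k)

variable {Γ} [DecidableEq K]

/-- `Exec c S S' n`: the program `c`, started with `S`, terminates with `S'`, and its cost, an upper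
bound on the number of steps of a Turing machine, is `n`. -/
inductive Exec : Cmd Γ → Stacks Γ → Stacks Γ → ℕ → Prop
  | skip (S : Stacks Γ) : Exec .skip S S 0
  | push (k : K) (x : Γ k) (S : Stacks Γ) : Exec (.push k x) S (update S k (x :: S k)) 1
  | seq {a b : Cmd Γ} {S S' S'' : Stacks Γ} {m n : ℕ} : Exec a S S' m → Exec b S' S'' n →
      Exec (.seq a b) S S'' (m + n)
  | loop_nil {k : K} {c : Γ k → Cmd Γ} {S : Stacks Γ} : S k = [] → Exec (.loop k c) S S 1
  | loop_cons {k : K} {c : Γ k → Cmd Γ} {S S' S'' : Stacks Γ} {x : Γ k} {l : List (Γ k)} {m n : ℕ} :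
      S k = x :: l → Exec (c x) (update S k l) S' m → Exec (.loop k c) S' S'' n →
      Exec (.loop k c) S S'' (m + n + 2)

theorem Exec.length_le {c : Cmd Γ} {S S' : Stacks Γ} {n : ℕ} (h : Exec c S S' n) (k : K) :
    (S' k).length ≤ (S k).length + n := by
  induction h with
  | skip => exact Nat.le_add_right _ _
  | push k' x S => rcases eq_or_ne k k' with rfl | hk <;> simp [*]
  | seq _ _ ih₁ ih₂ => omega
  | loop_nil => exact Nat.le_add_right _ _
  | @loop_cons k' c S S' S'' x l m n hS _ _ ih₁ ih₂ =>
    rcases eq_or_ne k k' with rfl | hk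
    · rw [update_self] at ih₁
      rw [hS, List.length_cons]
      omega
    · rw [update_of_ne hk] at ih₁
      omega

/-- The labels of a program: in a loop, `none` for the loop itself, and for the body that belongs to
`x`, `some ⟨x, none⟩` for its beginning and `some ⟨x, some l⟩` for its own labels `l`. -/
def Label : Cmd Γ → Type
  | .skip => Empty
  | .push _ _ => Empty
  | .seq a b => Label a ⊕ Label b
  | .loop k c => Option (Σ x : Γ k, Option (Label (c x)))

noncomputable instance Label.fintype [∀ k, Fintype (Γ k)] : ∀ c : Cmd Γ, Fintype (Label c)
  | .skip => inferInstanceAs (Fintype Empty)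
  | .push _ _ => inferInstanceAs (Fintype Empty)
  | .seq a b =>
    have := Label.fintype a
    have := Label.fintype b
    inferInstanceAs (Fintype (Label a ⊕ Label b))
  | .loop k c =>
    have := fun x => Label.fintype (c x)
    inferInstanceAs (Fintype (Option (Σ x : Γ k, Option (Label (c x)))))

/-- The internal states: the symbol popped last, unless the stack was empty. -/
abbrev Memory (Γ : K → Type) := Option (Σ k, Γ k)

variable {L : Type}

/-- The label to go to after the topmost symbol of the stack `k` has been popped. -/
def select (k : K) (f : Option (Γ k) → L) : Memory Γ → L
  | none => f none
  | some ⟨k', x⟩ => if h : k' = k then f (some (h ▸ x)) else f none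

/-- The statement that starts the program `c` and continues with `q`, if the labels of `c` are
embedded by `i` into those of the machine. -/
def entry : (c : Cmd Γ) → (Label c → L) → TM2.Stmt Γ L (Memory Γ) → TM2.Stmt Γ L (Memory Γ)
  | .skip, _, q => q
  | .push k x, _, q => .push k (fun _ => x) q
  | .seq a b, i, q => entry a (fun l => i (.inl l)) (entry b (fun l => i (.inr l)) q)
  | .loop _ _, i, _ => .goto fun _ => i none

/-- The statements that belong to the labels of the program `c`; see `entry`. -/
def code : (c : Cmd Γ) → (Label c → L) → TM2.Stmt Γ L (Memory Γ) → Label c →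
    TM2.Stmt Γ L (Memory Γ)
  | .skip, _, _ => Empty.elim
  | .push _ _, _, _ => Empty.elim
  | .seq a b, i, q => Sum.elim (code a (fun l => i (.inl l)) (entry b (fun l => i (.inr l)) q))
      (code b (fun l => i (.inr l)) q)
  | .loop k c, i, q => fun l => l.elim
      (.pop k (fun _ o => o.map (Sigma.mk k)) (.branch Option.isSome
        (.goto (select k fun o => i (o.map fun x => ⟨x, none⟩))) q))
      fun y => y.2.elim
        (entry (c y.1) (fun l => i (some ⟨y.1, some l⟩)) (.goto fun _ => i none))
        (code (c y.1) (fun l => i (some ⟨y.1, some l⟩)) (.goto fun _ => i none))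

/-- The machine with the statements `p` gets from `a` to `b` in at most `n` steps. -/
def Steps (p : L → TM2.Stmt Γ L (Memory Γ)) (n : ℕ) (a b : TM2.Cfg Γ L (Memory Γ)) : Prop :=
  Nonempty (EvalsToInTime (TM2.step p) a (some b) n)

section Steps

variable {p : L → TM2.Stmt Γ L (Memory Γ)}

theorem Steps.refl (a : TM2.Cfg Γ L (Memory Γ)) : Steps p 0 a a := ⟨.refl _ _⟩

theorem Steps.trans {m n : ℕ} {a b c : TM2.Cfg Γ L (Memory Γ)} :
    Steps p m a b → Steps p n b c → Steps p (n + m) a c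
  | ⟨h⟩, ⟨h'⟩ => ⟨.trans _ _ _ _ _ _ h h'⟩

theorem Steps.mono {m n : ℕ} {a b : TM2.Cfg Γ L (Memory Γ)} (hmn : m ≤ n) :
    Steps p m a b → Steps p n a b
  | ⟨h⟩ => ⟨⟨h.toEvalsTo, h.steps_le_m.trans hmn⟩⟩

theorem Steps.single (l : L) (v : Memory Γ) (S : Stacks Γ) :
    Steps p 1 ⟨some l, v, S⟩ (TM2.stepAux (p l) v S) :=
  ⟨⟨⟨1, rfl⟩, le_rfl⟩⟩

end Steps

section Loop

variable {k : K} {c : Γ k → Cmd Γ} {S : Stacks Γ} (i : Label (.loop k c) → L)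
  (q : TM2.Stmt Γ L (Memory Γ)) (v : Memory Γ)

theorem stepAux_code_loop_nil (hS : S k = []) :
    TM2.stepAux (code (.loop k c) i q none) v S = TM2.stepAux q none S := by
  have hupd : update S k [] = S := by rw [← hS, update_eq_self]
  simp [code, hS, hupd]

theorem stepAux_code_loop_cons {x : Γ k} {l : List (Γ k)} (hS : S k = x :: l) :
    TM2.stepAux (code (.loop k c) i q none) v S =
      ⟨some (i (some ⟨x, none⟩)), some ⟨k, x⟩, update S k l⟩ := by
  simp [code, hS, select]

end Loop

theorem Exec.steps {p : L → TM2.Stmt Γ L (Memory Γ)} {c : Cmd Γ} {S S' : Stacks Γ} {n : ℕ}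
    (h : Exec c S S' n) : ∀ (i : Label c → L) (q : TM2.Stmt Γ L (Memory Γ)) (v : Memory Γ),
      (∀ l, p (i l) = code c i q l) →
      ∃ v', Steps p n (TM2.stepAux (entry c i q) v S) (TM2.stepAux q v' S') := by
  induction h with
  | skip S => exact fun i q v _ => ⟨v, .refl _⟩
  | push k x S => exact fun i q v _ => ⟨v, (Steps.refl _).mono zero_le_one⟩
  | seq _ _ ih₁ ih₂ =>
    intro i q v hp
    obtain ⟨v₁, h₁⟩ := ih₁ _ (entry _ (fun l => i (.inr l)) q) v fun l => hp (.inl l)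
    obtain ⟨v₂, h₂⟩ := ih₂ _ q v₁ fun l => hp (.inr l)
    exact ⟨v₂, (h₁.trans h₂).mono (Nat.add_comm _ _).le⟩
  | @loop_nil k c S hS =>
    intro i q v hp
    have h₁ := Steps.single (p := p) (i none) v S
    rw [hp none, stepAux_code_loop_nil i q v hS] at h₁
    exact ⟨none, h₁⟩
  | @loop_cons k c S S' S'' x l m n hS _ _ ih₁ ih₂ =>
    intro i q v hp
    have h₁ := Steps.single (p := p) (i none) v S
    rw [hp none, stepAux_code_loop_cons i q v hS] at h₁
    have h₂ := Steps.single (p := p) (i (some ⟨x, none⟩)) (some ⟨k, x⟩) (update S k l)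
    rw [hp (some ⟨x, none⟩)] at h₂
    obtain ⟨v₃, h₃⟩ := ih₁ (fun l => i (some ⟨x, some l⟩)) (.goto fun _ => i none)
      (some ⟨k, x⟩) fun l => hp (some ⟨x, some l⟩)
    obtain ⟨v₄, h₄⟩ := ih₂ i q v₃ hp
    exact ⟨v₄, (((h₁.trans h₂).trans h₃).trans h₄).mono (by omega)⟩

/-- The Turing machine that runs a program. -/
noncomputable abbrev machine [Fintype K] [∀ k, Fintype (Γ k)] (k₀ k₁ : K) (c : Cmd Γ) : FinTM2 where
  K := K
  k₀ := k₀
  k₁ := k₁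
  Γ := Γ
  Λ := Option (Label c)
  main := none
  σ := Memory Γ
  initialState := none
  m l := l.elim (entry c some (.load (fun _ => none) .halt))
    (code c some (.load (fun _ => none) .halt))

theorem initList_eq (tm : FinTM2) (s : List (tm.Γ tm.k₀)) :
    initList tm s = ⟨some tm.main, tm.initialState, update (fun _ => []) tm.k₀ s⟩ := by
  unfold initList
  congr 1
  funext k
  by_cases hk : k = tm.k₀
  · subst hk
    simp
  · simp [hk]

theorem haltList_eq (tm : FinTM2) (s : List (tm.Γ tm.k₁)) :
    haltList tm s = ⟨none, tm.initialState, update (fun _ => []) tm.k₁ s⟩ := by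
  unfold haltList
  congr 1
  funext k
  by_cases hk : k = tm.k₁
  · subst hk
    simp
  · simp [hk]

variable {k₀ k₁ : K}

theorem Exec.outputsInTime [Fintype K] [∀ k, Fintype (Γ k)] {c : Cmd Γ} {s : List (Γ k₀)}
    {s' : List (Γ k₁)} {n : ℕ}
    (h : Exec c (update (fun _ => []) k₀ s) (update (fun _ => []) k₁ s') n) :
    Nonempty (TM2OutputsInTime (machine k₀ k₁ c) s (some s') (n + 1)) := by
  obtain ⟨_, hsteps⟩ := h.steps (p := (machine k₀ k₁ c).m) some (.load (fun _ => none) .halt) none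
    fun _ => rfl
  change Nonempty (EvalsToInTime _ (initList (machine k₀ k₁ c) s)
    (some (haltList (machine k₀ k₁ c) s')) _)
  rw [initList_eq, haltList_eq]
  exact (Steps.single (p := (machine k₀ k₁ c).m) none none _).trans hsteps

theorem computableInPolyTime_of_exec [Finite K] [∀ k, Finite (Γ k)]
    {f : List (Γ k₀) → List (Γ k₁)} (c : Cmd Γ) (t : Polynomial ℕ) (h : ∀ s, ∃ n ≤ t.eval s.length,
      Exec c (update (fun _ => []) k₀ s) (update (fun _ => []) k₁ (f s)) n) :
    Nonempty (TM2ComputableInPolyTime id id f) := by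
  have := Fintype.ofFinite K
  have := fun k => Fintype.ofFinite (Γ k)
  have houtputs (s : List (Γ k₀)) : Nonempty (TM2OutputsInTime (machine k₀ k₁ c)
      (s.map (Equiv.refl _).invFun) (some ((f s).map (Equiv.refl _).invFun))
      ((t + 1).eval s.length)) := by
    obtain ⟨n, hn, hexec⟩ := h s
    obtain ⟨out⟩ := hexec.outputsInTime
    have hle : n + 1 ≤ (t + 1).eval s.length := by simpa using hn
    have hs : s.map (Equiv.refl (Γ k₀)).invFun = s := List.map_id s
    have hfs : (f s).map (Equiv.refl (Γ k₁)).invFun = f s := List.map_id (f s)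
    rw [hs, hfs]
    exact ⟨⟨out.toEvalsTo, out.steps_le_m.trans hle⟩⟩
  exact ⟨⟨⟨machine k₀ k₁ c, Equiv.refl _, Equiv.refl _⟩, t + 1, fun s => (houtputs s).some⟩⟩

end StackProgram

/-! ### Registers -/

namespace StackProgram

open Function

/-- The stacks besides the one with the input. Text is printed to `buf` in reverse order, and
finally moved to `out`. Numbers are kept in unary: `size`, the indices `idx ℓ` of loops, and the
numbers `rest ℓ` of iterations that remain to be done. -/
inductive Reg where
  | out
  | buf
  | tmp
  | size
  | idx (ℓ : Fin 2)
  | rest (ℓ : Fin 2)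
  deriving DecidableEq, Fintype

variable {α β : Type}

variable (α β) in
/-- The alphabets of the stacks; `none` is the input. -/
def Alphabet : Option Reg → Type
  | none => α
  | some _ => β

instance Alphabet.finite [Finite α] [Finite β] : ∀ k, Finite (Alphabet α β k)
  | none => inferInstanceAs (Finite α)
  | some _ => inferInstanceAs (Finite β)

/-- The stacks with the input `w` and the registers `ρ`. -/
def contents (w : List α) (ρ : Reg → List β) : Stacks (Alphabet α β)
  | none => w
  | some v => ρ v

theorem update_contents_some (w : List α) (ρ : Reg → List β) (v : Reg) (l : List β) :
    update (contents w ρ) (some v) l = contents w (update ρ v l) := by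
  funext k
  cases k with
  | none => rfl
  | some u =>
    by_cases h : u = v
    · subst h
      exact (update_self _ _ _).trans (update_self (β := fun _ => List β) u l ρ).symm
    · exact (update_of_ne (by simpa using h) _ _).trans
        (update_of_ne (β := fun _ => List β) h l ρ).symm

theorem update_contents_none (w : List α) (ρ : Reg → List β) (l : List α) :
    update (contents w ρ) none l = contents l ρ := by
  funext k
  cases k with
  | none => exact update_self _ _ _
  | some u => exact update_of_ne (by simp) _ _

theorem contents_nil : contents [] (fun _ => []) = fun k => ([] : List (Alphabet α β k)) := by
  funext k
  cases k <;> rfl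

/-- The program `c`, started with the input `w` and the registers `ρ`, terminates with the input
`w'` and the registers `ρ'`, and its cost is at most `n`. -/
def Runs (c : Cmd (Alphabet α β)) (w : List α) (ρ : Reg → List β) (w' : List α)
    (ρ' : Reg → List β) (n : ℕ) : Prop :=
  ∃ m ≤ n, Exec c (contents w ρ) (contents w' ρ') m

namespace Runs

variable {a b : Cmd (Alphabet α β)} {w w' w'' : List α} {ρ ρ' ρ'' : Reg → List β} {m n : ℕ}

theorem congr (h : Runs a w ρ w' ρ' m) (hρ : ρ' = ρ'') (hmn : m ≤ n) : Runs a w ρ w' ρ'' n :=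
  let ⟨k, hk, h⟩ := h
  ⟨k, hk.trans hmn, hρ ▸ h⟩

theorem mono (h : Runs a w ρ w' ρ' m) (hmn : m ≤ n) : Runs a w ρ w' ρ' n := h.congr rfl hmn

theorem length_le (h : Runs a w ρ w' ρ' n) (v : Reg) : (ρ' v).length ≤ (ρ v).length + n :=
  let ⟨_, hm, h⟩ := h
  (h.length_le (some v)).trans (Nat.add_le_add_left hm _)

theorem length_input_le (h : Runs a w ρ w' ρ' n) : w'.length ≤ w.length + n :=
  let ⟨_, hm, h⟩ := h
  (h.length_le none).trans (Nat.add_le_add_left hm _)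

theorem skip : Runs (.skip : Cmd (Alphabet α β)) w ρ w ρ 0 := ⟨0, le_rfl, .skip _⟩

theorem push (v : Reg) (x : β) :
    Runs (.push (some v) x : Cmd (Alphabet α β)) w ρ w (update ρ v (x :: ρ v)) 1 := by
  refine ⟨1, le_rfl, ?_⟩
  rw [← update_contents_some]
  exact .push (Γ := Alphabet α β) (some v) x _

theorem seq (h : Runs a w ρ w' ρ' m) (h' : Runs b w' ρ' w'' ρ'' n) :
    Runs (.seq a b) w ρ w'' ρ'' (m + n) :=
  let ⟨_, hk, h⟩ := h
  let ⟨_, hk', h'⟩ := h'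
  ⟨_, Nat.add_le_add hk hk', h.seq h'⟩

theorem loop_nil {v : Reg} {c : β → Cmd (Alphabet α β)} (h : ρ v = []) :
    Runs (.loop (some v) c) w ρ w ρ 1 := ⟨1, le_rfl, .loop_nil h⟩

theorem loop_cons {v : Reg} {c : β → Cmd (Alphabet α β)} {x : β} {l : List β}
    (h : ρ v = x :: l) (h₁ : Runs (c x) w (update ρ v l) w' ρ' m)
    (h₂ : Runs (.loop (some v) c) w' ρ' w'' ρ'' n) :
    Runs (.loop (some v) c) w ρ w'' ρ'' (m + n + 2) := by
  obtain ⟨i, hi, h₁⟩ := h₁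
  obtain ⟨j, hj, h₂⟩ := h₂
  rw [← update_contents_some] at h₁
  exact ⟨i + j + 2, by omega, .loop_cons (Γ := Alphabet α β) (k := some v) h h₁ h₂⟩

theorem input_nil {c : α → Cmd (Alphabet α β)} : Runs (.loop none c) [] ρ [] ρ 1 :=
  ⟨1, le_rfl, .loop_nil rfl⟩

theorem input_cons {c : α → Cmd (Alphabet α β)} {x : α} {l : List α}
    (h₁ : Runs (c x) l ρ w' ρ' m) (h₂ : Runs (.loop none c) w' ρ' w'' ρ'' n) :
    Runs (.loop none c) (x :: l) ρ w'' ρ'' (m + n + 2) := by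
  obtain ⟨i, hi, h₁⟩ := h₁
  obtain ⟨j, hj, h₂⟩ := h₂
  rw [← update_contents_none (x :: l)] at h₁
  exact ⟨i + j + 2, by omega, .loop_cons (Γ := Alphabet α β) (k := none) (x := x) rfl h₁ h₂⟩

theorem loop {v : Reg} {c : β → Cmd (Alphabet α β)} {σ : ℕ → Reg → List β} {k : ℕ}
    (hn : σ n v = [])
    (h : ∀ j < n, ∃ x l, σ j v = x :: l ∧ Runs (c x) w (update (σ j) v l) w (σ (j + 1)) k) :
    Runs (.loop (some v) c) w (σ 0) w (σ n) ((k + 2) * n + 1) := by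
  induction n generalizing σ with
  | zero => exact (loop_nil hn).mono (by omega)
  | succ n ih =>
    obtain ⟨x, l, e, hr⟩ := h 0 n.succ_pos
    have := ih (σ := fun j => σ (j + 1)) hn fun j hj => h (j + 1) (Nat.succ_lt_succ hj)
    exact (loop_cons e hr this).mono (by ring_nf; omega)

end Runs

section Transfer

variable {w : List α} {ρ : Reg → List β}

/-- Moves the contents of `u` to `v`. -/
def moveCmd (u v : Reg) : Cmd (Alphabet α β) := .loop (some u) fun x => .push (some v) x

theorem runs_moveCmd {u v : Reg} (huv : u ≠ v) :
    Runs (moveCmd u v : Cmd (Alphabet α β)) w ρ w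
      (update (update ρ u []) v ((ρ u).reverse ++ ρ v)) (3 * (ρ u).length + 1) := by
  generalize hl : ρ u = l
  induction l generalizing ρ with
  | nil =>
    have hρ : update ρ u [] = ρ := by rw [← hl, update_eq_self]
    exact (Runs.loop_nil hl).congr (by simp [hρ]) le_rfl
  | cons x l ih =>
    have h := Runs.push (α := α) (w := w) (ρ := update ρ u l) v x
    have := ih (ρ := update (update ρ u l) v (x :: update ρ u l v)) (by simp [huv])
    refine (Runs.loop_cons hl h this).congr ?_ (by simp only [List.length_cons]; omega)
    funext y
    simp only [update_apply]
    split_ifs <;> simp_all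

/-- Empties `u`. -/
def drainCmd (u : Reg) : Cmd (Alphabet α β) := .loop (some u) fun _ => .skip

theorem runs_drainCmd (u : Reg) :
    Runs (drainCmd u : Cmd (Alphabet α β)) w ρ w (update ρ u []) (2 * (ρ u).length + 1) := by
  generalize hl : ρ u = l
  induction l generalizing ρ with
  | nil => exact (Runs.loop_nil hl).congr (by rw [← hl, update_eq_self]) le_rfl
  | cons x l ih =>
    have := ih (ρ := update ρ u l) (update_self ..)
    rw [update_idem] at this
    exact (Runs.loop_cons hl Runs.skip this).mono (by simp only [List.length_cons]; omega)

/-- Adds the number `u` to `v`. -/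
def addCmd (one : β) (u v : Reg) : Cmd (Alphabet α β) :=
  .seq (.loop (some u) fun x => .seq (.push (some .tmp) x) (.push (some v) one)) (moveCmd .tmp u)

theorem runs_addCmd_loop (one : β) {u v : Reg} (huv : u ≠ v) (hu : u ≠ .tmp) (hv : v ≠ .tmp) :
    Runs (.loop (some u) fun x => .seq (.push (some .tmp) x) (.push (some v) one) :
        Cmd (Alphabet α β)) w ρ w
      (update (update (update ρ u []) .tmp ((ρ u).reverse ++ ρ .tmp)) v
        (List.replicate (ρ u).length one ++ ρ v)) (4 * (ρ u).length + 1) := by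
  generalize hl : ρ u = l
  induction l generalizing ρ with
  | nil =>
    have hρ : update ρ u [] = ρ := by rw [← hl, update_eq_self]
    exact (Runs.loop_nil hl).congr (by simp [hρ]) le_rfl
  | cons x l ih =>
    have h := (Runs.push (α := α) (w := w) (ρ := update ρ u l) .tmp x).seq (Runs.push v one)
    have := ih (ρ := update (update (update ρ u l) .tmp (x :: update ρ u l .tmp)) v
      (one :: update (update ρ u l) .tmp (x :: update ρ u l .tmp) v)) (by simp [huv, hu])
    refine (Runs.loop_cons hl h this).congr ?_ (by simp only [List.length_cons]; omega)
    funext y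
    simp only [update_apply]
    split_ifs <;> simp_all [List.replicate_succ']

theorem runs_addCmd (one : β) {u v : Reg} (huv : u ≠ v) (hu : u ≠ .tmp) (hv : v ≠ .tmp)
    (htmp : ρ .tmp = []) :
    Runs (addCmd one u v : Cmd (Alphabet α β)) w ρ w
      (update ρ v (List.replicate (ρ u).length one ++ ρ v)) (7 * (ρ u).length + 2) := by
  refine ((runs_addCmd_loop one huv hu hv).seq (runs_moveCmd hu.symm)).congr ?_ ?_
  · funext y
    simp only [update_apply]
    split_ifs <;> simp_all
  · simp only [ne_eq, hv.symm, not_false_eq_true, update_of_ne, update_self, htmp,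
      List.append_nil, List.length_reverse]
    omega

end Transfer

section For

/-- The registers in the `j`-th iteration of a loop with the index `idx ℓ`, if `i` iterations remain
and the text `l` has been printed. -/
def loopState (one : β) (ℓ : Fin 2) (ρ : Reg → List β) (i j : ℕ) (l : List β) : Reg → List β :=
  update (update (update ρ (.rest ℓ) (List.replicate i one)) (.idx ℓ) (List.replicate j one)) .buf l

/-- Runs `c` for all values of `idx ℓ` from `0` to `size - 1`. -/
def forCmd (one : β) (ℓ : Fin 2) (c : Cmd (Alphabet α β)) : Cmd (Alphabet α β) :=
  .seq (addCmd one .size (.rest ℓ)) <| .seq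
    (.loop (some (.rest ℓ)) fun _ => .seq c (.push (some (.idx ℓ)) one)) (drainCmd (.idx ℓ))

theorem runs_forCmd {one : β} {ℓ : Fin 2} {c : Cmd (Alphabet α β)} {w : List α}
    {ρ : Reg → List β} {N k : ℕ} {g : ℕ → List β} (hsize : (ρ .size).length = N)
    (htmp : ρ .tmp = []) (hidx : ρ (.idx ℓ) = []) (hrest : ρ (.rest ℓ) = [])
    (hc : ∀ i, ∀ j < N, ∀ l,
      Runs c w (loopState one ℓ ρ i j l) w (loopState one ℓ ρ i j ((g j).reverse ++ l)) k) :
    Runs (forCmd one ℓ c) w ρ w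
      (update ρ .buf (((List.range N).flatMap g).reverse ++ ρ .buf))
      (7 * N + 2 + ((k + 3) * N + 1 + (2 * N + 1))) := by
  let σ (j : ℕ) : Reg → List β :=
    loopState one ℓ ρ (N - j) j (((List.range j).flatMap g).reverse ++ ρ .buf)
  have hstart : Runs (addCmd one .size (.rest ℓ)) w ρ w (σ 0) (7 * N + 2) := by
    refine (runs_addCmd one (by simp) (by simp) (by simp) htmp).congr ?_ (by rw [hsize])
    funext y
    simp only [σ, loopState, update_apply]
    split_ifs <;> simp_all
  have hloop : Runs (.loop (some (.rest ℓ)) fun _ => .seq c (.push (some (.idx ℓ)) one)) w (σ 0) w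
      (σ N) ((k + 3) * N + 1) := by
    refine Runs.loop (by simp [σ, loopState]) fun j hj =>
      ⟨one, List.replicate (N - (j + 1)) one, ?_, ?_⟩
    · rw [← List.replicate_succ, show N - (j + 1) + 1 = N - j by omega]
      simp [σ, loopState]
    · have hpop : update (σ j) (.rest ℓ) (List.replicate (N - (j + 1)) one) =
          loopState one ℓ ρ (N - (j + 1)) j (((List.range j).flatMap g).reverse ++ ρ .buf) := by
        funext y
        simp only [σ, loopState, update_apply]
        split_ifs <;> simp_all
      rw [hpop]
      refine ((hc _ j hj _).seq (Runs.push (.idx ℓ) one)).congr ?_ le_rfl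
      funext y
      simp only [σ, loopState, update_apply]
      split_ifs <;> simp_all [List.range_succ, List.replicate_succ]
  refine (hstart.seq (hloop.seq (runs_drainCmd (.idx ℓ)))).congr ?_ (by simp [σ, loopState])
  funext y
  simp only [σ, loopState, update_apply]
  split_ifs <;> simp_all

end For

end StackProgram

/-! ### Printable texts -/

namespace StackProgram

open Turing Function

variable {α β : Type}

/-- A program that uses the loops `ℓ ∈ I` may be started with the registers `ρ`, and the numbers in
them are at most `B`. -/
structure IsReady (I : Set (Fin 2)) (B : ℕ) (ρ : Reg → List β) : Prop where
  tmp : ρ .tmp = []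
  idx : ∀ ℓ ∈ I, ρ (.idx ℓ) = []
  rest : ∀ ℓ ∈ I, ρ (.rest ℓ) = []
  size_le : (ρ .size).length ≤ B
  idx_le : ∀ ℓ, (ρ (.idx ℓ)).length ≤ B

variable (α) in
/-- Some program prints the text `f`, which may depend on the number `size` and the indices of the
loops, in time polynomial in these numbers. It uses the loops `ℓ ∈ I` only. -/
def Prints (I : Set (Fin 2)) (f : ℕ → (Fin 2 → ℕ) → List β) : Prop :=
  ∃ (c : Cmd (Alphabet α β)) (t : Polynomial ℕ), ∀ (w : List α) (ρ : Reg → List β) (B : ℕ),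
    IsReady I B ρ → Runs c w ρ w (update ρ .buf
      ((f (ρ .size).length fun ℓ => (ρ (.idx ℓ)).length).reverse ++ ρ .buf)) (t.eval B)

section IsReady

variable {I J : Set (Fin 2)} {B : ℕ} {ρ : Reg → List β}

theorem IsReady.mono (h : IsReady J B ρ) (hIJ : I ⊆ J) : IsReady I B ρ :=
  { h with
    idx := fun ℓ hℓ => h.idx ℓ (hIJ hℓ)
    rest := fun ℓ hℓ => h.rest ℓ (hIJ hℓ) }

theorem IsReady.update_buf (h : IsReady I B ρ) (l : List β) : IsReady I B (update ρ .buf l) := by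
  constructor <;> simp [h.tmp, h.size_le, h.idx_le] <;> simp +contextual [h.idx, h.rest]

theorem IsReady.loopState {ℓ : Fin 2} (hℓ : ℓ ∉ I) (h : IsReady I B ρ) (one : β) (i : ℕ) {j : ℕ}
    (hj : j ≤ B) (l : List β) : IsReady I B (loopState one ℓ ρ i j l) := by
  have hne (k : Fin 2) (hk : k ∈ I) : k ≠ ℓ := fun heq => hℓ (heq ▸ hk)
  constructor
  · simp [StackProgram.loopState, h.tmp]
  · intro k hk
    simp [StackProgram.loopState, hne k hk, h.idx k hk]
  · intro k hk
    simp [StackProgram.loopState, hne k hk, h.rest k hk]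
  · simp [StackProgram.loopState, h.size_le]
  · intro k
    rcases eq_or_ne k ℓ with rfl | hk
    · simp [StackProgram.loopState, hj]
    · simp [StackProgram.loopState, hk, h.idx_le k]

end IsReady

namespace Prints

variable {I J : Set (Fin 2)} {f g : ℕ → (Fin 2 → ℕ) → List β}

theorem mono (h : Prints α I f) (hIJ : I ⊆ J) : Prints α J f :=
  let ⟨c, t, h⟩ := h
  ⟨c, t, fun w ρ B hρ => h w ρ B (hρ.mono hIJ)⟩

theorem append (hf : Prints α I f) (hg : Prints α I g) :
    Prints α I fun N e => f N e ++ g N e := by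
  obtain ⟨c, t, hc⟩ := hf
  obtain ⟨d, s, hd⟩ := hg
  refine ⟨.seq c d, t + s, fun w ρ B hρ => ?_⟩
  simpa using (hc w ρ B hρ).seq (hd w _ B (hρ.update_buf _))

theorem nil : Prints α I fun _ _ => ([] : List β) :=
  ⟨.skip, 0, fun w ρ B _ => by simpa using Runs.skip⟩

theorem singleton (x : β) : Prints α I fun _ _ => [x] :=
  ⟨.push (some .buf) x, 1, fun w ρ B _ => by simpa using Runs.push .buf x⟩

theorem cons (x : β) (hf : Prints α I f) : Prints α I fun N e => x :: f N e :=
  (singleton x).append hf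

theorem flatMap {ι : Type} (l : List ι) {f : ι → ℕ → (Fin 2 → ℕ) → List β}
    (h : ∀ i, Prints α I (f i)) : Prints α I fun N e => l.flatMap fun i => f i N e := by
  induction l with
  | nil => exact nil
  | cons x l ih => exact (h x).append ih

theorem const (l : List β) : Prints α I fun _ _ => l := by
  simpa using flatMap l (α := α) (I := I) (f := fun x _ _ => [x]) singleton

theorem size (one : β) : Prints α I fun N _ => List.replicate N one := by
  refine ⟨addCmd one .size .buf, 7 * .X + 2, fun w ρ B hρ => ?_⟩
  refine (runs_addCmd one (by simp) (by simp) (by simp) hρ.tmp).congr (by simp) ?_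
  simpa using hρ.size_le

theorem index (one : β) (ℓ : Fin 2) : Prints α I fun _ e => List.replicate (e ℓ) one := by
  refine ⟨addCmd one (.idx ℓ) .buf, 7 * .X + 2, fun w ρ B hρ => ?_⟩
  refine (runs_addCmd one (by simp) (by simp) (by simp) hρ.tmp).congr (by simp) ?_
  simpa using hρ.idx_le ℓ

theorem loop (one : β) {ℓ : Fin 2} (hℓ : ℓ ∉ I) (hf : Prints α I f) :
    Prints α (insert ℓ I) fun N e => (List.range N).flatMap fun j => f N (update e ℓ j) := by
  obtain ⟨c, t, hc⟩ := hf
  refine ⟨forCmd one ℓ c, 7 * .X + 2 + ((t + 3) * .X + 1 + (2 * .X + 1)), fun w ρ B hρ => ?_⟩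
  have hI := Set.mem_insert ℓ I
  refine (runs_forCmd (k := t.eval B) rfl hρ.tmp (hρ.idx ℓ hI) (hρ.rest ℓ hI)
    fun i j hj l => ?_).mono ?_
  · have hrun := hc w _ B ((hρ.mono (Set.subset_insert ℓ I)).loopState hℓ one i
      (hj.le.trans hρ.size_le) l)
    have hidx : (fun k => (loopState one ℓ ρ i j l (.idx k)).length) =
        update (fun k => (ρ (.idx k)).length) ℓ j := by
      funext k
      rcases eq_or_ne k ℓ with rfl | hk
      · simp [loopState]
      · simp [loopState, hk]
    rw [hidx] at hrun
    exact hrun.congr (update_idem ..) le_rfl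
  · have := hρ.size_le
    simp only [Polynomial.eval_add, Polynomial.eval_mul, Polynomial.eval_X, Polynomial.eval_ofNat,
      Polynomial.eval_one]
    gcongr

theorem loop_inner (one : β) {f : ℕ → ℕ → ℕ → List β} (hf : Prints α ∅ fun N e => f N (e 0) (e 1)) :
    Prints α {1} fun N e => (List.range N).flatMap (f N (e 0)) := by
  simpa using hf.loop one (ℓ := 1) (by simp)

theorem loop_outer (one : β) {f : ℕ → ℕ → List β} (hf : Prints α {1} fun N e => f N (e 0)) :
    Prints α Set.univ fun N _ => (List.range N).flatMap (f N) := by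
  have := hf.loop one (ℓ := 0) (by simp)
  simp only [update_self] at this
  exact this.mono (Set.subset_univ _)

end Prints

end StackProgram

/-! ### Programs in polynomial time -/

namespace StackProgram

open Turing Function

variable {α β : Type} {one : β}

/-- The data between the phases of a printing program: the rest of the input, the number `size`, and
the printed text. -/
structure State (α β : Type) where
  input : List α
  size : ℕ
  printed : List β

/-- The registers that hold the data `s`. -/
def State.registers (one : β) (s : State α β) : Reg → List β :=
  update (update (fun _ => []) .size (List.replicate s.size one)) .buf s.printed.reverse

/-- Some program computes `F` in time polynomial in the lengths of the data. -/
def IsPolyTime (one : β) (F : State α β → State α β) : Prop :=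
  ∃ (c : Cmd (Alphabet α β)) (t : Polynomial ℕ), ∀ (s : State α β) (B : ℕ),
    s.input.length ≤ B → s.size ≤ B → s.printed.length ≤ B →
      Runs c s.input (s.registers one) (F s).input ((F s).registers one) (t.eval B)

theorem IsPolyTime.comp {F G : State α β → State α β} (hG : IsPolyTime one G)
    (hF : IsPolyTime one F) : IsPolyTime one (G ∘ F) := by
  obtain ⟨c, t, hc⟩ := hF
  obtain ⟨d, u, hd⟩ := hG
  refine ⟨.seq c d, t + u.comp (.X + t), fun s B hinput hsize hprinted => ?_⟩
  have hrun := hc s B hinput hsize hprinted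
  have hsize' := hrun.length_le .size
  have hprinted' := hrun.length_le .buf
  simp only [State.registers, update_self, ne_eq, reduceCtorEq, not_false_eq_true, update_of_ne,
    List.length_replicate, List.length_reverse] at hsize' hprinted'
  have := hrun.seq (hd (F s) (B + t.eval B) (hrun.length_input_le.trans (by omega)) (by omega)
    (by omega))
  simpa using this

theorem Prints.exists_runs {f : ℕ → List β} (one : β) (h : Prints α Set.univ fun N _ => f N) :
    ∃ (c : Cmd (Alphabet α β)) (t : Polynomial ℕ), ∀ (s : State α β) (B : ℕ), s.size ≤ B →
      Runs c s.input (s.registers one) s.input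
        (State.registers one { s with printed := s.printed ++ f s.size }) (t.eval B) := by
  obtain ⟨c, t, hc⟩ := h
  refine ⟨c, t, fun s B hsize => ?_⟩
  have := hc s.input (s.registers one) B (by constructor <;> simp [State.registers, hsize])
  simpa [State.registers] using this

theorem Prints.isPolyTime_append {f : ℕ → List β} (one : β)
    (h : Prints α Set.univ fun N _ => f N) :
    IsPolyTime one fun s : State α β => { s with printed := s.printed ++ f s.size } :=
  let ⟨c, t, hc⟩ := h.exists_runs one
  ⟨c, t, fun s B _ hsize _ => hc s B hsize⟩

theorem Prints.isPolyTime_size {f : ℕ → ℕ} {one : β}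
    (h : Prints α Set.univ fun N _ => List.replicate (f N) one) :
    IsPolyTime one fun s : State α β => { s with size := f s.size } := by
  obtain ⟨c, t, hc⟩ := h
  refine ⟨.seq (moveCmd .buf .out) (.seq c (.seq (drainCmd .size) (.seq (moveCmd .buf .size)
    (moveCmd .out .buf)))), (3 * .X + 1) + (t + ((2 * .X + 1) + ((3 * t + 1) + (3 * .X + 1)))),
    fun s B _ hsize hprinted => ?_⟩
  have hprint := hc s.input (update (update (s.registers one) .buf []) .out
    ((s.registers one .buf).reverse ++ s.registers one .out)) B
    (by constructor <;> simp [State.registers, hsize])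
  have hlen : f s.size ≤ t.eval B := by simpa [State.registers] using hprint.length_le .buf
  refine ((runs_moveCmd (by simp)).seq (hprint.seq ((runs_drainCmd .size).seq
    ((runs_moveCmd (by simp)).seq (runs_moveCmd (by simp)))))).congr ?_ ?_
  · funext v
    simp only [State.registers, update_apply]
    split_ifs <;> simp_all
  · simp only [State.registers, update_self, List.length_reverse, update_idem, List.reverse_reverse,
      ne_eq, reduceCtorEq, not_false_eq_true, update_of_ne, List.append_nil, List.length_replicate,
      List.reverse_replicate, Polynomial.eval_add, Polynomial.eval_mul, Polynomial.eval_ofNat,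
      Polynomial.eval_X, Polynomial.eval_one]
    omega

theorem isPolyTime_square :
    IsPolyTime one fun s : State α β => { s with size := s.size * s.size } := by
  have h := Prints.loop_outer (α := α) one (f := fun N _ => List.replicate N one) (Prints.size one)
  have hsquare (N : ℕ) : ((List.range N).flatMap fun _ => List.replicate N one) =
      List.replicate (N * N) one := by
    simp [List.eq_replicate_iff]
  simp only [hsquare] at h
  exact h.isPolyTime_size (f := fun N => N * N)

theorem isPolyTime_pow (k : ℕ) :
    IsPolyTime one fun s : State α β => { s with size := s.size ^ 2 ^ k } := by
  induction k with
  | zero => simpa using (Prints.size one).isPolyTime_size (f := fun N => N)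
  | succ k ih =>
    have := isPolyTime_square.comp ih
    simpa only [comp_def, ← sq, ← pow_mul, ← pow_succ] using this

theorem runs_input {g : α → ℕ → List β} {c : α → Cmd (Alphabet α β)} {T B : ℕ}
    (h : ∀ a (s : State α β), s.size ≤ B → Runs (c a) s.input (s.registers one) s.input
      (State.registers one { s with printed := s.printed ++ g a s.size }) T)
    (s : State α β) (hB : s.size + s.input.length ≤ B) :
    Runs (.loop none fun a => .seq (c a) (.push (some .size) one)) s.input (s.registers one) []
      (State.registers (α := α) one ⟨[], s.size + s.input.length,
        s.printed ++ (s.input.zipIdx s.size).flatMap fun p => g p.1 p.2⟩)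
      ((T + 3) * s.input.length + 1) := by
  obtain ⟨w, N, l⟩ := s
  induction w generalizing N l with
  | nil => exact Runs.input_nil.congr (by simp [State.registers]) (by simp)
  | cons a w ih =>
    rw [List.length_cons] at hB
    have hfirst := (h a ⟨w, N, l⟩ (by grind)).seq (Runs.push .size one)
    have hrest := ih (N + 1) (l ++ g a N) (by grind)
    have hpush : update (State.registers (α := α) one ⟨w, N, l ++ g a N⟩) .size
        (one :: State.registers (α := α) one ⟨w, N, l ++ g a N⟩ .size) =
          State.registers (α := α) one ⟨w, N + 1, l ++ g a N⟩ := by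
      funext y
      simp only [State.registers, update_apply]
      split_ifs <;> simp_all [List.replicate_succ]
    rw [hpush] at hfirst
    refine (Runs.input_cons hfirst hrest).congr ?_ (by simp only [List.length_cons]; ring_nf; omega)
    simp [State.registers, Nat.add_right_comm, ← add_assoc]

theorem isPolyTime_input [Finite α] {g : α → ℕ → List β} (one : β)
    (hg : ∀ a, Prints α Set.univ fun N _ => g a N) :
    IsPolyTime one fun s : State α β =>
      ⟨[], s.size + s.input.length,
        s.printed ++ (s.input.zipIdx s.size).flatMap fun p => g p.1 p.2⟩ := by
  have := Fintype.ofFinite α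
  choose c t hc using fun a => (hg a).exists_runs one
  refine ⟨.loop none fun a => .seq (c a) (.push (some .size) one),
    ((∑ a, t a).comp (2 * .X) + 3) * .X + 1, fun s B hinput hsize _ => ?_⟩
  have hle (a : α) : (t a).eval (2 * B) ≤ (∑ a, t a).eval (2 * B) := by
    rw [Polynomial.eval_finsetSum]
    exact Finset.single_le_sum (f := fun a => (t a).eval (2 * B)) (fun _ _ => Nat.zero_le _)
      (Finset.mem_univ a)
  refine (runs_input (fun a s hs => (hc a s (2 * B) hs).mono (hle a)) s (by omega)).mono ?_
  simp only [Polynomial.eval_add, Polynomial.eval_mul, Polynomial.eval_comp, Polynomial.eval_X,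
    Polynomial.eval_ofNat, Polynomial.eval_one]
  gcongr

theorem IsPolyTime.computableInPolyTime [Finite α] [Finite β] {F : State α β → State α β}
    {f : List α → List β} (h : IsPolyTime one F) (hF : ∀ w, F ⟨w, 0, []⟩ = ⟨[], 0, f w⟩) :
    Nonempty (TM2ComputableInPolyTime id id f) := by
  obtain ⟨c, t, hc⟩ := h
  refine computableInPolyTime_of_exec (Γ := Alphabet α β) (k₀ := none) (k₁ := some .out)
    (.seq c (moveCmd .buf .out)) (4 * t + 1) fun (w : List α) => ?_
  have hrun := hc ⟨w, 0, []⟩ w.length le_rfl (Nat.zero_le _) (Nat.zero_le _)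
  have hstart : State.registers one (⟨w, 0, []⟩ : State α β) = fun _ => [] := by
    funext v
    simp only [State.registers, update_apply]
    split_ifs <;> rfl
  rw [hF w, hstart] at hrun
  have hlen : (f w).length ≤ t.eval w.length := by
    simpa [State.registers] using hrun.length_le .buf
  obtain ⟨n, hn, hexec⟩ : Runs (.seq c (moveCmd .buf .out)) w (fun _ => []) []
      (update (fun _ => []) .out (f w)) ((4 * t + 1).eval w.length) := by
    refine (hrun.seq (runs_moveCmd (by simp))).congr ?_ ?_
    · funext v
      simp only [State.registers, update_apply]
      split_ifs <;> simp_all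
    · simp only [State.registers, update_self, List.length_reverse, Polynomial.eval_add,
        Polynomial.eval_mul, Polynomial.eval_ofNat, Polynomial.eval_one]
      omega
  refine ⟨n, hn, ?_⟩
  rw [← contents_nil, update_contents_none, update_contents_some]
  exact hexec

theorem computableInPolyTime_of_prints [Finite α] [Finite β] (one : β) (pre : List β)
    {g : α → ℕ → List β} {h G : ℕ → List β} (hg : ∀ a, Prints α Set.univ fun N _ => g a N)
    (hh : Prints α Set.univ fun N _ => h N) (hG : Prints α Set.univ fun N _ => G N) (k : ℕ) :
    Nonempty (TM2ComputableInPolyTime (id : List α → List α) (id : List β → List β) fun w =>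
      pre ++ ((w.zipIdx.flatMap fun p => g p.1 p.2) ++
        (h w.length ++ G ((w.length + 2) ^ 2 ^ k)))) := by
  have hadd : Prints α Set.univ fun N _ => List.replicate (N + 2) one :=
    ((Prints.size one).cons one).cons one
  have hzero : Prints α Set.univ fun _ _ => List.replicate 0 one := Prints.nil
  have hphases := (hzero.isPolyTime_size (f := fun _ => 0)).comp <|
    (hG.isPolyTime_append one).comp <| (isPolyTime_pow k).comp <|
    (hadd.isPolyTime_size (f := fun N => N + 2)).comp <|
    (hh.isPolyTime_append one).comp <| (isPolyTime_input one hg).comp <|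
    (Prints.const pre).isPolyTime_append one
  exact IsPolyTime.computableInPolyTime hphases fun w => by simp

end StackProgram

/-! ### Printing the knowledge base and the query -/

namespace DL.Reduction

open StackProgram

theorem listEnc_eq_flatMap {ι : Type} (enc : ι → List Sym) (l : List ι) :
    listEnc enc l = l.flatMap (fun a => .cons :: enc a) ++ [.nil] := by
  induction l with
  | nil => rfl
  | cons a l ih => simp [listEnc, ih]

/-- The contribution of an atom to the encoding of a conjunction. -/
def atomText (q : CQ) : List Sym := .inter :: q.enc

theorem enc_conjunction (l : List CQ) (q : CQ) :
    (conjunction l q).enc = l.flatMap atomText ++ q.enc := by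
  induction l with
  | nil => rfl
  | cons a l ih => simp_all [conjunction, CQ.enc, atomText]

theorem enc_unaryName_cons (a : ℕ) (l : List ℕ) : (unaryName (a :: l)).enc =
    List.replicate a (Sym.bit true) ++ Sym.bit false :: (unaryName l).enc := by
  simp [Name.enc, unaryName_cons]

/-- The contribution of an inclusion to the encoding of a TBox. -/
def inclusionText (τ : TAxiom) : List Sym := .cons :: τ.enc

/-- The contribution of a clause to the encoding of a TBox. -/
def Clause.text {T : Type} [Encodable T] (φ : Clause T) : List Sym := inclusionText φ.toInclusion

theorem Var.enc_term {T : Type} [Encodable T] (x : Var T) :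
    x.term.enc = .var :: x.name.enc := rfl

variable {α β T : Type} [Encodable T] {I : Set (Fin 2)}

theorem prints_replicate_succ {t : ℕ → (Fin 2 → ℕ) → ℕ} {x : β}
    (h : Prints α I fun N e => List.replicate (t N e) x) :
    Prints α I fun N e => List.replicate (t N e + 1) x := h.cons x

section Clauses

theorem prints_succClauses {t : ℕ → (Fin 2 → ℕ) → ℕ} {a c b : ℕ → (Fin 2 → ℕ) → ℕ → Letter T}
    (ha : Prints α I fun N e => (ConLabel.letter (a N e (t N e))).name.enc)
    (hc : Prints α I fun N e => (ConLabel.letter (c N e (t N e))).name.enc)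
    (hc' : Prints α I fun N e => (ConLabel.letter (c N e (t N e + 1))).name.enc)
    (hb : Prints α I fun N e => (ConLabel.letter (b N e (t N e))).name.enc) :
    Prints α I fun N e =>
      (succClauses (a N e) (c N e) (b N e) (t N e)).flatMap Clause.text := by
  simp only [succClauses, List.flatMap_cons, List.flatMap_nil, Clause.text, inclusionText,
    Clause.toInclusion, bodyConcept, headConcept, TAxiom.enc, Concept.enc]
  with_reducible repeat' first
    | exact Prints.const _ | assumption | apply Prints.append | apply Prints.cons

theorem prints_copyClauses (κ : Kind) (x : Axis) :
    Prints α I fun _ e => (copyClauses (T := T) κ x (e 0)).flatMap Clause.text := by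
  have hj := Prints.index (α := α) (I := I) (Sym.bit true) 0
  cases κ <;> cases x <;>
  simp only [copyClauses, Kind.digit, List.flatMap_cons, List.flatMap_nil, Clause.text,
    inclusionText, Clause.toInclusion, bodyConcept, headConcept, TAxiom.enc, Concept.enc,
    ConLabel.name, ConLabel.code, Letter.code, ClaimBit.code, enc_unaryName_cons] <;>
  with_reducible repeat' first
    | exact Prints.const _ | assumption | apply Prints.append | apply Prints.cons

theorem prints_counterClauses (g : Counter) : Prints α I fun _ e =>
    (succClauses (T := T) g.digit (.carry g) (.sum g) (e 0)).flatMap Clause.text := by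
  have hj := Prints.index (α := α) (I := I) (Sym.bit true) 0
  apply prints_succClauses (t := fun _ e => e 0) <;> cases g <;>
  simp only [Counter.digit, ConLabel.name, ConLabel.code, Letter.code, enc_unaryName_cons] <;>
  with_reducible repeat' first
    | exact Prints.const _ | assumption | apply Prints.append | apply Prints.cons
    | apply prints_replicate_succ

theorem prints_bitClauses :
    Prints α I fun _ e => (bitClauses (T := T) (e 0)).flatMap Clause.text := by
  have hj := Prints.index (α := α) (I := I) (Sym.bit true) 0
  simp only [bitClauses, List.flatMap_append, List.flatMap_assoc]
  refine .append ?_ (.append ?_ (.append (.flatMap _ prints_counterClauses)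
    (.flatMap _ fun κ => .flatMap _ (prints_copyClauses κ))))
  all_goals
    simp only [List.map_cons, List.map_nil, List.flatMap_cons, List.flatMap_nil, Clause.text,
      inclusionText, Clause.toInclusion, bodyConcept, headConcept, TAxiom.enc, Concept.enc,
      ConLabel.name, ConLabel.code, Letter.code, enc_unaryName_cons]
    with_reducible repeat' first
      | exact Prints.const _ | assumption | apply Prints.append | apply Prints.cons

theorem prints_chainClauses :
    Prints α {1} fun N e => (chainClauses (T := T) N (e 0)).flatMap Clause.text := by
  have hindex := fun ℓ I => Prints.index (α := α) (I := I) (Sym.bit true) ℓ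
  have hN := Prints.size (α := α) (I := {1}) (Sym.bit true)
  simp only [chainClauses, List.flatMap_append, List.flatMap_assoc]
  refine .append ?_ (.loop_inner (Sym.bit true)
    (f := fun _ s j => (succClauses (.chain s) (.chainCarry s) (.chain (s + 1)) j).flatMap
      Clause.text) (prints_succClauses (t := fun _ e => e 1) ?_ ?_ ?_ ?_))
  all_goals
    simp only [List.flatMap_cons, List.flatMap_nil, Clause.text, inclusionText,
      Clause.toInclusion, bodyConcept, headConcept, TAxiom.enc, Concept.enc, ConLabel.name,
      ConLabel.code, Letter.code, enc_unaryName_cons]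
    with_reducible repeat' first
      | exact Prints.const _ | assumption | apply hindex | apply Prints.append | apply Prints.cons
      | apply prints_replicate_succ

theorem prints_choiceClauses :
    Prints α I fun N _ => (choiceClauses (T := T) N).flatMap Clause.text := by
  have hN := Prints.size (α := α) (I := I) (Sym.bit true)
  simp only [choiceClauses, List.flatMap_append]
  refine .append (.const _) ?_
  simp only [List.flatMap_cons, List.flatMap_nil, Clause.text, inclusionText,
    Clause.toInclusion, bodyConcept, headConcept, TAxiom.enc, Concept.enc, ConLabel.name,
    ConLabel.code, Letter.code, enc_unaryName_cons]
  with_reducible repeat' first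
    | exact Prints.const _ | assumption | apply Prints.append | apply Prints.cons

theorem prints_tileClauses (S : TileSystem α T) (τ : T × T × T) :
    Prints α I fun N _ => (tileClauses S N τ).flatMap Clause.text := by
  have hN := Prints.size (α := α) (I := I) (Sym.bit true)
  simp only [tileClauses, List.flatMap_cons, List.flatMap_nil, Clause.text, inclusionText,
    Clause.toInclusion, bodyConcept, headConcept, TAxiom.enc, Concept.enc, ConLabel.name,
    ConLabel.code, Letter.code, enc_unaryName_cons]
  with_reducible repeat' first
    | exact Prints.const _ | assumption | apply Prints.append | apply Prints.cons

theorem prints_initClauses [Encodable α] (S : TileSystem α T) (o : Option α) :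
    Prints α I fun N _ => (initClauses S N o).flatMap Clause.text := by
  have hN := Prints.size (α := α) (I := I) (Sym.bit true)
  simp only [initClauses, List.flatMap_cons, List.flatMap_nil, Clause.text, inclusionText,
    Clause.toInclusion, bodyConcept, headConcept, TAxiom.enc, Concept.enc, ConLabel.name,
    ConLabel.code, Letter.code, enc_unaryName_cons]
  with_reducible repeat' first
    | exact Prints.const _ | assumption | apply Prints.append | apply Prints.cons

theorem prints_letterClauses [Encodable α] (a : α) :
    Prints α I fun N _ => (letterClauses (T := T) N a).flatMap Clause.text := by
  have hN := Prints.size (α := α) (I := I) (Sym.bit true)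
  simp only [letterClauses, List.flatMap_cons, List.flatMap_nil, Clause.text, inclusionText,
    Clause.toInclusion, bodyConcept, headConcept, TAxiom.enc, Concept.enc, ConLabel.name,
    ConLabel.code, Letter.code, enc_unaryName_cons]
  with_reducible repeat' first
    | exact Prints.const _ | assumption | apply Prints.append | apply Prints.cons
    | apply prints_replicate_succ

theorem prints_blankClause [Encodable α] : Prints α I fun N _ =>
    (⟨[.columnGe N, .symbolNe (Encodable.encode (none : Option α))], []⟩ : Clause T).text := by
  have hN := Prints.size (α := α) (I := I) (Sym.bit true)
  simp only [Clause.text, inclusionText, Clause.toInclusion, bodyConcept, headConcept,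
    TAxiom.enc, Concept.enc, ConLabel.name, ConLabel.code, Letter.code, enc_unaryName_cons]
  with_reducible repeat' first
    | exact Prints.const _ | assumption | apply Prints.append | apply Prints.cons

theorem prints_generalClauses [Encodable α] [Fintype α] [Fintype T] (S : TileSystem α T) :
    Prints α Set.univ fun N _ => (generalClauses S N).flatMap Clause.text := by
  simp only [generalClauses, List.flatMap_append, List.flatMap_assoc]
  exact .append (.loop_outer (Sym.bit true) (f := fun _ j => (bitClauses j).flatMap Clause.text)
      prints_bitClauses) <|
    .append (.loop_outer (Sym.bit true) (f := fun N s => (chainClauses N s).flatMap Clause.text)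
      prints_chainClauses) <|
    .append prints_choiceClauses <| .append (.const _) <|
    .append (.flatMap _ (prints_tileClauses S)) (.flatMap _ (prints_initClauses S))

end Clauses

section Inclusions

theorem prints_levelInclusions :
    Prints α I fun _ e => (levelInclusions T (e 0)).flatMap inclusionText := by
  have hj := Prints.index (α := α) (I := I) (Sym.bit true) 0
  simp only [levelInclusions, List.flatMap_assoc]
  refine .flatMap _ fun b => ?_
  simp only [List.flatMap_cons, List.flatMap_nil, inclusionText, splitInclusion, inheritInclusion,
    TAxiom.enc, Concept.enc, SRole.enc, ConLabel.name, ConLabel.code, Letter.code,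
    enc_unaryName_cons]
  with_reducible repeat' first
    | exact Prints.const _ | assumption | apply Prints.append | apply Prints.cons
    | apply prints_replicate_succ

theorem prints_leafInclusion (τ : T × T × T) :
    Prints α I fun N _ => inclusionText (leafInclusion N τ) := by
  have hN := Prints.size (α := α) (I := I) (Sym.bit true)
  simp only [inclusionText, leafInclusion, TAxiom.enc, Concept.enc, SRole.enc, ConLabel.name,
    ConLabel.code, enc_unaryName_cons]
  with_reducible repeat' first
    | exact Prints.const _ | assumption | apply Prints.append | apply Prints.cons

theorem prints_claimInclusion {p : ℕ → (Fin 2 → ℕ) → ClaimBit T}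
    (hp : Prints α I fun N e => (unaryName (p N e).code).enc) (b : Bool) :
    Prints α I fun N e => inclusionText (claimInclusion (p N e) b) := by
  cases b <;>
  simp only [inclusionText, claimInclusion, cond_true, cond_false, TAxiom.enc, Concept.enc,
    SRole.enc, ConLabel.name, ConLabel.code, Letter.code, enc_unaryName_cons] <;>
  with_reducible repeat' first
    | exact Prints.const _ | assumption | apply Prints.append | apply Prints.cons

theorem prints_claimBit_digit (x : Axis) :
    Prints α I fun _ e => (unaryName (ClaimBit.digit (T := T) x (e 0)).code).enc := by
  simpa only [ClaimBit.code, enc_unaryName_cons] using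
    (Prints.const _).append (((Prints.index _ 0).append (.const _)).cons _)

theorem prints_flatMap_bits [Fintype T] {f : ℕ → ClaimBit T → List Sym}
    (hf : ∀ p : ℕ → ClaimBit T, (∀ J, Prints α J fun _ e => (unaryName (p (e 0)).code).enc) →
      Prints α {1} fun N e => f N (p (e 0))) :
    Prints α Set.univ fun N _ => (bits N).flatMap (f N) := by
  simp only [bits, List.flatMap_append, List.flatMap_assoc, List.flatMap_map]
  refine .append (.flatMap _ fun x => ?_) (.flatMap _ fun ρ => ?_)
  · exact .loop_outer (Sym.bit true) (f := fun N j => f N (.digit x j))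
      (hf (fun j => .digit x j) fun _ => prints_claimBit_digit x)
  · exact (hf (fun _ => .tile ρ) fun _ => .const _).mono (Set.subset_univ _)

end Inclusions

section Query

theorem text_chainAtoms_succ (t : ℕ → Term) (n : ℕ) :
    (chainAtoms t (n + 1)).flatMap atomText = atomText (edgeAtom (t 0) (t 1)) ++
      (List.range n).flatMap fun l => atomText (edgeAtom (t (l + 1)) (t (l + 1 + 1))) := by
  simp [chainAtoms, List.range_succ_eq_map, List.flatMap_map]

variable {p : ℕ → ClaimBit T}

theorem prints_legAtoms (hp : ∀ J, Prints α J fun _ e => (unaryName (p (e 0)).code).enc)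
    (b c : Bool) {u : ℕ → (Fin 2 → ℕ) → Term} (hu : Prints α {1} fun N e => (u N e).enc) :
    Prints α {1} fun N e => (legAtoms N (p (e 0)) b c (u N e)).flatMap atomText := by
  have hN := Prints.size (α := α) (I := {1}) (Sym.bit true)
  have hl := Prints.index (α := α) (I := ∅) (Sym.bit true) 1
  simp only [legAtoms, List.flatMap_append, text_chainAtoms_succ]
  refine .append (.append ?_ (.loop_inner (Sym.bit true) (f := fun _ j l => atomText (edgeAtom
    (legTerm (p j) b c (l + 1)) (legTerm (p j) b c (l + 1 + 1)))) ?_)) ?_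
  all_goals
    simp only [List.flatMap_cons, List.flatMap_nil, atomText, edgeAtom, bitAtom, legTerm, CQ.enc,
      Var.enc_term, Var.name, Var.code, enc_unaryName_cons]
    with_reducible repeat' first
      | exact Prints.const _ | assumption | apply hp | apply Prints.append | apply Prints.cons
      | apply prints_replicate_succ

theorem prints_blockAtoms (hp : ∀ J, Prints α J fun _ e => (unaryName (p (e 0)).code).enc)
    (b : Bool) {u u' : ℕ → (Fin 2 → ℕ) → Term} (hu : Prints α {1} fun N e => (u N e).enc)
    (hu' : Prints α {1} fun N e => (u' N e).enc) :
    Prints α {1} fun N e =>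
      (blockAtoms N (p (e 0)) b (u N e) (u' N e)).flatMap atomText := by
  simp only [blockAtoms, List.flatMap_append]
  exact (prints_legAtoms hp b false hu).append (prints_legAtoms hp b true hu')

theorem prints_compareAtoms (hp : ∀ J, Prints α J fun _ e => (unaryName (p (e 0)).code).enc) :
    Prints α {1} fun N e => (compareAtoms N (p (e 0))).flatMap atomText := by
  have hN := Prints.size (α := α) (I := {1}) (Sym.bit true)
  simp only [compareAtoms, List.flatMap_append]
  refine .append (.append (.append (.append ?_ (prints_blockAtoms hp _ ?_ ?_))
    (prints_blockAtoms hp _ ?_ ?_)) ?_) ?_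
  all_goals
    simp only [readAtoms, List.flatMap_cons, List.flatMap_nil, atomText, bitAtom, pathTerm, CQ.enc,
      Var.enc_term, ConLabel.name, ConLabel.code, Var.name, Var.code, enc_unaryName_cons]
    with_reducible repeat' first
      | exact Prints.const _ | assumption | apply hp | apply Prints.append | apply Prints.cons

theorem prints_query [Fintype T] : Prints α Set.univ fun N _ => (query T N).enc := by
  have hN := Prints.size (α := α) (I := Set.univ) (Sym.bit true)
  have hl := Prints.index (α := α) (I := {1}) (Sym.bit true) 0
  simp only [query, enc_conjunction, List.flatMap_append, List.flatMap_assoc,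
    text_chainAtoms_succ]
  refine .append (.append (.append (.append (.const _) (.loop_outer (Sym.bit true)
    (f := fun _ l => atomText (edgeAtom (pathTerm T (l + 1)) (pathTerm T (l + 1 + 1)))) ?_))
    (prints_flatMap_bits fun p hp => prints_compareAtoms hp)) ?_) (.const _)
  all_goals
    simp only [List.flatMap_cons, List.flatMap_nil, atomText, edgeAtom, pathTerm, CQ.enc,
      Var.enc_term, Var.name, Var.code, enc_unaryName_cons]
    with_reducible repeat' first
      | exact Prints.const _ | assumption | apply Prints.append | apply Prints.cons
      | apply prints_replicate_succ

end Query

section Input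

variable [Encodable α] [Fintype α] [Fintype T] (S : TileSystem α T)

theorem prints_tbox :
    Prints α Set.univ fun N _ => (kb N (generalClauses S N)).tbox.flatMap inclusionText := by
  simp only [kb, List.flatMap_append, List.flatMap_assoc, List.flatMap_map,
    List.flatMap_cons, List.flatMap_nil]
  exact .append (prints_generalClauses S) <|
    .append (.loop_outer (Sym.bit true)
      (f := fun _ j => (levelInclusions T j).flatMap inclusionText) prints_levelInclusions) <|
    .append (.flatMap _ prints_leafInclusion) <|
    .append (prints_flatMap_bits fun p hp => .append (prints_claimInclusion (hp _) false) <|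
      .append (prints_claimInclusion (hp _) true) .nil) (.const _)

theorem encInput_kb (N : ℕ) (w : List α) : encInput (kb N (clauses S N w)) (query T N) =
    listEnc AAxiom.enc [.concept (ConLabel.level (T := T) 0).name root] ++
      ((w.zipIdx.flatMap fun p => (letterClauses (T := T) p.2 p.1).flatMap Clause.text) ++
        ((⟨[.columnGe w.length, .symbolNe (Encodable.encode (none : Option α))], []⟩ :
            Clause T).text ++
          ((kb N (generalClauses S N)).tbox.flatMap inclusionText ++
            .nil :: (query T N).enc))) := by
  have hlist : ∀ l, listEnc TAxiom.enc l = l.flatMap inclusionText ++ [.nil] := listEnc_eq_flatMap _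
  have htext : Clause.text (T := T) = fun φ => inclusionText φ.toInclusion := rfl
  simp only [encInput, kb, clauses, wordClauses, hlist, List.map_append, List.flatMap_append,
    List.flatMap_map, htext, List.flatMap_assoc, List.flatMap_cons, List.flatMap_nil,
    List.append_assoc, List.cons_append, List.nil_append, List.append_nil]

theorem computableInPolyTime_encInput (k : ℕ) :
    Nonempty (Turing.TM2ComputableInPolyTime (id : List α → List α) (id : List Sym → List Sym)
      fun w => encInput (kb ((w.length + 2) ^ 2 ^ k) (clauses S ((w.length + 2) ^ 2 ^ k) w))
        (query T ((w.length + 2) ^ 2 ^ k))) := by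
  simp only [encInput_kb]
  exact computableInPolyTime_of_prints (Sym.bit true) _ prints_letterClauses prints_blankClause
    (G := fun N => (kb N (generalClauses S N)).tbox.flatMap inclusionText ++
      .nil :: (query T N).enc) ((prints_tbox S).append (prints_query.cons _)) k

end Input

end DL.Reduction

namespace DL.Reduction

/-! ### The reduction -/

theorem exists_eval_le_pow (p : Polynomial ℕ) : ∃ k, ∀ n, p.eval n ≤ (n + 2) ^ k := by
  induction p using Polynomial.induction_on' with
  | add p q hp hq =>
    obtain ⟨k, hp⟩ := hp
    obtain ⟨l, hq⟩ := hq
    refine ⟨k + l + 1, fun n => ?_⟩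
    calc
      (p + q).eval n ≤ (n + 2) ^ k + (n + 2) ^ l := by
        rw [Polynomial.eval_add]
        exact Nat.add_le_add (hp n) (hq n)
      _ ≤ (n + 2) ^ (k + l) + (n + 2) ^ (k + l) := by gcongr <;> omega
      _ ≤ (n + 2) ^ (k + l + 1) := by
        rw [pow_succ]
        nlinarith [Nat.zero_le ((n + 2) ^ (k + l) * n)]
  | monomial i a =>
    refine ⟨a + i, fun n => ?_⟩
    rw [Polynomial.eval_monomial, pow_add]
    have ha : a ≤ (n + 2) ^ a := Nat.lt_two_pow_self.le.trans (Nat.pow_le_pow_left (by omega) a)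
    gcongr
    omega

theorem encInput_mem_iff {IsKB : KB → Prop} {K : KB} {q : CQ} (hK : IsKB K) (hq : q.IsRooted) :
    encInput K q ∈ RootedCQEntailment IsKB ↔ K.Entails q := by
  constructor
  · rintro ⟨K', q', heq, -, -, h⟩
    obtain ⟨rfl, rfl⟩ := encInput_inj _ _ _ _ heq
    exact h
  · exact fun h => ⟨K, q, rfl, hK, hq, h⟩

theorem exists_two_pow_lt (p : Polynomial ℕ) : ∃ k, ∀ n, n ≤ (n + 2) ^ 2 ^ k ∧
    2 ^ p.eval n + 1 < 2 ^ (n + 2) ^ 2 ^ k := by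
  obtain ⟨k, hk⟩ := exists_eval_le_pow (p + 2)
  refine ⟨k, fun n => ?_⟩
  have hbase : n + 2 ≤ (n + 2) ^ 2 ^ k := Nat.le_self_pow (by positivity) _
  have hle : p.eval n + 2 ≤ (n + 2) ^ 2 ^ k := by
    refine le_trans ?_ (Nat.pow_le_pow_right (by omega) Nat.lt_two_pow_self.le)
    simpa using hk n
  refine ⟨by omega, ?_⟩
  calc
    2 ^ p.eval n + 1 < 2 ^ (p.eval n + 2) := by
      rw [pow_add]
      have := Nat.one_le_two_pow (n := p.eval n)
      omega
    _ ≤ 2 ^ (n + 2) ^ 2 ^ k := Nat.pow_le_pow_right two_pos hle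

theorem mem_iff_exists_isTiling {α : Type} {L : Language α} {M : NTM α} {t : ℕ → ℕ}
    (hM : M.DecidesInTime L t) {w : List α} {m : ℕ} [NeZero m] (hm : t w.length + 1 < m) :
    w ∈ L ↔ ∃ X, M.tileSystem.IsTiling w (L := m) X := by
  rw [hM.2 w]
  constructor
  · rintro ⟨n, c, h, ha⟩
    exact NTM.exists_isTiling_of_accepts h ha
  · rintro ⟨X, hX⟩
    exact NTM.accepts_of_isTiling (fun n c h => by have := hM.1 w n c h; omega) hX

theorem coNExpTimeHard {IsKB : KB → Prop} (hKB : ∀ K : KB, K.IsALCSelf → IsKB K) :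
    CoNExpTimeHard (RootedCQEntailment IsKB) := by
  rintro α _ L ⟨p, M, hM⟩
  have := Fintype.toEncodable α
  obtain ⟨k, hk⟩ := exists_two_pow_lt p
  refine ⟨_, computableInPolyTime_encInput M.tileSystem k, fun w => ?_⟩
  obtain ⟨hw, hbound⟩ := hk w.length
  have hN : 0 < (w.length + 2) ^ 2 ^ k := by positivity
  rw [encInput_mem_iff (hKB _ (kb_isALCSelf _ _)) (query_isRooted hN),
    entails_iff_not_exists_isTiling hw hN, ← mem_iff_exists_isTiling hM hbound]
  exact not_not.symm

end DL.Reduction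

theorem mainTheorem5 :
    CoNExpTimeHard (DL.RootedCQEntailment DL.KB.IsALCSelf) ∧
      CoNExpTimeHard (DL.RootedCQEntailment DL.KB.IsZIQ) :=
  ⟨DL.Reduction.coNExpTimeHard fun _ h => h, DL.Reduction.coNExpTimeHard fun _ h => h.isZIQ⟩
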